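/- Let $(M,g,J)$ be a connected, complete, non-compact Kähler manifold: $M$ is a (finite-dimensional) connected complex manifold with complex structure $J$, and $g$ is a smooth complete Riemannian metric on $M$ with $g(JX,JY)=g(X,Y)$ for all tangent vectors $X,Y$ and $\nabla J=0$, where $\nabla$ is the Levi-Civita connection of $g$. Assume that $(M,g,J)$ has positive holomorphic sectional curvature, that is, $$H(v)=g\big(R(v,Jv)Jv,v\big)>0\qquad\text{for every } p\in M \text{ and every unit vector } v\in T_pM,$$ where $R(X,Y)Z=\nabla_X\nabla_YZ-\nabla_Y\nabla_XZ-\nabla_{[X,Y]}Z$ is the Riemann curvature tensor of $g$. Then $M$ has finitely many ends: $e(M)<+\infty$. Here, for an exhaustion $\{K_l\}$ of $M$ by compact sets with $K_l\subset\operatorname{int}K_{l+1}$, an end is a decreasing sequence $\{V_l\}$ in which each $V_l$ is an unbounded (i.e. not relatively compact) connected component of $M\setminus K_l$, and $e(M)$ is the number of ends; the assertion holds for every such exhaustion. -/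

import Mathlib

open Bundle
open scoped Manifold ContDiff Topology

noncomputable section

namespace KahlerEnds

section ComplexManifold

variable {E : Type*} [NormedAddCommGroup E] [NormedSpace ℂ E]
  {M : Type*} [TopologicalSpace M] [ChartedSpace E M]

/-- A complex manifold is in particular a real manifold, with the same charts. -/
instance isManifold_real [IsManifold 𝓘(ℂ, E) ω M] : IsManifold 𝓘(ℝ, E) ω M := by
  refine isManifold_of_contDiffOn 𝓘(ℝ, E) ω M fun e e' he he' ↦ ?_
  have h := (contDiffGroupoid ω 𝓘(ℂ, E)).compatible he he'
  rw [contDiffGroupoid, mem_groupoid_of_pregroupoid] at h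
  exact h.1.restrict_scalars ℝ

/-- The complex structure `J` of a complex manifold: multiplication by `i` in the tangent space
`T_x M`, which is identified with the complex vector space `E` by the derivative at `x` of the
preferred (holomorphic) chart at `x`. -/
def J (x : M) : TangentSpace 𝓘(ℝ, E) x →L[ℝ] TangentSpace 𝓘(ℝ, E) x :=
  (Complex.I • ContinuousLinearMap.id ℝ E : E →L[ℝ] E)

/-- The vector field `Y` read in the chart centred at `c`, as a map from coordinates to `E`. -/
def fieldInChart (Y : Π x : M, TangentSpace 𝓘(ℝ, E) x) (c : M) (y : E) : E :=
  mfderiv 𝓘(ℝ, E) 𝓘(ℝ, E) (extChartAt 𝓘(ℝ, E) c) ((extChartAt 𝓘(ℝ, E) c).symm y)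
    (Y ((extChartAt 𝓘(ℝ, E) c).symm y))

end ComplexManifold

section Metric

variable {E : Type*} [NormedAddCommGroup E] [NormedSpace ℂ E]
  {M : Type*} [TopologicalSpace M] [ChartedSpace E M]
  [RiemannianBundle (fun x : M ↦ TangentSpace 𝓘(ℝ, E) x)]

/-- The Riemannian metric `g` read in the chart centred at `c`: at the point with coordinates `y`
it is the bilinear form `(u, v) ↦ g (dψ_y u, dψ_y v)`, where `ψ` is the inverse of the chart. -/
def metricInChart (c : M) (y : E) : E →L[ℝ] E →L[ℝ] ℝ :=
  (innerSL ℝ (E := TangentSpace 𝓘(ℝ, E) ((extChartAt 𝓘(ℝ, E) c).symm y))).bilinearComp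
    (mfderiv 𝓘(ℝ, E) 𝓘(ℝ, E) (extChartAt 𝓘(ℝ, E) c).symm y)
    (mfderiv 𝓘(ℝ, E) 𝓘(ℝ, E) (extChartAt 𝓘(ℝ, E) c).symm y)

theorem metricInChart_apply (c : M) (y u v : E) :
    metricInChart c y u v =
      inner ℝ (mfderiv 𝓘(ℝ, E) 𝓘(ℝ, E) (extChartAt 𝓘(ℝ, E) c).symm y u)
        (mfderiv 𝓘(ℝ, E) 𝓘(ℝ, E) (extChartAt 𝓘(ℝ, E) c).symm y v) :=
  rfl

/-- The Christoffel symbol of the Levi-Civita connection of `g` in the chart centred at `c`: with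
`G = metricInChart c`, the vector `Γ = christoffel c y u v` is determined by
`G (Γ, w) = (1/2) (∂_u G (v, w) + ∂_v G (u, w) - ∂_w G (u, v))` for all `w`. -/
def christoffel (c : M) (y u v : E) : E :=
  (metricInChart c y).inverse
    ((1 / 2 : ℝ) • (fderiv ℝ (metricInChart c) y u v + fderiv ℝ (metricInChart c) y v u
      - ((fderiv ℝ (metricInChart c) y).flip u).flip v))

/-- The Christoffel symbols satisfy their defining equation at all points of the chart. -/
theorem metricInChart_christoffel [FiniteDimensional ℂ E] [IsManifold 𝓘(ℂ, E) ω M]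
    (c : M) (y u v w : E) (hy : y ∈ (extChartAt 𝓘(ℝ, E) c).target) :
    metricInChart c y (christoffel c y u v) w =
      (1 / 2) * (fderiv ℝ (metricInChart c) y u v w + fderiv ℝ (metricInChart c) y v u w
        - fderiv ℝ (metricInChart c) y w u v) := by
  have hinj : Function.Injective (metricInChart c y) := by
    rw [injective_iff_map_eq_zero]
    intro a ha
    have h1 := DFunLike.congr_fun ha a
    rw [metricInChart_apply] at h1
    have h2 := (inner_self_eq_zero (𝕜 := ℝ)).1 h1
    have hi := isInvertible_mfderivWithin_extChartAt_symm (I := 𝓘(ℝ, E)) hy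
    simp only [modelWithCornersSelf_coe, Set.range_id, mfderivWithin_univ] at hi
    obtain ⟨e, he⟩ := hi
    rw [← he] at h2
    exact e.map_eq_zero_iff.1 h2
  have : (metricInChart c y).IsInvertible := by
    have hd : Module.finrank ℝ E = Module.finrank ℝ (E →L[ℝ] ℝ) := by
      rw [← LinearMap.toContinuousLinearMap.finrank_eq]
      exact (Subspace.dual_finrank_eq).symm
    refine ⟨((metricInChart c y).toLinearMap.linearEquivOfInjective
      hinj hd).toContinuousLinearEquiv, ?_⟩
    ext; rfl
  have h2 := DFunLike.congr_fun (this.self_comp_inverse)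
    ((1 / 2 : ℝ) • (fderiv ℝ (metricInChart c) y u v + fderiv ℝ (metricInChart c) y v u
      - ((fderiv ℝ (metricInChart c) y).flip u).flip v))
  have h3 := DFunLike.congr_fun h2 w
  simpa [christoffel] using h3

/-- The covariant derivative in the chart centred at `c`, at the point with coordinates `y`, of a
coordinate vector field `Y` in the direction `v`: `∂_v Y + Γ (v, Y)`. -/
def covDerivInChart (c : M) (Y : E → E) (y v : E) : E :=
  fderiv ℝ Y y v + christoffel c y v (Y y)

/-- The Levi-Civita covariant derivative `∇_v Y` at `x` of the vector field `Y` in the direction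
`v`, computed in the chart centred at `x` (whose derivative at `x` identifies `T_x M` with `E`). -/
def leviCivita (Y : Π x : M, TangentSpace 𝓘(ℝ, E) x) (x : M) (v : TangentSpace 𝓘(ℝ, E) x) :
    TangentSpace 𝓘(ℝ, E) x :=
  covDerivInChart (E := E) x (fieldInChart Y x) (extChartAt 𝓘(ℝ, E) x x) v

/-- The Riemann curvature tensor in the chart centred at `c`, with the sign convention
`R(u, v) w = ∇_u ∇_v w - ∇_v ∇_u w - ∇_[u, v] w`: it is
`∂_u Γ (v, w) - ∂_v Γ (u, w) + Γ (u, Γ (v, w)) - Γ (v, Γ (u, w))`. -/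
def curvatureInChart (c : M) (y u v w : E) : E :=
  fderiv ℝ (fun z : E ↦ christoffel c z v w) y u - fderiv ℝ (fun z : E ↦ christoffel c z u w) y v
    + christoffel c y u (christoffel c y v w) - christoffel c y v (christoffel c y u w)

/-- The Riemann curvature tensor `R(u, v) w` at `x`, computed in the chart centred at `x`. -/
def curvature (x : M) (u v w : TangentSpace 𝓘(ℝ, E) x) : TangentSpace 𝓘(ℝ, E) x :=
  curvatureInChart (E := E) x (extChartAt 𝓘(ℝ, E) x x) u v w

/-- The holomorphic sectional curvature `H(v) = g (R(v, Jv) Jv, v)`; for a unit vector `v` and a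
`J`-invariant metric it is the sectional curvature of the plane spanned by `v` and `Jv`. -/
def holSecCurvature (x : M) (v : TangentSpace 𝓘(ℝ, E) x) : ℝ :=
  inner ℝ (curvature x v (J x v) (J x v)) v

variable (E M) in
/-- The Riemannian metric of the complex manifold `M` is Kähler: it is `J`-invariant, and `J` is
parallel for the Levi-Civita connection, that is, `(∇_v J) Y = ∇_v (J Y) - J (∇_v Y) = 0`. -/
structure IsKahler [IsManifold 𝓘(ℝ, E) 1 M] : Prop where
  inner_J : ∀ (x : M) (u v : TangentSpace 𝓘(ℝ, E) x), inner ℝ (J x u) (J x v) = inner ℝ u v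
  parallel_J : ∀ (Y : Π x : M, TangentSpace 𝓘(ℝ, E) x) (x : M),
    MDifferentiableAt 𝓘(ℝ, E) 𝓘(ℝ, E).tangent (fun z ↦ (⟨z, Y z⟩ : TangentBundle 𝓘(ℝ, E) M)) x →
      ∀ v : TangentSpace 𝓘(ℝ, E) x,
        leviCivita (fun z ↦ J z (Y z)) x v = J x (leviCivita Y x v)

variable (E M) in
/-- All holomorphic sectional curvatures of `M` are positive. -/
def PositiveHolSecCurvature : Prop :=
  ∀ (x : M) (v : TangentSpace 𝓘(ℝ, E) x), ‖v‖ = 1 → 0 < holSecCurvature x v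

end Metric

section Ends

variable {M : Type*} [TopologicalSpace M]

/-- The ends of `M` with respect to a compact exhaustion `K`: decreasing sequences `V` of sets such
that each `V l` is an unbounded (i.e. not relatively compact) connected component of the complement
of `K l`. -/
def ends (K : CompactExhaustion M) : Set (ℕ → Set M) :=
  {V | Antitone V ∧ ∀ l, (∃ x ∈ (K l)ᶜ, V l = connectedComponentIn (K l)ᶜ x) ∧
    ¬ IsCompact (closure (V l))}

/-- The number of ends `e(M)`, computed with the compact exhaustion `K`. -/
def numEnds (K : CompactExhaustion M) : ℕ∞ := (ends K).encard

end Ends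

end KahlerEnds

end

noncomputable section

namespace KahlerEnds

open Set Filter MeasureTheory

set_option linter.unusedSectionVars false

/-! ### Smoothness of the metric coefficients and length of curves in a chart -/

section ChartGeometry

variable {E : Type*} [NormedAddCommGroup E] [NormedSpace ℂ E]
  {M : Type*} [TopologicalSpace M] [ChartedSpace E M] [IsManifold 𝓘(ℂ, E) ω M]

/-! The manifold has at most one end: two ends would produce a line, that is, an isometric embedding
of ℝ, and positive holomorphic sectional curvature forbids lines.

Existence of the line is metric geometry. A complete locally compact length space is proper
(`HasShortPaths.properSpace`). A nearly shortest path between far away points of two different ends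
must cross a fixed compact set. Parametrised by the distance from its starting point and recentred
at the crossing, it is almost isometric on a long interval; properness yields a limit, which is an
isometry of ℝ into M (`HasShortPaths.exists_isometry_of_ends`).

A line γ is excluded by second variation (`not_isometry_of_positive`). Since J is parallel, Jγ' is a
parallel unit normal field. Displacing γ by s f Jγ', with f vanishing at ±L, changes the length by
(s²/2) ∫ (f'² - f² H(γ')) + o(s²). For f = 1 - t²/L² the first term of the integral is O(1/L), while
the second stays above a positive constant because H is positive near γ(0); no uniform lower bound
on H is needed. For large L the displaced curve is shorter than 2L = dist(γ(-L), γ(L)), a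
contradiction.

The differential geometry is done in charts, without the exponential map. A curve realizing
distances is a priori only continuous. Comparing distances with the metric frozen at a point and
using the parallelogram law, its second differences are O(h^(3/2)), so it is C¹ with unit speed
(`exists_hasDerivAt_of_isometry`); the first variation and the du Bois-Reymond lemma then give the
geodesic equation (`hasDerivAt_of_minimizing`).

The displaced point at γ(t) is the complexified second order Taylor polynomial of γ in a chart,
evaluated at z = i s f(t). Coordinate changes are holomorphic, so this point is independent of the
chart up to o(s²) (`eventually_dist_jetPoint_le`), and the estimates in successive charts add up by
the triangle inequality alone. In one chart, the Kähler condition makes the Christoffel symbols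
complex bilinear, which turns the second derivative of the energy density into 2f'² - 2f²H
(`varEnergy_derivs`). -/

theorem isOpen_chart_target (c : M) : IsOpen (extChartAt 𝓘(ℝ, E) c).target :=
  isOpen_extChartAt_target c

theorem mdifferentiableAt_chart_symm {c : M} {y : E} (hy : y ∈ (extChartAt 𝓘(ℝ, E) c).target) :
    MDifferentiableAt 𝓘(ℝ, E) 𝓘(ℝ, E) (extChartAt 𝓘(ℝ, E) c).symm y := by
  have := mdifferentiableWithinAt_extChartAt_symm (I := 𝓘(ℝ, E)) hy
  simpa only [modelWithCornersSelf_coe, Set.range_id, mdifferentiableWithinAt_univ] using this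

theorem mfderiv_chart_symm_injective {c : M} {y : E}
    (hy : y ∈ (extChartAt 𝓘(ℝ, E) c).target) :
    Function.Injective (mfderiv 𝓘(ℝ, E) 𝓘(ℝ, E) (extChartAt 𝓘(ℝ, E) c).symm y) := by
  have hi := isInvertible_mfderivWithin_extChartAt_symm (I := 𝓘(ℝ, E)) hy
  simp only [modelWithCornersSelf_coe, Set.range_id, mfderivWithin_univ] at hi
  obtain ⟨e, he⟩ := hi
  rw [← he]
  exact e.injective

/-- The tangent map of the inverse chart is smooth, and this is its composition with a constant
vector field on E. -/
theorem contMDiffOn_chart_symm_section (c : M) (w : E) : ContMDiffOn 𝓘(ℝ, E) 𝓘(ℝ, E).tangent ∞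
    (fun y : E ↦ (⟨(extChartAt 𝓘(ℝ, E) c).symm y,
      mfderiv 𝓘(ℝ, E) 𝓘(ℝ, E) (extChartAt 𝓘(ℝ, E) c).symm y w⟩ : TangentBundle 𝓘(ℝ, E) M))
    (extChartAt 𝓘(ℝ, E) c).target := by
  have h1 : ContMDiffOn 𝓘(ℝ, E) 𝓘(ℝ, E) ω (extChartAt 𝓘(ℝ, E) c).symm
    (extChartAt 𝓘(ℝ, E) c).target := contMDiffOn_extChartAt_symm c
  have h2 := h1.contMDiffOn_tangentMapWithin (m := ∞) (by simp)
    (isOpen_chart_target c).uniqueMDiffOn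
  have h3 : ContMDiff 𝓘(ℝ, E) 𝓘(ℝ, E).tangent ∞
    (fun y : E ↦ (⟨y, w⟩ : TangentBundle 𝓘(ℝ, E) E)) := by
    exact contMDiff_vectorSpace_iff_contDiff.2 contDiff_const
  have h4 := h2.comp h3.contMDiffOn (s := (extChartAt 𝓘(ℝ, E) c).target) (fun y hy ↦ hy)
  refine h4.congr fun y hy ↦ ?_
  simp only [tangentMapWithin, Function.comp]
  rw [mfderivWithin_of_isOpen (isOpen_chart_target c) hy]

variable [RiemannianBundle (fun x : M ↦ TangentSpace 𝓘(ℝ, E) x)]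

theorem metricInChart_symm (c : M) (y u v : E) :
    metricInChart c y u v = metricInChart c y v u := by
  rw [metricInChart_apply, metricInChart_apply, real_inner_comm]

theorem metricInChart_self (c : M) (y u : E) : metricInChart c y u u =
    ‖mfderiv 𝓘(ℝ, E) 𝓘(ℝ, E) (extChartAt 𝓘(ℝ, E) c).symm y u‖ ^ 2 := by
  rw [metricInChart_apply, real_inner_self_eq_norm_sq]

theorem metricInChart_self_nonneg (c : M) (y u : E) : 0 ≤ metricInChart c y u u := by
  rw [metricInChart_self]; positivity

theorem metricInChart_self_pos {c : M} {y u : E} (hy : y ∈ (extChartAt 𝓘(ℝ, E) c).target)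
    (hu : u ≠ 0) : 0 < metricInChart c y u u := by
  rw [metricInChart_self]
  have : mfderiv 𝓘(ℝ, E) 𝓘(ℝ, E) (extChartAt 𝓘(ℝ, E) c).symm y u ≠ 0 := by
    intro h
    exact hu (mfderiv_chart_symm_injective hy (h.trans (map_zero _).symm))
  positivity

/-- In finite dimension smoothness can be tested on fixed pairs of vectors, where it is the
smoothness of the inner product of two coordinate fields. -/
theorem contDiffOn_metricInChart [FiniteDimensional ℂ E]
    [IsContMDiffRiemannianBundle 𝓘(ℝ, E) ∞ E (fun x : M ↦ TangentSpace 𝓘(ℝ, E) x)] (c : M) :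
    ContDiffOn ℝ ∞ (metricInChart c) (extChartAt 𝓘(ℝ, E) c).target := by
  rw [contDiffOn_clm_apply]
  intro u
  rw [contDiffOn_clm_apply]
  intro v
  have hs (w : E) := contMDiffOn_chart_symm_section c w
  have := ContMDiffOn.inner_bundle (IB := 𝓘(ℝ, E)) (F := E) (n := ∞)
    (E := fun x : M ↦ TangentSpace 𝓘(ℝ, E) x) (b := (extChartAt 𝓘(ℝ, E) c).symm)
    (v := fun y ↦ mfderiv 𝓘(ℝ, E) 𝓘(ℝ, E) (extChartAt 𝓘(ℝ, E) c).symm y u)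
    (w := fun y ↦ mfderiv 𝓘(ℝ, E) 𝓘(ℝ, E) (extChartAt 𝓘(ℝ, E) c).symm y v) (hs u) (hs v)
  rw [contMDiffOn_iff_contDiffOn] at this
  exact this


variable [FiniteDimensional ℂ E]
  [IsContMDiffRiemannianBundle 𝓘(ℝ, E) ∞ E (fun x : M ↦ TangentSpace 𝓘(ℝ, E) x)]

theorem continuousOn_metricInChart_apply {X : Type*} [TopologicalSpace X] {s : Set X} {c : M}
    {z u v : X → E} (hz : ContinuousOn z s) (hu : ContinuousOn u s) (hv : ContinuousOn v s)
    (h : MapsTo z s (extChartAt 𝓘(ℝ, E) c).target) :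
    ContinuousOn (fun t ↦ metricInChart c (z t) (u t) (v t)) s :=
  (((contDiffOn_metricInChart c).continuousOn.comp hz h).clm_apply hu).clm_apply hv

/-- The length of a curve contained in the domain of a chart. -/
theorem pathELength_chart {c : M} {a b : ℝ} {z : ℝ → E} (hab : a < b)
    (hz : ContDiffOn ℝ 1 z (Icc a b)) (h : MapsTo z (Icc a b) (extChartAt 𝓘(ℝ, E) c).target) :
    Manifold.pathELength 𝓘(ℝ, E) ((extChartAt 𝓘(ℝ, E) c).symm ∘ z) a b =
      ∫⁻ t in Icc a b, ENNReal.ofReal √(metricInChart c (z t) (derivWithin z (Icc a b) t)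
        (derivWithin z (Icc a b) t)) := by
  rw [Manifold.pathELength_eq_lintegral_mfderivWithin_Icc]
  refine setLIntegral_congr_fun measurableSet_Icc fun t ht ↦ ?_
  have h1 : mfderivWithin 𝓘(ℝ) 𝓘(ℝ, E) ((extChartAt 𝓘(ℝ, E) c).symm ∘ z) (Icc a b) t =
      (mfderiv 𝓘(ℝ, E) 𝓘(ℝ, E) (extChartAt 𝓘(ℝ, E) c).symm (z t)) ∘L
        (mfderivWithin 𝓘(ℝ) 𝓘(ℝ, E) z (Icc a b) t) := by
    apply mfderiv_comp_mfderivWithin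
    · exact mdifferentiableAt_chart_symm (h ht)
    · exact (hz.contMDiffOn.mdifferentiableOn one_ne_zero) t ht
    · exact (uniqueDiffOn_Icc hab t ht).uniqueMDiffWithinAt
  have h2 : mfderivWithin 𝓘(ℝ) 𝓘(ℝ, E) ((extChartAt 𝓘(ℝ, E) c).symm ∘ z) (Icc a b) t 1 =
      (mfderiv 𝓘(ℝ, E) 𝓘(ℝ, E) (extChartAt 𝓘(ℝ, E) c).symm (z t))
        (derivWithin z (Icc a b) t) := by
    have h3 : mfderivWithin 𝓘(ℝ) 𝓘(ℝ, E) z (Icc a b) t 1 = derivWithin z (Icc a b) t := by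
      rw [mfderivWithin_eq_fderivWithin]
      exact fderivWithin_derivWithin (𝕜 := ℝ) (F := E)
    rw [h1]
    exact congrArg (mfderiv 𝓘(ℝ, E) 𝓘(ℝ, E) (extChartAt 𝓘(ℝ, E) c).symm (z t)) h3
  rw [h2, metricInChart_self, Real.sqrt_sq (norm_nonneg _), ofReal_norm]
  rfl

end ChartGeometry

/-! ### Upper bound for the distance by the length of a curve in a chart -/

section Distance

variable {E : Type*} [NormedAddCommGroup E] [NormedSpace ℂ E] [FiniteDimensional ℂ E]
  {M : Type*} [MetricSpace M] [ChartedSpace E M] [IsManifold 𝓘(ℂ, E) ω M]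
  [RiemannianBundle (fun x : M ↦ TangentSpace 𝓘(ℝ, E) x)]
  [IsContMDiffRiemannianBundle 𝓘(ℝ, E) ∞ E (fun x : M ↦ TangentSpace 𝓘(ℝ, E) x)]
  [IsRiemannianManifold 𝓘(ℝ, E) M]

/-- The distance is bounded by the length of a curve in a chart. -/
theorem dist_le_integral_chart {c : M} {a b : ℝ} {z z' : ℝ → E} (hab : a ≤ b)
    (hz : ∀ t ∈ Icc a b, HasDerivWithinAt z (z' t) (Icc a b) t) (hz' : ContinuousOn z' (Icc a b))
    (h : MapsTo z (Icc a b) (extChartAt 𝓘(ℝ, E) c).target) :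
    dist ((extChartAt 𝓘(ℝ, E) c).symm (z a)) ((extChartAt 𝓘(ℝ, E) c).symm (z b)) ≤
      ∫ t in a..b, √(metricInChart c (z t) (z' t) (z' t)) := by
  rcases hab.eq_or_lt with rfl | hab'
  · simp
  have hzc : ContinuousOn z (Icc a b) := fun t ht ↦ (hz t ht).continuousWithinAt
  have hd : EqOn (derivWithin z (Icc a b)) z' (Icc a b) := fun t ht ↦
    (hz t ht).derivWithin (uniqueDiffOn_Icc hab' t ht)
  have hC : ContDiffOn ℝ 1 z (Icc a b) := by
    rw [contDiffOn_one_iff_derivWithin (uniqueDiffOn_Icc hab')]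
    exact ⟨fun t ht ↦ (hz t ht).differentiableWithinAt, hz'.congr hd⟩
  have hi : ContinuousOn (fun t ↦ √(metricInChart c (z t) (z' t) (z' t))) (Icc a b) :=
    (continuousOn_metricInChart_apply hzc hz' hz' h).sqrt
  have h1 : edist ((extChartAt 𝓘(ℝ, E) c).symm (z a)) ((extChartAt 𝓘(ℝ, E) c).symm (z b)) ≤
      Manifold.pathELength 𝓘(ℝ, E) ((extChartAt 𝓘(ℝ, E) c).symm ∘ z) a b := by
    rw [IsRiemannianManifold.out (I := 𝓘(ℝ, E))]
    refine Manifold.riemannianEDist_le_pathELength ?_ rfl rfl hab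
    exact ((contMDiffOn_extChartAt_symm (n := ω) c).of_le (by simp)).comp hC.contMDiffOn h
  rw [pathELength_chart hab' hC h] at h1
  have h2 : ∫⁻ t in Icc a b, ENNReal.ofReal √(metricInChart c (z t) (derivWithin z (Icc a b) t)
      (derivWithin z (Icc a b) t)) =
      ENNReal.ofReal (∫ t in a..b, √(metricInChart c (z t) (z' t) (z' t))) := by
    rw [intervalIntegral.integral_of_le hab, ← integral_Icc_eq_integral_Ioc,
      ofReal_integral_eq_lintegral_ofReal hi.integrableOn_Icc
        (Eventually.of_forall fun t ↦ Real.sqrt_nonneg _)]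
    refine setLIntegral_congr_fun measurableSet_Icc fun t ht ↦ ?_
    simp only [hd ht]
  rw [h2, edist_dist] at h1
  refine (ENNReal.ofReal_le_ofReal_iff ?_).1 h1
  exact intervalIntegral.integral_nonneg hab fun t _ ↦ Real.sqrt_nonneg _

end Distance

/-! ### The Hilbert norms given by the metric at points of a chart -/

section ChartNorm

variable {E : Type*} [NormedAddCommGroup E] [NormedSpace ℂ E]
  {M : Type*} [TopologicalSpace M] [ChartedSpace E M] [IsManifold 𝓘(ℂ, E) ω M]
  [RiemannianBundle (fun x : M ↦ TangentSpace 𝓘(ℝ, E) x)]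

/-- The norm of tangent vectors read in the chart centred at `c`. -/
def chartNorm (c : M) (y v : E) : ℝ := √(metricInChart c y v v)

theorem chartNorm_eq (c : M) (y v : E) : chartNorm c y v =
    ‖mfderiv 𝓘(ℝ, E) 𝓘(ℝ, E) (extChartAt 𝓘(ℝ, E) c).symm y v‖ := by
  rw [chartNorm, metricInChart_self, Real.sqrt_sq (norm_nonneg _)]

theorem chartNorm_nonneg (c : M) (y v : E) : 0 ≤ chartNorm c y v := Real.sqrt_nonneg _

theorem chartNorm_sq (c : M) (y v : E) : chartNorm c y v ^ 2 = metricInChart c y v v :=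
  Real.sq_sqrt (metricInChart_self_nonneg c y v)

theorem chartNorm_smul (c : M) (y v : E) (t : ℝ) :
    chartNorm c y (t • v) = |t| * chartNorm c y v := by
  rw [chartNorm, chartNorm, ← Real.sqrt_sq_eq_abs, ← Real.sqrt_mul (sq_nonneg t)]
  simp only [map_smul, smul_apply, smul_eq_mul]
  ring_nf

theorem metricInChart_le_mul (c : M) (y u v : E) :
    metricInChart c y u v ≤ chartNorm c y u * chartNorm c y v := by
  rw [chartNorm_eq, chartNorm_eq, metricInChart_apply]
  exact real_inner_le_norm _ _

/-- The source of regularity for minimizing curves: if u and -v are consecutive steps whose sum is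
nearly as long as their lengths allow, then u + v, which is the second difference, is small. -/
theorem chartNorm_parallelogram (c : M) (y u v : E) : chartNorm c y (u + v) ^ 2 =
    2 * chartNorm c y u ^ 2 + 2 * chartNorm c y v ^ 2 - chartNorm c y (u - v) ^ 2 := by
  simp only [chartNorm_sq, map_add, map_sub, add_apply,
    sub_apply]
  ring

variable [FiniteDimensional ℂ E]
  [IsContMDiffRiemannianBundle 𝓘(ℝ, E) ∞ E (fun x : M ↦ TangentSpace 𝓘(ℝ, E) x)]

theorem continuousOn_chartNorm {X : Type*} [TopologicalSpace X] {s : Set X} {c : M}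
    {z u : X → E} (hz : ContinuousOn z s) (hu : ContinuousOn u s)
    (h : MapsTo z s (extChartAt 𝓘(ℝ, E) c).target) :
    ContinuousOn (fun t ↦ chartNorm c (z t) (u t)) s :=
  (continuousOn_metricInChart_apply hz hu hu h).sqrt

set_option maxSynthPendingDepth 3 in
-- The two-sided bounds come from compactness of a closed ball times the unit sphere, and the
-- comparison between two base points from the Lipschitz continuity of the metric coefficients.
theorem exists_chartNorm_bounds {c : M} {y₀ : E} (hy₀ : y₀ ∈ (extChartAt 𝓘(ℝ, E) c).target) :
    ∃ R > 0, ∃ κ > 0, ∃ K ≥ 0, Metric.closedBall y₀ R ⊆ (extChartAt 𝓘(ℝ, E) c).target ∧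
      ∀ y ∈ Metric.closedBall y₀ R, ∀ v : E, ‖v‖ ≤ κ * chartNorm c y v ∧
        chartNorm c y v ≤ κ * ‖v‖ ∧ ∀ m ∈ Metric.closedBall y₀ R,
          chartNorm c m v ≤ (1 + K * ‖y - m‖) * chartNorm c y v := by
  have hproper : ProperSpace E := FiniteDimensional.proper ℂ E
  have hat : ContDiffAt ℝ 1 (metricInChart c) y₀ :=
    ((contDiffOn_metricInChart c).contDiffAt ((isOpen_chart_target c).mem_nhds hy₀)).of_le
      (by exact_mod_cast le_top)
  obtain ⟨K₀, t, ht, hK₀⟩ := hat.exists_lipschitzOnWith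
  obtain ⟨R, hR, hRt⟩ := Metric.nhds_basis_closedBall.mem_iff.1
    (inter_mem ht ((isOpen_chart_target c).mem_nhds hy₀))
  have hcomp : IsCompact (Metric.closedBall y₀ R ×ˢ Metric.sphere (0 : E) 1) :=
    (isCompact_closedBall y₀ R).prod (isCompact_sphere 0 1)
  have hcont : ContinuousOn (fun q : E × E ↦ metricInChart c q.1 q.2 q.2)
      (Metric.closedBall y₀ R ×ˢ Metric.sphere (0 : E) 1) :=
    continuousOn_metricInChart_apply continuousOn_fst continuousOn_snd continuousOn_snd
      fun q hq ↦ (hRt hq.1).2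
  obtain ⟨a, ha, hlow⟩ := hcomp.exists_forall_le' hcont (a := 0) fun q hq ↦ by
    refine metricInChart_self_pos (hRt hq.1).2 ?_
    rintro h
    have := hq.2
    simp [h] at this
  obtain ⟨C₀, hC₀⟩ := hcomp.exists_bound_of_continuousOn hcont
  set C := max C₀ 0
  have hscale : ∀ y ∈ Metric.closedBall y₀ R, ∀ v : E,
      a * ‖v‖ ^ 2 ≤ metricInChart c y v v ∧ metricInChart c y v v ≤ C * ‖v‖ ^ 2 := by
    intro y hy v
    rcases eq_or_ne v 0 with rfl | hv
    · simp
    have hv' : ‖v‖ ≠ 0 := norm_ne_zero_iff.2 hv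
    have hmem : (y, (‖v‖⁻¹ : ℝ) • v) ∈ Metric.closedBall y₀ R ×ˢ Metric.sphere (0 : E) 1 :=
      ⟨hy, by simp [norm_smul, hv']⟩
    have h1 := hlow _ hmem
    have h2 := (le_abs_self _).trans ((hC₀ _ hmem).trans (le_max_left C₀ 0))
    simp only [map_smul, smul_apply, smul_eq_mul] at h1 h2
    have : ‖v‖⁻¹ * (‖v‖⁻¹ * metricInChart c y v v) = metricInChart c y v v / ‖v‖ ^ 2 := by
      field_simp
    rw [this, le_div_iff₀ (by positivity)] at h1
    rw [this, div_le_iff₀ (by positivity)] at h2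
    exact ⟨h1, h2⟩
  have hC0 : 0 ≤ C := le_max_right _ _
  -- A single constant for both directions: its square dominates 1/a and C.
  set κ : ℝ := √(1 / a) + √C with hκ
  have hκa : 1 / a ≤ κ ^ 2 := by
    have h1 := Real.sq_sqrt (by positivity : 0 ≤ 1 / a)
    have h2 := Real.sqrt_nonneg (1 / a)
    have h3 := Real.sqrt_nonneg C
    nlinarith
  have hκC : C ≤ κ ^ 2 := by
    have h1 := Real.sq_sqrt hC0
    have h2 := Real.sqrt_nonneg (1 / a)
    have h3 := Real.sqrt_nonneg C
    nlinarith
  have hκ0 : 0 < κ := by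
    have := Real.sqrt_pos.2 (by positivity : 0 < 1 / a)
    have h3 := Real.sqrt_nonneg C
    linarith
  have hlow2 : ∀ y ∈ Metric.closedBall y₀ R, ∀ v : E, ‖v‖ ^ 2 ≤ κ ^ 2 * chartNorm c y v ^ 2 := by
    intro y hy v
    rw [chartNorm_sq]
    have h1 := (hscale y hy v).1
    have h2 : ‖v‖ ^ 2 ≤ (1 / a) * metricInChart c y v v := by
      rw [one_div, ← div_eq_inv_mul, le_div_iff₀ ha]; linarith
    exact h2.trans (mul_le_mul_of_nonneg_right hκa (metricInChart_self_nonneg c y v))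
  refine ⟨R, hR, κ, hκ0, K₀ * κ ^ 2, by positivity, fun y hy ↦ (hRt hy).2,
    fun y hy v ↦ ⟨?_, ?_, ?_⟩⟩
  · refine abs_le_of_sq_le_sq' ?_ (by have := chartNorm_nonneg c y v; positivity) |>.2
    rw [mul_pow]
    exact hlow2 y hy v
  · refine abs_le_of_sq_le_sq' ?_ (by positivity) |>.2
    rw [mul_pow, chartNorm_sq]
    exact (hscale y hy v).2.trans (mul_le_mul_of_nonneg_right hκC (sq_nonneg ‖v‖))
  · intro m hm
    have hN := chartNorm_nonneg c y v
    refine abs_le_of_sq_le_sq' ?_ (by positivity) |>.2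
    -- On squares the relative error is 1 + K₀κ²‖y - m‖, which is at most its own square; so the
    -- same constant works for the norms.
    have h1 : metricInChart c m v v - metricInChart c y v v ≤ K₀ * ‖y - m‖ * ‖v‖ ^ 2 := by
      have h2 := (metricInChart c m - metricInChart c y).le_opNorm₂ v v
      have h3 := hK₀.norm_sub_le (hRt hm).1 (hRt hy).1
      have h4 := mul_le_mul_of_nonneg_right h3 (sq_nonneg ‖v‖)
      have h5 := le_abs_self ((metricInChart c m - metricInChart c y) v v)
      rw [Real.norm_eq_abs] at h2
      simp only [sub_apply] at h2 h5
      rw [norm_sub_rev m y] at h4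
      nlinarith
    have h2 := mul_le_mul_of_nonneg_left (hlow2 y hy v)
      (by positivity : 0 ≤ (K₀ : ℝ) * ‖y - m‖)
    rw [mul_pow, chartNorm_sq, ← chartNorm_sq c y v] at *
    nlinarith [mul_nonneg (by positivity : (0 : ℝ) ≤ K₀ * κ ^ 2 * ‖y - m‖) (sq_nonneg (chartNorm c y v)),
      mul_nonneg (sq_nonneg ((K₀ : ℝ) * κ ^ 2 * ‖y - m‖)) (sq_nonneg (chartNorm c y v))]

end ChartNorm

/-! ### Comparison of the distance with a frozen norm -/

section Distance

variable {E : Type*} [NormedAddCommGroup E] [NormedSpace ℂ E] [FiniteDimensional ℂ E]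
  {M : Type*} [MetricSpace M] [ChartedSpace E M] [IsManifold 𝓘(ℂ, E) ω M]
  [RiemannianBundle (fun x : M ↦ TangentSpace 𝓘(ℝ, E) x)]
  [IsContMDiffRiemannianBundle 𝓘(ℝ, E) ∞ E (fun x : M ↦ TangentSpace 𝓘(ℝ, E) x)]
  [IsRiemannianManifold 𝓘(ℝ, E) M]

/-- A path almost realizing the distance between two points, with all its pieces controlled. -/
theorem exists_path_lt {x y : M} {l : ℝ} (h : dist x y < l) :
    ∃ γ : ℝ → M, γ 0 = x ∧ γ 1 = y ∧ ContMDiffOn 𝓘(ℝ) 𝓘(ℝ, E) 1 γ (Icc 0 1) ∧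
      Manifold.pathELength 𝓘(ℝ, E) γ 0 1 < ENNReal.ofReal l := by
  refine Manifold.exists_lt_of_riemannianEDist_lt ?_
  rw [← IsRiemannianManifold.out (I := 𝓘(ℝ, E)), edist_dist]
  exact (ENNReal.ofReal_lt_ofReal_iff (dist_nonneg.trans_lt h)).2 h

theorem edist_le_pathELength {γ : ℝ → M} {s t : ℝ} (hst : s ≤ t)
    (hγ : ContMDiffOn 𝓘(ℝ) 𝓘(ℝ, E) 1 γ (Icc s t)) :
    edist (γ s) (γ t) ≤ Manifold.pathELength 𝓘(ℝ, E) γ s t := by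
  rw [IsRiemannianManifold.out (I := 𝓘(ℝ, E))]
  exact Manifold.riemannianEDist_le_pathELength hγ rfl rfl hst

/-- A path of length less than l starting at x cannot leave the ball of radius l about x, so it can
be read entirely in the chart. -/
theorem exists_curve_in_chart {c x y : M} {l : ℝ} (h : dist x y < l)
    (hs : Metric.ball x l ⊆ (extChartAt 𝓘(ℝ, E) c).source) :
    ∃ z z' : ℝ → E, z 0 = extChartAt 𝓘(ℝ, E) c x ∧ z 1 = extChartAt 𝓘(ℝ, E) c y ∧
      ContinuousOn z' (Icc 0 1) ∧
      (∀ t ∈ Icc (0 : ℝ) 1, HasDerivWithinAt z (z' t) (Icc 0 1) t ∧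
        z t ∈ (extChartAt 𝓘(ℝ, E) c).target ∧
        (extChartAt 𝓘(ℝ, E) c).symm (z t) ∈ Metric.ball x l) ∧
      ∫ t in (0 : ℝ)..1, chartNorm c (z t) (z' t) < l := by
  obtain ⟨γ, h0, h1, hγ, hl⟩ := exists_path_lt (E := E) h
  have hball : ∀ t ∈ Icc (0 : ℝ) 1, γ t ∈ Metric.ball x l := by
    intro t ht
    have h2 : edist (γ 0) (γ t) < ENNReal.ofReal l := by
      refine (edist_le_pathELength ht.1 (hγ.mono (Icc_subset_Icc_right ht.2))).trans_lt ?_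
      exact (Manifold.pathELength_mono le_rfl ht.2).trans_lt hl
    rw [edist_dist, h0, ENNReal.ofReal_lt_ofReal_iff (dist_nonneg.trans_lt h)] at h2
    rwa [Metric.mem_ball, dist_comm]
  set z : ℝ → E := extChartAt 𝓘(ℝ, E) c ∘ γ with hzdef
  have hz : ContDiffOn ℝ 1 z (Icc 0 1) := by
    rw [← contMDiffOn_iff_contDiffOn]
    refine ((contMDiffOn_extChartAt (n := ω)).of_le (by simp)).comp hγ fun t ht ↦ ?_
    have := hs (hball t ht)
    rwa [extChartAt_source] at this
  have hzt : ∀ t ∈ Icc (0 : ℝ) 1, z t ∈ (extChartAt 𝓘(ℝ, E) c).target := fun t ht ↦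
    (extChartAt 𝓘(ℝ, E) c).map_source (hs (hball t ht))
  have hψ : ∀ t ∈ Icc (0 : ℝ) 1, (extChartAt 𝓘(ℝ, E) c).symm (z t) = γ t := fun t ht ↦
    (extChartAt 𝓘(ℝ, E) c).left_inv (hs (hball t ht))
  have hc := (contDiffOn_one_iff_derivWithin (uniqueDiffOn_Icc zero_lt_one)).1 hz
  refine ⟨z, derivWithin z (Icc 0 1), by simp [hzdef, h0], by simp [hzdef, h1], hc.2,
    fun t ht ↦ ⟨(hc.1 t ht).hasDerivWithinAt, hzt t ht, by rw [hψ t ht]; exact hball t ht⟩, ?_⟩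
  have h2 := pathELength_chart zero_lt_one hz hzt
  rw [Manifold.pathELength_congr (γ := _ ∘ z) (γ' := γ) hψ] at h2
  have hcont : ContinuousOn (fun t ↦ chartNorm c (z t) (derivWithin z (Icc 0 1) t)) (Icc 0 1) :=
    continuousOn_chartNorm hz.continuousOn hc.2 hzt
  have h3 := ofReal_integral_eq_lintegral_ofReal (hcont.integrableOn_Icc (μ := volume))
    (Eventually.of_forall fun t ↦ chartNorm_nonneg _ _ _)
  rw [h2] at hl
  unfold chartNorm at h3 ⊢
  rw [← h3, ENNReal.ofReal_lt_ofReal_iff (dist_nonneg.trans_lt h)] at hl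
  rwa [intervalIntegral.integral_of_le zero_le_one, ← integral_Icc_eq_integral_Ioc]


theorem sub_eq_integral_of_hasDerivWithinAt {F : Type*} [NormedAddCommGroup F] [NormedSpace ℝ F]
    [CompleteSpace F] {z z' : ℝ → F} {a b : ℝ}
    (hz : ∀ t ∈ Icc a b, HasDerivWithinAt z (z' t) (Icc a b) t) (hz' : ContinuousOn z' (Icc a b))
    {s t : ℝ} (has : a ≤ s) (hst : s ≤ t) (htb : t ≤ b) : ∫ τ in s..t, z' τ = z t - z s := by
  have hsub : Icc s t ⊆ Icc a b := Icc_subset_Icc has htb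
  refine intervalIntegral.integral_eq_sub_of_hasDerivAt_of_le hst
    (fun τ hτ ↦ ((hz τ (hsub hτ)).mono hsub).continuousWithinAt) (fun τ hτ ↦ ?_)
    ((hz'.mono hsub).intervalIntegrable_of_Icc hst)
  exact (hz τ (hsub ⟨hτ.1.le, hτ.2.le⟩)).hasDerivAt
    (Icc_mem_nhds (has.trans_lt hτ.1) (hτ.2.trans_le htb))

/-- Pair the displacement with itself in the metric at m, move the pairing under the integral, use
Cauchy-Schwarz and divide by the norm of the displacement. -/
theorem chartNorm_sub_le_integral {c : M} {m : E} {z z' : ℝ → E} {a b : ℝ} (hab : a ≤ b)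
    (hz : ∀ t ∈ Icc a b, HasDerivWithinAt z (z' t) (Icc a b) t) (hz' : ContinuousOn z' (Icc a b))
    (hm : m ∈ (extChartAt 𝓘(ℝ, E) c).target) :
    chartNorm c m (z b - z a) ≤ ∫ t in a..b, chartNorm c m (z' t) := by
  have hcont : ContinuousOn (fun t ↦ chartNorm c m (z' t)) (Icc a b) :=
    continuousOn_chartNorm continuousOn_const hz' fun _ _ ↦ hm
  have hInt := hz'.intervalIntegrable_of_Icc (μ := volume) hab
  have hc : CompleteSpace E := FiniteDimensional.complete ℂ E
  set w := z b - z a with hw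
  have h1 : metricInChart c m w w = ∫ t in a..b, metricInChart c m w (z' t) := by
    rw [(metricInChart c m w).intervalIntegral_comp_comm hInt,
      sub_eq_integral_of_hasDerivWithinAt hz hz' le_rfl hab le_rfl]
  have h2 : metricInChart c m w w ≤ ∫ t in a..b, chartNorm c m w * chartNorm c m (z' t) := by
    rw [h1]
    refine intervalIntegral.integral_mono_on hab ?_ ?_ fun t _ ↦ metricInChart_le_mul c m w _
    · exact ((metricInChart c m w).continuous.comp_continuousOn hz').intervalIntegrable_of_Icc hab
    · exact (continuousOn_const.mul hcont).intervalIntegrable_of_Icc hab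
  rw [intervalIntegral.integral_const_mul, ← chartNorm_sq] at h2
  rcases (chartNorm_nonneg c m w).eq_or_lt with h0 | h0
  · rw [← h0]
    exact intervalIntegral.integral_nonneg hab fun t _ ↦ chartNorm_nonneg _ _ _
  · rw [sq] at h2
    exact le_of_mul_le_mul_left h2 h0

/-- In a chart, the distance is comparable to the norm given by the metric at a nearby point, with
a relative error of first order in the distances involved. -/
theorem exists_chart_comparison {c : M} {y₀ : E} (hy₀ : y₀ ∈ (extChartAt 𝓘(ℝ, E) c).target) :
    ∃ r > 0, ∃ κ > 0, ∃ K ≥ 0, Metric.ball y₀ r ⊆ (extChartAt 𝓘(ℝ, E) c).target ∧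
      (∀ y ∈ Metric.ball y₀ r, ∀ v : E, ‖v‖ ≤ κ * chartNorm c y v) ∧
      ∀ p ∈ Metric.ball y₀ r, ∀ q ∈ Metric.ball y₀ r,
        ‖q - p‖ ≤ κ * dist ((extChartAt 𝓘(ℝ, E) c).symm p) ((extChartAt 𝓘(ℝ, E) c).symm q) ∧
        dist ((extChartAt 𝓘(ℝ, E) c).symm p) ((extChartAt 𝓘(ℝ, E) c).symm q) ≤ κ * ‖q - p‖ ∧
        chartNorm c p (q - p) ≤
          (1 + K * dist ((extChartAt 𝓘(ℝ, E) c).symm p) ((extChartAt 𝓘(ℝ, E) c).symm q)) *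
            dist ((extChartAt 𝓘(ℝ, E) c).symm p) ((extChartAt 𝓘(ℝ, E) c).symm q) ∧
        ∀ m ∈ Metric.ball y₀ r, ∀ ρ, ‖p - m‖ ≤ ρ → ‖q - m‖ ≤ ρ →
          dist ((extChartAt 𝓘(ℝ, E) c).symm p) ((extChartAt 𝓘(ℝ, E) c).symm q) ≤
            (1 + K * ρ) * chartNorm c m (q - p) := by
  obtain ⟨R, hR, κ, hκ, K, hK, hRt, hb⟩ := exists_chartNorm_bounds hy₀
  set φ := extChartAt 𝓘(ℝ, E) c with hφ
  have hcE : CompleteSpace E := FiniteDimensional.complete ℂ E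
  have hψ0 : φ.symm y₀ ∈ φ.source := φ.map_target hy₀
  have hW : φ.source ∩ φ ⁻¹' (Metric.ball y₀ R) ∈ 𝓝 (φ.symm y₀) := by
    refine inter_mem (extChartAt_source_mem_nhds' hψ0) ?_
    refine (continuousAt_extChartAt' hψ0).preimage_mem_nhds ?_
    rw [← hφ, φ.right_inv hy₀]
    exact Metric.ball_mem_nhds _ hR
  obtain ⟨ρ, hρ, hρW⟩ := Metric.mem_nhds_iff.1 hW
  have hcont : ContinuousAt φ.symm y₀ := by
    have := continuousAt_extChartAt_symm'' (I := 𝓘(ℝ, E)) hy₀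
    exact this
  -- The quarter leaves room: two points of the small ball are less than ρ/2 apart in M, and a ball
  -- of radius l < 3ρ/4 about either still lies in the region controlled by the chart.
  obtain ⟨r₁, hr₁, hr₁W⟩ := Metric.mem_nhds_iff.1
    (hcont.preimage_mem_nhds (Metric.ball_mem_nhds _ (by positivity : 0 < ρ / 4)))
  set r := min R r₁ with hr
  have hrR : Metric.ball y₀ r ⊆ Metric.closedBall y₀ R :=
    (Metric.ball_subset_ball (min_le_left _ _)).trans Metric.ball_subset_closedBall
  have hrr : ∀ p ∈ Metric.ball y₀ r, dist (φ.symm p) (φ.symm y₀) < ρ / 4 := fun p hp ↦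
    hr₁W (Metric.ball_subset_ball (min_le_right _ _) hp)
  -- Upper bounds use the straight segment as competitor; by convexity it remains within ρ' of m, so
  -- the metric along it is close to the metric at m.
  have upper : ∀ p ∈ Metric.ball y₀ r, ∀ q ∈ Metric.ball y₀ r, ∀ m ∈ Metric.ball y₀ r, ∀ ρ',
      ‖p - m‖ ≤ ρ' → ‖q - m‖ ≤ ρ' →
      dist (φ.symm p) (φ.symm q) ≤ (1 + K * ρ') * chartNorm c m (q - p) ∧
      dist (φ.symm p) (φ.symm q) ≤ κ * ‖q - p‖ := by
    intro p hp q hq m hm ρ' hpm hqm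
    have hseg : ∀ t ∈ Icc (0 : ℝ) 1,
        p + t • (q - p) ∈ Metric.ball y₀ r ∩ Metric.closedBall m ρ' := by
      intro t ht
      refine ((convex_ball y₀ r).inter (convex_closedBall m ρ')).add_smul_sub_mem ?_ ?_ ht
      · exact ⟨hp, by rwa [Metric.mem_closedBall, dist_eq_norm]⟩
      · exact ⟨hq, by rwa [Metric.mem_closedBall, dist_eq_norm]⟩
    have hd : ∀ t ∈ Icc (0 : ℝ) 1,
        HasDerivWithinAt (fun t : ℝ ↦ p + t • (q - p)) (q - p) (Icc 0 1) t := by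
      intro t _
      have := ((hasDerivAt_id t).smul_const (q - p)).const_add p
      simpa using this.hasDerivWithinAt
    have h1 := dist_le_integral_chart (c := c) zero_le_one hd continuousOn_const
      fun t ht ↦ hRt (hrR (hseg t ht).1)
    change _ ≤ ∫ t in (0 : ℝ)..1, chartNorm c (p + t • (q - p)) (q - p) at h1
    simp only [zero_smul, add_zero, one_smul, add_sub_cancel] at h1
    have hmap : MapsTo (fun t : ℝ ↦ p + t • (q - p)) (Icc 0 1) φ.target :=
      fun t ht ↦ hRt (hrR (hseg t ht).1)
    have hci : IntervalIntegrable (fun t : ℝ ↦ chartNorm c (p + t • (q - p)) (q - p)) volume 0 1 :=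
      (continuousOn_chartNorm (by fun_prop) continuousOn_const hmap).intervalIntegrable_of_Icc
        zero_le_one
    constructor
    · refine h1.trans ?_
      have : ∫ t in (0 : ℝ)..1, chartNorm c (p + t • (q - p)) (q - p) ≤
          ∫ t in (0 : ℝ)..1, (1 + K * ρ') * chartNorm c m (q - p) := by
        refine intervalIntegral.integral_mono_on zero_le_one hci (by simp) fun t ht ↦ ?_
        have h2 := (hb m (hrR hm) (q - p)).2.2 _ (hrR (hseg t ht).1)
        refine h2.trans (mul_le_mul_of_nonneg_right ?_ (chartNorm_nonneg _ _ _))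
        have h3 := (hseg t ht).2
        rw [Metric.mem_closedBall, dist_eq_norm, norm_sub_rev] at h3
        gcongr
      simpa using this
    · refine h1.trans ?_
      have : ∫ t in (0 : ℝ)..1, chartNorm c (p + t • (q - p)) (q - p) ≤
          ∫ t in (0 : ℝ)..1, κ * ‖q - p‖ :=
        intervalIntegral.integral_mono_on zero_le_one hci (by simp) fun t ht ↦
          (hb _ (hrR (hseg t ht).1) (q - p)).2.1
      simpa using this
  -- Lower bounds use a path of length less than l. It stays within κl of p in coordinates, and then
  -- freezing its metric at p costs only the factor 1 + Kκl.
  have lower : ∀ p ∈ Metric.ball y₀ r, ∀ q ∈ Metric.ball y₀ r, ∀ l,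
      dist (φ.symm p) (φ.symm q) < l → l < 3 * ρ / 4 →
      ‖q - p‖ ≤ κ * l ∧ chartNorm c p (q - p) ≤ (1 + K * (κ * l)) * l := by
    intro p hp q hq l hl hlρ
    have hball : Metric.ball (φ.symm p) l ⊆ φ.source ∩ φ ⁻¹' (Metric.ball y₀ R) := by
      refine Subset.trans ?_ hρW
      refine Metric.ball_subset_ball' ?_
      have := hrr p hp
      linarith
    obtain ⟨z, z', hz0, hz1, hz'c, hz, hzl⟩ := exists_curve_in_chart (c := c) hl
      (hball.trans inter_subset_left)
    rw [φ.right_inv (hRt (hrR hp))] at hz0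
    rw [φ.right_inv (hRt (hrR hq))] at hz1
    have hzd : ∀ t ∈ Icc (0 : ℝ) 1, HasDerivWithinAt z (z' t) (Icc 0 1) t := fun t ht ↦ (hz t ht).1
    have hzc : ContinuousOn z (Icc 0 1) := fun t ht ↦ (hzd t ht).continuousWithinAt
    have hzR : ∀ t ∈ Icc (0 : ℝ) 1, z t ∈ Metric.closedBall y₀ R := by
      intro t ht
      have h1 := (hball (hz t ht).2.2).2
      rw [mem_preimage, φ.right_inv (hz t ht).2.1] at h1
      exact Metric.ball_subset_closedBall h1
    have hNc : ContinuousOn (fun t ↦ chartNorm c (z t) (z' t)) (Icc 0 1) :=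
      continuousOn_chartNorm hzc hz'c fun t ht ↦ (hz t ht).2.1
    have hzp : ∀ t ∈ Icc (0 : ℝ) 1, ‖z t - p‖ ≤ κ * l := by
      intro t ht
      have hsub : Icc (0 : ℝ) t ⊆ Icc 0 1 := Icc_subset_Icc_right ht.2
      rw [← hz0, ← sub_eq_integral_of_hasDerivWithinAt hzd hz'c le_rfl ht.1 ht.2]
      refine (intervalIntegral.norm_integral_le_integral_norm ht.1).trans ?_
      have h1 : ∫ τ in (0 : ℝ)..t, ‖z' τ‖ ≤ ∫ τ in (0 : ℝ)..t, κ * chartNorm c (z τ) (z' τ) := by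
        refine intervalIntegral.integral_mono_on ht.1
          ((hz'c.mono hsub).norm.intervalIntegrable_of_Icc ht.1)
          ((continuousOn_const.mul (hNc.mono hsub)).intervalIntegrable_of_Icc ht.1) fun τ hτ ↦ ?_
        exact (hb _ (hzR τ (hsub hτ)) _).1
      rw [intervalIntegral.integral_const_mul] at h1
      refine h1.trans (mul_le_mul_of_nonneg_left ?_ hκ.le)
      refine le_trans ?_ hzl.le
      refine intervalIntegral.integral_mono_interval le_rfl ht.1 ht.2
        (Eventually.of_forall fun τ ↦ chartNorm_nonneg _ _ _)
        (hNc.intervalIntegrable_of_Icc zero_le_one)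
    refine ⟨by simpa [hz1] using hzp 1 (by simp), ?_⟩
    have h1 := chartNorm_sub_le_integral zero_le_one hzd hz'c (hRt (hrR hp))
    rw [hz0, hz1] at h1
    refine h1.trans ?_
    have hl0 : 0 < l := dist_nonneg.trans_lt hl
    have h2 : ∫ t in (0 : ℝ)..1, chartNorm c p (z' t) ≤
        ∫ t in (0 : ℝ)..1, (1 + K * (κ * l)) * chartNorm c (z t) (z' t) := by
      refine intervalIntegral.integral_mono_on zero_le_one ?_ ?_ fun t ht ↦ ?_
      · exact (continuousOn_chartNorm continuousOn_const hz'c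
          fun _ _ ↦ hRt (hrR hp)).intervalIntegrable_of_Icc zero_le_one
      · exact (continuousOn_const.mul hNc).intervalIntegrable_of_Icc zero_le_one
      · refine ((hb _ (hzR t ht) _).2.2 p (hrR hp)).trans ?_
        refine mul_le_mul_of_nonneg_right ?_ (chartNorm_nonneg _ _ _)
        gcongr
        exact hzp t ht
    rw [intervalIntegral.integral_const_mul] at h2
    exact h2.trans (mul_le_mul_of_nonneg_left hzl.le (by positivity))
  refine ⟨r, lt_min hR hr₁, κ, hκ, K * κ + K, by positivity, hrR.trans hRt,
    fun y hy v ↦ (hb y (hrR hy) v).1, fun p hp q hq ↦ ?_⟩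
  set d := dist (φ.symm p) (φ.symm q) with hd
  have hdρ : d < 3 * ρ / 4 := by
    have h1 := dist_triangle_right (φ.symm p) (φ.symm q) (φ.symm y₀)
    have h2 := hrr p hp
    have h3 := hrr q hq
    linarith
  -- The distance is only an infimum of lengths, so the lower bounds are obtained for l > d and
  -- passed to the limit.
  have hev : ∀ᶠ l in 𝓝[>] d, d < l ∧ l < 3 * ρ / 4 :=
    (eventually_mem_nhdsWithin).and ((eventually_lt_nhds hdρ).filter_mono nhdsWithin_le_nhds)
  refine ⟨?_, ?_, ?_, ?_⟩
  · refine ge_of_tendsto (f := fun l : ℝ ↦ κ * l) (x := 𝓝[>] d) ?_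
      (hev.mono fun l hl ↦ (lower p hp q hq l hl.1 hl.2).1)
    exact ((continuous_const.mul continuous_id).tendsto d).mono_left nhdsWithin_le_nhds
  · exact (upper p hp q hq p hp ‖q - p‖ (by simp) le_rfl).2
  · have h1 : chartNorm c p (q - p) ≤ (1 + K * (κ * d)) * d := by
      refine ge_of_tendsto (f := fun l : ℝ ↦ (1 + K * (κ * l)) * l) (x := 𝓝[>] d) ?_
        (hev.mono fun l hl ↦ (lower p hp q hq l hl.1 hl.2).2)
      have : Continuous fun l : ℝ ↦ (1 + K * (κ * l)) * l := by fun_prop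
      exact (this.tendsto d).mono_left nhdsWithin_le_nhds
    have h2 : 0 ≤ d := dist_nonneg
    nlinarith [mul_nonneg hK (mul_nonneg h2 h2)]
  · intro m hm ρ' hpm hqm
    refine (upper p hp q hq m hm ρ' hpm hqm).1.trans ?_
    refine mul_le_mul_of_nonneg_right ?_ (chartNorm_nonneg _ _ _)
    have h2 : 0 ≤ ρ' := (norm_nonneg _).trans hpm
    nlinarith [mul_nonneg (mul_nonneg hK hκ.le) h2]

end Distance

/-! ### One-variable analysis: second differences, du Bois-Reymond, uniform Taylor expansion -/

section Analysis

/-- A continuous function whose second differences are `O(h ^ (3 / 2))` is continuously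
differentiable. -/
theorem exists_hasDerivAt_of_second_difference {F : Type*} [NormedAddCommGroup F]
    [NormedSpace ℝ F] [CompleteSpace F] {f : ℝ → F} (hf : Continuous f) {a b C : ℝ}
    (hΔ : ∀ t h, 0 < h → a < t - h → t + h < b →
      ‖f (t + h) + f (t - h) - (2 : ℝ) • f t‖ ^ 2 ≤ C * h ^ 3) :
    ∃ g : ℝ → F, ContinuousOn g (Ioo a b) ∧ ∀ t ∈ Ioo a b, HasDerivAt f (g t) t := by
  suffices H : ∀ t₀ ∈ Ioo a b, ∃ s, IsOpen s ∧ t₀ ∈ s ∧ ∃ g : ℝ → F, ContinuousOn g s ∧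
      ∀ t ∈ s, HasDerivAt f (g t) t by
    refine ⟨deriv f, fun t ht ↦ ?_, fun t ht ↦ ?_⟩
    · obtain ⟨s, hs, hts, g, hg, hd⟩ := H t ht
      have h1 : ContinuousOn (deriv f) s := hg.congr fun τ hτ ↦ (hd τ hτ).deriv
      exact (h1.continuousAt (hs.mem_nhds hts)).continuousWithinAt
    · obtain ⟨s, hs, hts, g, hg, hd⟩ := H t ht
      exact (hd t hts).differentiableAt.hasDerivAt
  intro t₀ ht₀
  obtain ⟨b', hb', hb'b⟩ := exists_between ht₀.2
  set δ := b - b' with hδ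
  have hδ0 : 0 < δ := by linarith
  -- Forward difference quotients with steps less than b - b' stay inside the interval for every t
  -- below b'.
  set s := Ioo a b' with hs
  set e : ℕ → ℝ := fun k ↦ δ / 2 * (1 / 2) ^ k with he
  have he0 : ∀ k, 0 < e k := fun k ↦ by positivity
  have heδ : ∀ k, e k < δ := by
    intro k
    have : (1 / 2 : ℝ) ^ k ≤ 1 := pow_le_one₀ (by norm_num) (by norm_num)
    simp only [he]
    nlinarith
  have hstep : ∀ k, e (k + 1) = e k / 2 := fun k ↦ by simp only [he, pow_succ]; ring
  -- Dyadic difference quotients: D (k + 1) - D k is, up to sign, a second difference with step e k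
  -- / 2 divided by e k. It is O(√(e k)), so the increments are dominated by a geometric series and
  -- D converges uniformly.
  set D : ℕ → ℝ → F := fun k t ↦ (e k)⁻¹ • (f (t + e k) - f t) with hD
  have hsq : ∀ k : ℕ, √(1 / 2) ^ k = √((1 / 2) ^ k) := by
    intro k
    rw [eq_comm, Real.sqrt_eq_iff_mul_self_eq (by positivity) (by positivity), ← mul_pow,
      Real.mul_self_sqrt (by norm_num)]
  have hdiff : ∀ k, ∀ t ∈ s, ‖D (k + 1) t - D k t‖ ≤ √(|C| * (δ / 2)) * (√(1 / 2)) ^ k := by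
    intro k t ht
    have h1 := hΔ (t + e k / 2) (e k / 2) (by linarith [he0 k]) (by linarith [ht.1])
      (by linarith [ht.2, heδ k])
    have h2 : D (k + 1) t - D k t = -((e k)⁻¹ • (f (t + e k / 2 + e k / 2) +
        f (t + e k / 2 - e k / 2) - (2 : ℝ) • f (t + e k / 2))) := by
      simp only [hD, hstep, inv_div, add_sub_cancel_right, add_assoc, add_halves]
      rw [div_eq_mul_inv, mul_smul]
      rw [← smul_neg, smul_comm, ← smul_sub]
      congr 1
      rw [two_smul, two_smul]
      abel
    rw [h2, norm_neg, norm_smul, norm_inv, Real.norm_of_nonneg (he0 k).le]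
    have h3 : √(|C| * (δ / 2)) * √(1 / 2) ^ k = √(|C| * e k) := by
      rw [hsq, ← Real.sqrt_mul (by positivity)]
      simp only [he]; ring_nf
    rw [h3]
    refine Real.le_sqrt_of_sq_le ?_
    rw [mul_pow, inv_pow, inv_mul_le_iff₀ (by have := he0 k; positivity)]
    have h4 : C * (e k / 2) ^ 3 ≤ |C| * (e k / 2) ^ 3 :=
      mul_le_mul_of_nonneg_right (le_abs_self C) (by have := he0 k; positivity)
    have h5 : 0 ≤ |C| * e k ^ 3 := by have := he0 k; positivity
    nlinarith
  have hsum : Summable fun k : ℕ ↦ √(|C| * (δ / 2)) * (√(1 / 2)) ^ k := by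
    refine (summable_geometric_of_lt_one (Real.sqrt_nonneg _) ?_).mul_left _
    rw [Real.sqrt_lt' one_pos]; norm_num
  have hunif := tendstoUniformlyOn_tsum_nat hsum hdiff
  have hunif' : TendstoUniformlyOn D (fun t ↦ D 0 t + ∑' k, (D (k + 1) t - D k t)) atTop s := by
    have h1 := hunif
    rw [Metric.tendstoUniformlyOn_iff] at h1 ⊢
    intro ε hε
    filter_upwards [h1 ε hε] with n hn t ht
    have h2 := hn t ht
    rw [Finset.sum_range_sub (fun k ↦ D k t)] at h2
    rw [dist_eq_norm] at h2 ⊢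
    convert h2 using 2
    abel
  have hDc : ∀ k, Continuous (D k) := fun k ↦ by simp only [hD]; fun_prop
  refine ⟨s, isOpen_Ioo, ⟨ht₀.1, hb'⟩, _,
    hunif'.continuousOn (Frequently.of_forall fun k ↦ (hDc k).continuousOn), fun t ht ↦ ?_⟩
  -- To identify the limit as the derivative of f, write D k as the derivative of the difference
  -- quotient of a primitive Pf. These quotients converge pointwise to f and their derivatives
  -- converge uniformly.
  set Pf : ℝ → F := fun t ↦ ∫ τ in (0 : ℝ)..t, f τ with hPf
  have hPd : ∀ t, HasDerivAt Pf (f t) t := fun t ↦ hf.integral_hasStrictDerivAt 0 t |>.hasDerivAt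
  refine hasDerivAt_of_tendstoUniformlyOn (f := fun k t ↦ (e k)⁻¹ • (Pf (t + e k) - Pf t))
    isOpen_Ioo hunif' (Eventually.of_forall fun k τ _ ↦ ?_) (fun τ _ ↦ ?_) ht
  · exact (((hPd (τ + e k)).comp_add_const τ (e k)).sub (hPd τ)).const_smul _
  · have h1 := (hPd τ).tendsto_slope_zero
    refine h1.comp (tendsto_nhdsWithin_iff.2 ⟨?_, Eventually.of_forall fun k ↦ (he0 k).ne'⟩)
    have := (tendsto_pow_atTop_nhds_zero_of_lt_one (r := (1 / 2 : ℝ)) (by norm_num)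
      (by norm_num)).const_mul (δ / 2)
    rwa [mul_zero] at this

/-- The lemma of du Bois-Reymond. -/
theorem du_bois_reymond {P Q : ℝ → ℝ} {a b : ℝ} (hab : a < b) (hP : ContinuousOn P (Icc a b))
    (hQ : ContinuousOn Q (Icc a b))
    (h : ∀ f f' : ℝ → ℝ, Continuous f' → (∀ t, HasDerivAt f (f' t) t) → f a = 0 → f b = 0 →
      ∫ t in a..b, (Q t * f t + P t * f' t) = 0) :
    ∃ k : ℝ, ∀ t ∈ Icc a b, P t = k + ∫ τ in a..t, Q τ := by
  set P₁ := IccExtend hab.le ((Icc a b).domRestrict P) with hP₁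
  set Q₁ := IccExtend hab.le ((Icc a b).domRestrict Q) with hQ₁
  have hP₁c : Continuous P₁ := hP.domRestrict.Icc_extend'
  have hQ₁c : Continuous Q₁ := hQ.domRestrict.Icc_extend'
  have eP : ∀ t ∈ Icc a b, P₁ t = P t := fun t ht ↦ by
    rw [hP₁, IccExtend_of_mem _ _ ht]; rfl
  have eQ : ∀ t ∈ Icc a b, Q₁ t = Q t := fun t ht ↦ by
    rw [hQ₁, IccExtend_of_mem _ _ ht]; rfl
  set R : ℝ → ℝ := fun t ↦ ∫ τ in a..t, Q₁ τ with hR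
  have hRd : ∀ t, HasDerivAt R (Q₁ t) t := fun t ↦
    (hQ₁c.integral_hasStrictDerivAt a t).hasDerivAt
  have hRc : Continuous R := continuous_iff_continuousAt.2 fun t ↦ (hRd t).continuousAt
  -- With this constant g = P - R - k has mean zero, so its primitive vanishes at both ends and is
  -- an admissible test function. Since R' = Q, the hypothesis and an integration by parts give ∫ g²
  -- = 0.
  set k : ℝ := (∫ t in a..b, (P₁ t - R t)) / (b - a) with hk
  set g : ℝ → ℝ := fun t ↦ P₁ t - R t - k with hg
  have hgc : Continuous g := by fun_prop
  set f : ℝ → ℝ := fun t ↦ ∫ τ in a..t, g τ with hf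
  have hfd : ∀ t, HasDerivAt f (g t) t := fun t ↦
    (hgc.integral_hasStrictDerivAt a t).hasDerivAt
  have hfc : Continuous f := continuous_iff_continuousAt.2 fun t ↦ (hfd t).continuousAt
  have hfa : f a = 0 := by simp [hf]
  have hfb : f b = 0 := by
    simp only [hf, hg]
    rw [intervalIntegral.integral_sub (f := fun t ↦ P₁ t - R t)
      ((hP₁c.sub hRc).intervalIntegrable _ _) (by simp)]
    rw [intervalIntegral.integral_const, smul_eq_mul, hk]
    field_simp [(sub_pos.2 hab).ne']
    ring
  have h1 := h f g hgc hfd hfa hfb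
  have h2 : ∫ t in a..b, (Q₁ t * f t + P₁ t * g t) = 0 := by
    rw [← h1]
    refine intervalIntegral.integral_congr fun t ht ↦ ?_
    rw [uIcc_of_le hab.le] at ht
    simp only [eP t ht, eQ t ht]
  have h3 : ∫ t in a..b, (Q₁ t * f t + R t * g t) = 0 := by
    have := intervalIntegral.integral_eq_sub_of_hasDerivAt (a := a) (b := b)
      (fun t _ ↦ (hRd t).mul (hfd t)) (Continuous.intervalIntegrable (by fun_prop) _ _)
    rw [this]
    simp [hfa, hfb]
  have h4 : ∫ t in a..b, k * g t = 0 := by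
    rw [intervalIntegral.integral_const_mul]
    have : ∫ t in a..b, g t = 0 := hfb
    rw [this, mul_zero]
  have h5 : ∫ t in a..b, g t ^ 2 = 0 := by
    have e1 : ∀ t, g t ^ 2 = (Q₁ t * f t + P₁ t * g t) - (Q₁ t * f t + R t * g t) - k * g t := by
      intro t; simp only [hg]; ring
    simp_rw [e1]
    rw [intervalIntegral.integral_sub (Continuous.intervalIntegrable (by fun_prop) _ _)
      (Continuous.intervalIntegrable (by fun_prop) _ _),
      intervalIntegral.integral_sub (Continuous.intervalIntegrable (by fun_prop) _ _)
      (Continuous.intervalIntegrable (by fun_prop) _ _), h2, h3, h4]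
    simp
  have h6 : ∀ t ∈ Icc a b, g t = 0 := by
    intro t ht
    by_contra hne
    have := intervalIntegral.integral_pos hab (hgc.pow 2).continuousOn
      (fun x _ ↦ sq_nonneg (g x)) ⟨t, ht, sq_pos_iff.2 hne⟩
    exact this.ne' h5
  refine ⟨k, fun t ht ↦ ?_⟩
  have h7 := h6 t ht
  have h8 : ∫ τ in a..t, Q τ = R t := by
    refine intervalIntegral.integral_congr fun τ hτ ↦ ?_
    rw [uIcc_of_le ht.1] at hτ
    exact (eQ τ ⟨hτ.1, hτ.2.trans ht.2⟩).symm
  rw [h8, ← eP t ht]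
  simp only [hg] at h7
  linarith

/-- The difference with the comparison polynomial has nonpositive derivative; this is applied first
to g', then to g. -/
theorem le_taylor_of_second_deriv_le {g g' g'' : ℝ → ℝ} {δ A : ℝ}
    (hg : ∀ s ∈ Icc 0 δ, HasDerivAt g (g' s) s) (hg' : ∀ s ∈ Icc 0 δ, HasDerivAt g' (g'' s) s)
    (hA : ∀ s ∈ Icc 0 δ, g'' s ≤ A) {s : ℝ} (hs : s ∈ Icc 0 δ) :
    g s ≤ g 0 + s * g' 0 + s ^ 2 / 2 * A := by
  have h0 : (0 : ℝ) ∈ Icc 0 δ := ⟨le_rfl, hs.1.trans hs.2⟩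
  have key : ∀ {u u' : ℝ → ℝ}, (∀ s ∈ Icc 0 δ, HasDerivAt u (u' s) s) →
      (∀ s ∈ Icc 0 δ, u' s ≤ 0) → ∀ s ∈ Icc 0 δ, u s ≤ u 0 := by
    intro u u' hu hu' s hs
    refine antitoneOn_of_deriv_nonpos (convex_Icc 0 δ)
      (fun t ht ↦ (hu t ht).continuousAt.continuousWithinAt) (fun t ht ↦ ?_) (fun t ht ↦ ?_)
      h0 hs hs.1
    · exact (hu t (interior_subset ht)).differentiableAt.differentiableWithinAt
    · rw [(hu t (interior_subset ht)).deriv]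
      exact hu' t (interior_subset ht)
  have h1 : ∀ s ∈ Icc 0 δ, g' s ≤ g' 0 + A * s := by
    intro s hs
    have := key (u := fun s ↦ g' s - A * s) (u' := fun s ↦ g'' s - A)
      (fun s hs ↦ ((hg' s hs).sub ((hasDerivAt_id s).const_mul A)).congr_deriv (by simp))
      (fun s hs ↦ by linarith [hA s hs]) s hs
    simp only [mul_zero, sub_zero] at this
    linarith
  have h2 := key (u := fun s ↦ g s - (s * g' 0 + s ^ 2 / 2 * A))
    (u' := fun s ↦ g' s - (g' 0 + A * s)) (fun s hs ↦ by
      refine ((hg s hs).sub (((hasDerivAt_id s).mul_const (g' 0)).add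
        ((((hasDerivAt_id s).pow 2).div_const 2).mul_const A))).congr_deriv ?_
      simp only [id]
      push_cast
      ring) (fun s hs ↦ by linarith [h1 s hs]) s hs
  simp only [zero_mul, ne_eq, OfNat.ofNat_ne_zero, not_false_eq_true, zero_pow, zero_div,
    add_zero, sub_zero] at h2
  linarith

/-- A one-sided second order Taylor expansion, uniform with respect to a parameter in a compact
set. -/
theorem exists_uniform_taylor {A : Type*} [NormedAddCommGroup A] [NormedSpace ℝ A]
    {F : ℝ × A → ℝ} {W : Set (ℝ × A)} (hW : IsOpen W) (hF : ContDiffOn ℝ 2 F W) {K : Set A}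
    (hK : IsCompact K) (hKW : ∀ a ∈ K, ((0 : ℝ), a) ∈ W) {F₁ : A → ℝ}
    (hF₁ : ∀ a ∈ K, HasDerivAt (fun s ↦ F (s, a)) (F₁ a) 0) :
    ∃ F₂ : A → ℝ, ContinuousOn F₂ K ∧
      (∀ a ∈ K, HasDerivAt (deriv fun s ↦ F (s, a)) (F₂ a) 0) ∧
      ∀ ε > 0, ∃ δ > 0, ∀ a ∈ K, ∀ s ∈ Icc 0 δ, (s, a) ∈ W ∧
        F (s, a) ≤ F (0, a) + s * F₁ a + s ^ 2 / 2 * (F₂ a + ε) := by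
  set D₁ : ℝ × A → ℝ := fun p ↦ fderiv ℝ F p (1, 0) with hD₁
  have hD₁c : ContDiffOn ℝ 1 D₁ W :=
    (hF.fderiv_of_isOpen hW (by norm_num)).clm_apply contDiffOn_const
  set D₂ : ℝ × A → ℝ := fun p ↦ fderiv ℝ D₁ p (1, 0) with hD₂
  have hD₂c : ContinuousOn D₂ W :=
    (hD₁c.continuousOn_fderiv_of_isOpen hW le_rfl).clm_apply continuousOn_const
  have hline : ∀ (s : ℝ) (a : A), HasDerivAt (fun s : ℝ ↦ (s, a)) ((1 : ℝ), (0 : A)) s :=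
    fun s a ↦ (hasDerivAt_id s).prodMk (hasDerivAt_const s a)
  have d1 : ∀ s a, (s, a) ∈ W → HasDerivAt (fun s ↦ F (s, a)) (D₁ (s, a)) s := by
    intro s a h
    have h1 := ((hF.differentiableOn (by norm_num)).differentiableAt (hW.mem_nhds h)).hasFDerivAt
    exact h1.comp_hasDerivAt s (hline s a)
  have d2 : ∀ s a, (s, a) ∈ W → HasDerivAt (fun s ↦ D₁ (s, a)) (D₂ (s, a)) s := by
    intro s a h
    have h1 := ((hD₁c.differentiableOn (by norm_num)).differentiableAt
      (hW.mem_nhds h)).hasFDerivAt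
    exact h1.comp_hasDerivAt s (hline s a)
  have e1 : ∀ a ∈ K, F₁ a = D₁ (0, a) := fun a ha ↦ (hF₁ a ha).unique (d1 0 a (hKW a ha))
  refine ⟨fun a ↦ D₂ (0, a), hD₂c.comp (by fun_prop) hKW, fun a ha ↦ ?_, fun ε hε ↦ ?_⟩
  · refine (d2 0 a (hKW a ha)).congr_of_eventuallyEq ?_
    have : ∀ᶠ s in 𝓝 (0 : ℝ), (s, a) ∈ W :=
      (hline 0 a).continuousAt.eventually (hW.mem_nhds (hKW a ha))
    filter_upwards [this] with s hs using (d1 s a hs).deriv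
  -- Continuity of the second derivative along {0} × K and compactness of K give one interval of s
  -- valid for all parameters.
  have hev : ∀ᶠ s in 𝓝 (0 : ℝ), ∀ a ∈ K, (s, a) ∈ W ∧ D₂ (s, a) ≤ D₂ (0, a) + ε := by
    refine hK.eventually_forall_of_forall_eventually fun a ha ↦ ?_
    have h1 : ContinuousAt D₂ (0, a) := hD₂c.continuousAt (hW.mem_nhds (hKW a ha))
    have h2 : ContinuousAt (fun p : ℝ × A ↦ D₂ (0, p.2)) (0, a) :=
      ContinuousAt.comp (g := D₂) (f := fun p : ℝ × A ↦ ((0 : ℝ), p.2)) h1 (by fun_prop)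
    have h3 : ∀ᶠ p in 𝓝 ((0 : ℝ), a), D₂ p < D₂ (0, p.2) + ε :=
      h1.eventually_lt (h2.add continuousAt_const) (by simpa using hε)
    filter_upwards [h3, hW.mem_nhds (hKW a ha)] with p hp hpW using ⟨hpW, hp.le⟩
  obtain ⟨δ, hδ, hball⟩ := Metric.nhds_basis_closedBall.eventually_iff.1 hev
  have hmem : ∀ s ∈ Icc 0 δ, s ∈ Metric.closedBall (0 : ℝ) δ := fun s hs ↦ by
    rw [mem_closedBall_zero_iff, Real.norm_of_nonneg hs.1]; exact hs.2
  refine ⟨δ, hδ, fun a ha s hs ↦ ⟨(hball (hmem s hs) a ha).1, ?_⟩⟩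
  rw [e1 a ha]
  exact le_taylor_of_second_deriv_le (g := fun s ↦ F (s, a)) (g' := fun s ↦ D₁ (s, a))
    (g'' := fun s ↦ D₂ (s, a)) (fun s hs ↦ d1 s a (hball (hmem s hs) a ha).1)
    (fun s hs ↦ d2 s a (hball (hmem s hs) a ha).1) (fun s hs ↦ (hball (hmem s hs) a ha).2) hs

end Analysis

/-! ### Curves realizing distances are C¹ with unit speed -/

section Regularity

variable {E : Type*} [NormedAddCommGroup E] [NormedSpace ℂ E] [FiniteDimensional ℂ E]
  {M : Type*} [MetricSpace M] [ChartedSpace E M] [IsManifold 𝓘(ℂ, E) ω M]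
  [RiemannianBundle (fun x : M ↦ TangentSpace 𝓘(ℝ, E) x)]
  [IsContMDiffRiemannianBundle 𝓘(ℝ, E) ∞ E (fun x : M ↦ TangentSpace 𝓘(ℝ, E) x)]
  [IsRiemannianManifold 𝓘(ℝ, E) M]

theorem continuous_chartNorm (c : M) (y : E) : Continuous fun v ↦ chartNorm c y v := by
  unfold chartNorm
  fun_prop

/-- Here u and v stand for the frozen norms of the two steps of duration h and w for that of the
step of duration 2h. As u, v ≤ h(1 + O(h)) and w ≥ 2h(1 - O(h)), the terms of order h² cancel. -/
theorem parallelogram_defect_le {h K u v w : ℝ} (hh : 0 < h) (hh1 : h ≤ 1) (hK : 0 ≤ K)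
    (hu0 : 0 ≤ u) (hv0 : 0 ≤ v) (hu : u ≤ (1 + K * h) * h) (hv : v ≤ (1 + K * h) * h)
    (hw : 2 * h ≤ (1 + K * h) * w) : 2 * u ^ 2 + 2 * v ^ 2 - w ^ 2 ≤ 4 * K * (4 + K) * h ^ 3 := by
  set k := K * h with hk
  have hk0 : 0 ≤ k := by positivity
  have h6 : 4 * h ^ 2 * (1 - 2 * k) ≤ w ^ 2 := by
    have h7 : (2 * h) ^ 2 ≤ ((1 + k) * w) ^ 2 := pow_le_pow_left₀ (by positivity) hw 2
    rw [mul_pow] at h7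
    -- This is 1/(1+k)² ≥ 1 - 2k, valid for every k ≥ 0 since the left side equals 1 - 3k² - 2k³.
    have h8 : (1 - 2 * k) * (1 + k) ^ 2 ≤ 1 := by
      nlinarith [mul_nonneg hk0 (sq_nonneg k), sq_nonneg k]
    have h9 : 0 < (1 + k) ^ 2 := by positivity
    refine le_of_mul_le_mul_left ?_ h9
    have h10 := mul_le_mul_of_nonneg_left h8 (by positivity : 0 ≤ 4 * h ^ 2)
    linarith
  have h11 : u ^ 2 ≤ ((1 + k) * h) ^ 2 := pow_le_pow_left₀ hu0 hu 2
  have h12 : v ^ 2 ≤ ((1 + k) * h) ^ 2 := pow_le_pow_left₀ hv0 hv 2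
  have h14 : 2 * u ^ 2 + 2 * v ^ 2 - w ^ 2 ≤ 4 * h ^ 2 * (4 * k + k ^ 2) := by linarith
  refine h14.trans ?_
  have h15 : k ^ 2 ≤ K ^ 2 * h := by
    have := mul_nonneg (sq_nonneg K) (mul_nonneg hh.le (sub_nonneg.2 hh1))
    simp only [hk]
    linarith
  have h16 : 0 ≤ 4 * h ^ 2 := by positivity
  have h17 := mul_le_mul_of_nonneg_left (add_le_add_right h15 (4 * k)) h16
  refine h17.trans (le_of_eq ?_)
  simp only [hk]
  ring

set_option maxHeartbeats 400000 in
/-- A curve realizing distances is continuously differentiable in charts, with unit speed. -/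
theorem exists_hasDerivAt_of_isometry {γ : ℝ → M} (hγ : Isometry γ) {c : M} {t₀ : ℝ}
    (hc : γ t₀ ∈ (extChartAt 𝓘(ℝ, E) c).source) :
    ∃ δ > 0, ∃ x' : ℝ → E, ContinuousOn x' (Ioo (t₀ - δ) (t₀ + δ)) ∧
      ∀ t ∈ Ioo (t₀ - δ) (t₀ + δ), γ t ∈ (extChartAt 𝓘(ℝ, E) c).source ∧
        HasDerivAt (fun τ ↦ extChartAt 𝓘(ℝ, E) c (γ τ)) (x' t) t ∧
        metricInChart c (extChartAt 𝓘(ℝ, E) c (γ t)) (x' t) (x' t) = 1 := by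
  set φ := extChartAt 𝓘(ℝ, E) c with hφ
  obtain ⟨r, hr, κ, hκ, K, hK, hrt, hκN, hcmp⟩ := exists_chart_comparison (φ.map_source hc)
  set x : ℝ → E := fun τ ↦ φ (γ τ) with hx
  have hcE : CompleteSpace E := FiniteDimensional.complete ℂ E
  have hev : ∀ᶠ t in 𝓝 t₀, γ t ∈ φ.source ∧ x t ∈ Metric.ball (φ (γ t₀)) r := by
    have h1 : φ.source ∩ φ ⁻¹' Metric.ball (φ (γ t₀)) r ∈ 𝓝 (γ t₀) :=
      inter_mem (extChartAt_source_mem_nhds' hc)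
        ((continuousAt_extChartAt' hc).preimage_mem_nhds (Metric.ball_mem_nhds _ hr))
    exact hγ.continuous.continuousAt.preimage_mem_nhds h1
  obtain ⟨δ₀, hδ₀, hδ₀b⟩ := Metric.nhds_basis_closedBall.eventually_iff.1 hev
  -- The bound by 1 ensures h ≤ 1, so that higher powers of h are absorbed in h³.
  set δ := min δ₀ 1 with hδ
  have hδ0 : 0 < δ := lt_min hδ₀ one_pos
  have hin : ∀ t ∈ Icc (t₀ - δ) (t₀ + δ), γ t ∈ φ.source ∧ x t ∈ Metric.ball (φ (γ t₀)) r := by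
    intro t ht
    refine hδ₀b ?_
    rw [Metric.mem_closedBall, Real.dist_eq, abs_le]
    have : δ ≤ δ₀ := min_le_left _ _
    constructor <;> linarith [ht.1, ht.2]
  have hψ : ∀ t ∈ Icc (t₀ - δ) (t₀ + δ), φ.symm (x t) = γ t := fun t ht ↦
    φ.left_inv (hin t ht).1
  have hxc : ContinuousOn x (Icc (t₀ - δ) (t₀ + δ)) := by
    intro t ht
    exact ((continuousAt_extChartAt' (hin t ht).1).comp
      hγ.continuous.continuousAt).continuousWithinAt
  have hdist : ∀ s t, dist (γ s) (γ t) = |s - t| := fun s t ↦ by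
    rw [hγ.dist_eq, Real.dist_eq]
  set K₁ := K + K * κ with hK₁
  have hKK : 0 ≤ K * κ := mul_nonneg hK hκ.le
  have hK₁0 : 0 ≤ K₁ := by positivity
  have step : ∀ t ∈ Icc (t₀ - δ) (t₀ + δ), ∀ τ ∈ Icc (t₀ - δ) (t₀ + δ),
      chartNorm c (x t) (x τ - x t) ≤ (1 + K₁ * |t - τ|) * |t - τ| ∧ ‖x τ - x t‖ ≤ κ * |t - τ| ∧
      |t - τ| ≤ (1 + K₁ * |t - τ|) * chartNorm c (x t) (x τ - x t) := by
    intro t ht τ hτ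
    obtain ⟨h1, -, h3, h4⟩ := hcmp (x t) (hin t ht).2 (x τ) (hin τ hτ).2
    rw [hψ t ht, hψ τ hτ, hdist] at h1 h3
    have h5 := h4 (x t) (hin t ht).2 (κ * |t - τ|) (by simp; positivity) h1
    rw [hψ t ht, hψ τ hτ, hdist] at h5
    have h6 := abs_nonneg (t - τ)
    refine ⟨h3.trans ?_, h1, h5.trans ?_⟩
    · refine mul_le_mul_of_nonneg_right ?_ h6
      nlinarith [mul_nonneg hKK h6]
    · refine mul_le_mul_of_nonneg_right ?_ (chartNorm_nonneg _ _ _)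
      nlinarith [mul_nonneg hK h6]
  have second : ∀ t h, 0 < h → t₀ - δ < t - h → t + h < t₀ + δ →
      ‖x (t + h) + x (t - h) - (2 : ℝ) • x t‖ ^ 2 ≤ κ ^ 2 * (4 * K₁ * (4 + K₁)) * h ^ 3 := by
    intro t h hh hth hth'
    have ht : t ∈ Icc (t₀ - δ) (t₀ + δ) := ⟨by linarith, by linarith⟩
    have htp : t + h ∈ Icc (t₀ - δ) (t₀ + δ) := ⟨by linarith, by linarith⟩
    have htm : t - h ∈ Icc (t₀ - δ) (t₀ + δ) := ⟨by linarith, by linarith⟩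
    have hh1 : h ≤ 1 := by
      have : δ ≤ 1 := min_le_right _ _
      linarith
    obtain ⟨a1, a2, -⟩ := step t ht _ htp
    obtain ⟨b1, b2, -⟩ := step t ht _ htm
    have e1 : |t - (t + h)| = h := by rw [sub_add_cancel_left, abs_neg, abs_of_pos hh]
    have e2 : |t - (t - h)| = h := by rw [sub_sub_cancel, abs_of_pos hh]
    rw [e1] at a1 a2
    rw [e2] at b1 b2
    -- The chord from t - h to t + h is measured with the metric frozen at the midpoint x t, the
    -- same metric as for the two half steps; the parallelogram law needs a single norm.
    have h4 := (hcmp _ (hin _ htm).2 _ (hin _ htp).2).2.2.2 (x t) (hin t ht).2 (κ * h) b2 a2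
    rw [hψ _ htm, hψ _ htp, hdist] at h4
    have e3 : |t - h - (t + h)| = 2 * h := by
      rw [show t - h - (t + h) = -(2 * h) by ring, abs_neg, abs_of_pos (by linarith)]
    rw [e3] at h4
    set u := x (t + h) - x t with hu
    set v := x (t - h) - x t with hv
    have e4 : x (t + h) - x (t - h) = u - v := by simp [hu, hv]
    have e5 : x (t + h) + x (t - h) - (2 : ℝ) • x t = u + v := by
      simp only [hu, hv, two_smul]; abel
    rw [e4] at h4
    rw [e5]
    have hN := chartNorm_nonneg c (x t) (u - v)
    have h5 : 2 * h ≤ (1 + K₁ * h) * chartNorm c (x t) (u - v) := by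
      refine h4.trans (mul_le_mul_of_nonneg_right ?_ hN)
      simp only [hK₁]
      nlinarith [mul_nonneg hK hh.le]
    have h13 : chartNorm c (x t) (u + v) ^ 2 ≤ 4 * K₁ * (4 + K₁) * h ^ 3 := by
      rw [chartNorm_parallelogram]
      exact parallelogram_defect_le hh hh1 hK₁0 (chartNorm_nonneg _ _ _) (chartNorm_nonneg _ _ _)
        a1 b1 h5
    have h18 := pow_le_pow_left₀ (norm_nonneg _) (hκN (x t) (hin t ht).2 (u + v)) 2
    rw [mul_pow] at h18
    refine h18.trans ?_
    rw [mul_assoc]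
    exact mul_le_mul_of_nonneg_left h13 (sq_nonneg κ)
  have hle : t₀ - δ ≤ t₀ + δ := by linarith
  set f := IccExtend hle ((Icc (t₀ - δ) (t₀ + δ)).domRestrict x) with hf
  have hfc : Continuous f := hxc.domRestrict.Icc_extend'
  have ef : ∀ t ∈ Icc (t₀ - δ) (t₀ + δ), f t = x t := fun t ht ↦ by
    rw [hf, IccExtend_of_mem _ _ ht]; rfl
  obtain ⟨x', hx'c, hx'⟩ := exists_hasDerivAt_of_second_difference hfc (a := t₀ - δ) (b := t₀ + δ)
    (C := κ ^ 2 * (4 * K₁ * (4 + K₁))) fun t h hh h1 h2 ↦ by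
      rw [ef _ ⟨by linarith, by linarith⟩, ef _ ⟨by linarith, by linarith⟩,
        ef _ ⟨by linarith, by linarith⟩]
      exact second t h hh h1 h2
  have hxd : ∀ t ∈ Ioo (t₀ - δ) (t₀ + δ), HasDerivAt x (x' t) t := by
    intro t ht
    refine (hx' t ht).congr_of_eventuallyEq ?_
    filter_upwards [Ioo_mem_nhds ht.1 ht.2] with τ hτ
    exact (ef τ ⟨hτ.1.le, hτ.2.le⟩).symm
  refine ⟨δ, hδ0, x', hx'c, fun t ht ↦ ⟨(hin t ⟨ht.1.le, ht.2.le⟩).1, hxd t ht, ?_⟩⟩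
  have ht' : t ∈ Icc (t₀ - δ) (t₀ + δ) := ⟨ht.1.le, ht.2.le⟩
  have hslope := (hxd t ht).tendsto_slope_zero_right
  have hlim : Tendsto (fun h : ℝ ↦ chartNorm c (x t) (h⁻¹ • (x (t + h) - x t))) (𝓝[>] 0)
      (𝓝 (chartNorm c (x t) (x' t))) :=
    ((continuous_chartNorm c (x t)).tendsto _).comp hslope
  have hevb : ∀ᶠ h in 𝓝[>] (0 : ℝ), 0 < h ∧ t + h < t₀ + δ := by
    refine eventually_mem_nhdsWithin.and (Filter.Eventually.filter_mono nhdsWithin_le_nhds ?_)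
    have : Tendsto (fun h : ℝ ↦ t + h) (𝓝 0) (𝓝 t) := by
      simpa using (continuous_const_add t).tendsto 0
    exact this.eventually (eventually_lt_nhds ht.2)
  -- Unit speed: both comparisons of |t - τ| with the frozen norm, divided by h, squeeze the norm of
  -- the difference quotient to 1.
  have hb : ∀ᶠ h in 𝓝[>] (0 : ℝ), chartNorm c (x t) (h⁻¹ • (x (t + h) - x t)) ≤ 1 + K₁ * h ∧
      1 ≤ (1 + K₁ * h) * chartNorm c (x t) (h⁻¹ • (x (t + h) - x t)) := by
    filter_upwards [hevb] with h hh
    obtain ⟨a1, -, a3⟩ := step t ht' (t + h) ⟨by linarith [ht.1], hh.2.le⟩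
    have e1 : |t - (t + h)| = h := by rw [sub_add_cancel_left, abs_neg, abs_of_pos hh.1]
    rw [e1] at a1 a3
    rw [chartNorm_smul, abs_of_pos (inv_pos.2 hh.1)]
    constructor
    · rw [inv_mul_le_iff₀ hh.1]; linarith
    · rw [← mul_assoc, mul_comm (1 + K₁ * h), mul_assoc, ← div_eq_inv_mul, le_div_iff₀ hh.1]
      linarith
  have hl1 : Tendsto (fun h : ℝ ↦ 1 + K₁ * h) (𝓝[>] 0) (𝓝 1) := by
    have : Continuous fun h : ℝ ↦ 1 + K₁ * h := by fun_prop
    simpa using (this.tendsto 0).mono_left nhdsWithin_le_nhds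
  have u1 : chartNorm c (x t) (x' t) ≤ 1 :=
    le_of_tendsto_of_tendsto hlim hl1 (hb.mono fun _ h ↦ h.1)
  have u2 : 1 ≤ chartNorm c (x t) (x' t) := by
    have := ge_of_tendsto (hl1.mul hlim) (hb.mono fun _ h ↦ h.2)
    simpa using this
  rw [← chartNorm_sq]
  change chartNorm c (x t) (x' t) ^ 2 = 1
  rw [le_antisymm u1 u2, one_pow]

end Regularity

set_option maxSynthPendingDepth 3

/-! ### Christoffel symbols: symmetry, metric compatibility, smoothness -/

section Christoffel

variable {E : Type*} [NormedAddCommGroup E] [NormedSpace ℂ E] [FiniteDimensional ℂ E]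
  {M : Type*} [TopologicalSpace M] [ChartedSpace E M] [IsManifold 𝓘(ℂ, E) ω M]
  [RiemannianBundle (fun x : M ↦ TangentSpace 𝓘(ℝ, E) x)]

theorem metricInChart_injective {c : M} {y : E} (hy : y ∈ (extChartAt 𝓘(ℝ, E) c).target) :
    Function.Injective (metricInChart c y) := by
  rw [injective_iff_map_eq_zero]
  intro u hu
  by_contra hne
  have := metricInChart_self_pos hy hne
  simp [hu] at this

theorem eq_of_metricInChart_eq {c : M} {y u v : E} (hy : y ∈ (extChartAt 𝓘(ℝ, E) c).target)
    (h : ∀ w, metricInChart c y u w = metricInChart c y v w) : u = v :=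
  metricInChart_injective hy (ContinuousLinearMap.ext h)

theorem metricInChart_isInvertible {c : M} {y : E} (hy : y ∈ (extChartAt 𝓘(ℝ, E) c).target) :
    (metricInChart c y).IsInvertible := by
  have hd : Module.finrank ℝ E = Module.finrank ℝ (E →L[ℝ] ℝ) := by
    rw [← LinearMap.toContinuousLinearMap.finrank_eq]
    exact (Subspace.dual_finrank_eq).symm
  refine ⟨((metricInChart c y).toLinearMap.linearEquivOfInjective
    (metricInChart_injective hy) hd).toContinuousLinearEquiv, ?_⟩
  ext; rfl

variable [IsContMDiffRiemannianBundle 𝓘(ℝ, E) ∞ E (fun x : M ↦ TangentSpace 𝓘(ℝ, E) x)]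

theorem hasFDerivAt_metricInChart {c : M} {y : E} (hy : y ∈ (extChartAt 𝓘(ℝ, E) c).target) :
    HasFDerivAt (metricInChart c) (fderiv ℝ (metricInChart c) y) y :=
  (((contDiffOn_metricInChart c).differentiableOn (by simp)).differentiableAt
    ((isOpen_chart_target c).mem_nhds hy)).hasFDerivAt

theorem contDiffOn_fderiv_metricInChart (c : M) :
    ContDiffOn ℝ ∞ (fderiv ℝ (metricInChart c)) (extChartAt 𝓘(ℝ, E) c).target :=
  (contDiffOn_metricInChart c).fderiv_of_isOpen (isOpen_chart_target c) (by simp)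

theorem fderiv_metricInChart_symm {c : M} {y : E} (hy : y ∈ (extChartAt 𝓘(ℝ, E) c).target)
    (w u v : E) : fderiv ℝ (metricInChart c) y w u v = fderiv ℝ (metricInChart c) y w v u := by
  have h1 (u v : E) : HasFDerivAt (fun z ↦ metricInChart c z u v)
      (((fderiv ℝ (metricInChart c) y).flip u).flip v) y := by
    have h2 := ((hasFDerivAt_metricInChart hy).clm_apply (hasFDerivAt_const u y)).clm_apply
      (hasFDerivAt_const v y)
    refine h2.congr_fderiv ?_
    ext w
    simp
  have h2 : (fun z ↦ metricInChart c z u v) = fun z ↦ metricInChart c z v u :=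
    funext fun z ↦ metricInChart_symm c z u v
  have h3 := (h1 u v).unique (h2 ▸ h1 v u)
  exact DFunLike.congr_fun h3 w

theorem contDiffOn_inverse_metricInChart (c : M) :
    ContDiffOn ℝ ∞ (fun y ↦ (metricInChart c y).inverse) (extChartAt 𝓘(ℝ, E) c).target := by
  have hcE : CompleteSpace E := FiniteDimensional.complete ℂ E
  intro y hy
  obtain ⟨e, he⟩ := metricInChart_isInvertible hy
  have h1 : ContDiffAt ℝ ∞ ContinuousLinearMap.inverse (metricInChart c y) := by
    rw [← he]
    exact contDiffAt_map_inverse e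
  exact h1.comp_contDiffWithinAt y (contDiffOn_metricInChart c y hy)

theorem christoffel_symm {c : M} {y : E} (hy : y ∈ (extChartAt 𝓘(ℝ, E) c).target) (u v : E) :
    christoffel c y u v = christoffel c y v u := by
  refine eq_of_metricInChart_eq hy fun w ↦ ?_
  rw [metricInChart_christoffel c y u v w hy, metricInChart_christoffel c y v u w hy,
    fderiv_metricInChart_symm hy w u v]
  ring

/-- The Levi-Civita connection is compatible with the metric. -/
theorem fderiv_metricInChart_eq {c : M} {y : E} (hy : y ∈ (extChartAt 𝓘(ℝ, E) c).target)
    (w u v : E) : fderiv ℝ (metricInChart c) y w u v =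
      metricInChart c y (christoffel c y w u) v + metricInChart c y u (christoffel c y w v) := by
  rw [metricInChart_symm c y u, metricInChart_christoffel c y w u v hy,
    metricInChart_christoffel c y w v u hy, fderiv_metricInChart_symm hy w v u,
    fderiv_metricInChart_symm hy u w v, fderiv_metricInChart_symm hy v w u]
  ring

/-- The Christoffel symbols as a continuous bilinear map. -/
def christoffelL (c : M) (y : E) : E →L[ℝ] E →L[ℝ] E :=
  LinearMap.toContinuousLinearMap
    ((LinearMap.toContinuousLinearMap (𝕜 := ℝ) (E := E) (F' := E)).toLinearMap ∘ₗ
      LinearMap.mk₂ ℝ (christoffel c y)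
        (fun u u' v ↦ by
          simp only [christoffel, ← map_add]
          congr 1
          ext w
          simp only [smul_apply, map_add, add_apply, sub_apply, ContinuousLinearMap.flip_apply,
            smul_eq_mul]
          ring)
        (fun a u v ↦ by
          simp only [christoffel, ← map_smul]
          congr 1
          ext w
          simp only [smul_apply, map_smul, add_apply, sub_apply, ContinuousLinearMap.flip_apply,
            smul_eq_mul]
          ring)
        (fun u v v' ↦ by
          simp only [christoffel, ← map_add]
          congr 1
          ext w
          simp only [smul_apply, map_add, add_apply, sub_apply, ContinuousLinearMap.flip_apply,
            smul_eq_mul]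
          ring)
        (fun a u v ↦ by
          simp only [christoffel, ← map_smul]
          congr 1
          ext w
          simp only [smul_apply, map_smul, add_apply, sub_apply, ContinuousLinearMap.flip_apply,
            smul_eq_mul]
          ring))

theorem christoffelL_apply (c : M) (y u v : E) : christoffelL c y u v = christoffel c y u v := rfl

theorem contDiffOn_christoffelL (c : M) :
    ContDiffOn ℝ ∞ (christoffelL c) (extChartAt 𝓘(ℝ, E) c).target := by
  rw [contDiffOn_clm_apply]
  intro u
  rw [contDiffOn_clm_apply]
  intro v
  simp only [christoffelL_apply, christoffel]
  refine (contDiffOn_inverse_metricInChart c).clm_apply ?_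
  have h1 := contDiffOn_fderiv_metricInChart (E := E) c
  refine ContDiffOn.const_smul (1 / 2 : ℝ)
    ((((h1.clm_apply contDiffOn_const).clm_apply contDiffOn_const).add
      ((h1.clm_apply contDiffOn_const).clm_apply contDiffOn_const)).sub ?_)
  rw [contDiffOn_clm_apply]
  intro w
  simp only [ContinuousLinearMap.flip_apply]
  exact ((h1.clm_apply contDiffOn_const).clm_apply contDiffOn_const).clm_apply contDiffOn_const

end Christoffel

/-! ### First variation and the geodesic equation -/

section Geodesic

variable {E : Type*} [NormedAddCommGroup E] [NormedSpace ℂ E] [FiniteDimensional ℂ E]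
  {M : Type*} [MetricSpace M] [ChartedSpace E M] [IsManifold 𝓘(ℂ, E) ω M]
  [RiemannianBundle (fun x : M ↦ TangentSpace 𝓘(ℝ, E) x)]
  [IsContMDiffRiemannianBundle 𝓘(ℝ, E) ∞ E (fun x : M ↦ TangentSpace 𝓘(ℝ, E) x)]
  [IsRiemannianManifold 𝓘(ℝ, E) M]

/-- Replaces length by energy. Equality holds at a = 1, so around a unit speed curve nothing is lost
to first order, nor to second order when the first variation of the energy density vanishes. -/
theorem sqrt_le_half_one_add {a : ℝ} (ha : 0 ≤ a) : √a ≤ (1 + a) / 2 := by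
  nlinarith [Real.sq_sqrt ha, sq_nonneg (√a - 1)]

theorem hasDerivAt_metricInChart_apply {c : M} {X A B : ℝ → E} {X' A' B' : E} {s : ℝ}
    (hs : X s ∈ (extChartAt 𝓘(ℝ, E) c).target) (hX : HasDerivAt X X' s) (hA : HasDerivAt A A' s)
    (hB : HasDerivAt B B' s) :
    HasDerivAt (fun s ↦ metricInChart c (X s) (A s) (B s))
      (fderiv ℝ (metricInChart c) (X s) X' (A s) (B s) + metricInChart c (X s) A' (B s) +
        metricInChart c (X s) (A s) B') s := by
  have h1 := (((hasFDerivAt_metricInChart hs).comp_hasDerivAt s hX).clm_apply hA).clm_apply hB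
  exact h1.congr_deriv (by simp only [Function.comp, add_apply])

set_option maxHeartbeats 400000 in
/-- The first variation of energy in the direction of `f • e`, one-sided version. -/
theorem first_variation_nonneg {c : M} {a b : ℝ} (hab : a < b) {x x' : ℝ → E}
    (hxU : MapsTo x (Icc a b) (extChartAt 𝓘(ℝ, E) c).target)
    (hx : ∀ t ∈ Icc a b, HasDerivAt x (x' t) t) (hx' : ContinuousOn x' (Icc a b))
    (hunit : ∀ t ∈ Icc a b, metricInChart c (x t) (x' t) (x' t) = 1)
    (hmin : b - a ≤
      dist ((extChartAt 𝓘(ℝ, E) c).symm (x a)) ((extChartAt 𝓘(ℝ, E) c).symm (x b)))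
    (e : E) {f f' : ℝ → ℝ} (hf' : Continuous f') (hf : ∀ t, HasDerivAt f (f' t) t)
    (hfa : f a = 0) (hfb : f b = 0) :
    0 ≤ ∫ t in a..b, (fderiv ℝ (metricInChart c) (x t) e (x' t) (x' t) * f t +
      2 * metricInChart c (x t) (x' t) e * f' t) := by
  set U := (extChartAt 𝓘(ℝ, E) c).target with hU
  have hUo : IsOpen U := isOpen_chart_target c
  have hxc : ContinuousOn x (Icc a b) := fun t ht ↦ (hx t ht).continuousAt.continuousWithinAt
  have hfc : Continuous f := continuous_iff_continuousAt.2 fun t ↦ (hf t).continuousAt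
  -- The variation and its velocity are functions of s and of the tuple (x, x', f, f'). Over [a, b]
  -- the tuple runs through a compact set, so the Taylor expansion in s is uniform in t although x'
  -- is only known to be continuous.
  set X : ℝ × (E × E × ℝ × ℝ) → E := fun p ↦ p.2.1 + (p.1 * p.2.2.2.1) • e with hX
  set Y : ℝ × (E × E × ℝ × ℝ) → E := fun p ↦ p.2.2.1 + (p.1 * p.2.2.2.2) • e with hY
  have hXc : ContDiff ℝ ∞ X := by simp only [hX]; fun_prop
  have hYc : ContDiff ℝ ∞ Y := by simp only [hY]; fun_prop
  set F : ℝ × (E × E × ℝ × ℝ) → ℝ := fun p ↦ metricInChart c (X p) (Y p) (Y p) with hF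
  have hW : IsOpen (X ⁻¹' U) := hUo.preimage hXc.continuous
  have hFc : ContDiffOn ℝ 2 F (X ⁻¹' U) := by
    have h1 : ContDiffOn ℝ ∞ F (X ⁻¹' U) :=
      (((contDiffOn_metricInChart c).comp hXc.contDiffOn fun p hp ↦ hp).clm_apply
        hYc.contDiffOn).clm_apply hYc.contDiffOn
    exact h1.of_le ENat.LEInfty.out
  set α : ℝ → E × E × ℝ × ℝ := fun t ↦ (x t, x' t, f t, f' t) with hα
  have hαc : ContinuousOn α (Icc a b) :=
    hxc.prodMk (hx'.prodMk (hfc.continuousOn.prodMk hf'.continuousOn))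
  have hK : IsCompact (α '' Icc a b) := isCompact_Icc.image_of_continuousOn hαc
  set F₁ : E × E × ℝ × ℝ → ℝ := fun q ↦ fderiv ℝ (metricInChart c) q.1 e q.2.1 q.2.1 * q.2.2.1 +
    2 * metricInChart c q.1 q.2.1 e * q.2.2.2 with hF₁
  have hX0 : ∀ q, X (0, q) = q.1 := fun q ↦ by simp [hX]
  have hY0 : ∀ q, Y (0, q) = q.2.1 := fun q ↦ by simp [hY]
  have hd1 : ∀ q ∈ α '' Icc a b, HasDerivAt (fun s ↦ F (s, q)) (F₁ q) 0 := by
    rintro _ ⟨t, ht, rfl⟩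
    set q := α t
    have hXd : HasDerivAt (fun s : ℝ ↦ X (s, q)) (q.2.2.1 • e) 0 := by
      simp only [hX]
      simpa using (((hasDerivAt_id (0 : ℝ)).mul_const q.2.2.1).smul_const e).const_add q.1
    have hYd : HasDerivAt (fun s : ℝ ↦ Y (s, q)) (q.2.2.2 • e) 0 := by
      simp only [hY]
      simpa using (((hasDerivAt_id (0 : ℝ)).mul_const q.2.2.2).smul_const e).const_add q.2.1
    have h1 := hasDerivAt_metricInChart_apply (by rw [hX0]; exact hxU ht) hXd hYd hYd
    refine h1.congr_deriv ?_
    rw [hX0, hY0, hF₁]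
    simp only [map_smul, smul_apply, smul_eq_mul]
    rw [metricInChart_symm c q.1 e q.2.1]
    ring
  obtain ⟨F₂, hF₂c, -, hT⟩ := exists_uniform_taylor hW hFc hK
    (by rintro _ ⟨t, ht, rfl⟩; change X _ ∈ U; rw [hX0]; exact hxU ht) hd1
  obtain ⟨δ, hδ, hTδ⟩ := hT 1 one_pos
  obtain ⟨C, hC⟩ := hK.exists_bound_of_continuousOn hF₂c
  set I := ∫ t in a..b, F₁ (α t) with hI
  have hF₁c : ContinuousOn (fun t ↦ F₁ (α t)) (Icc a b) := by
    simp only [hF₁, hα]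
    have hD := (contDiffOn_fderiv_metricInChart (E := E) c).continuousOn.comp hxc hxU
    refine ContinuousOn.add (ContinuousOn.mul ?_ hfc.continuousOn) (ContinuousOn.mul ?_
      hf'.continuousOn)
    · exact ((hD.clm_apply continuousOn_const).clm_apply hx').clm_apply hx'
    · exact continuousOn_const.mul
        (continuousOn_metricInChart_apply hxc hx' continuousOn_const hxU)
  -- Minimality says that the varied curve has length at least b - a; subtract b - a from the
  -- expansion and divide by s/2.
  have key : ∀ s ∈ Ioc 0 δ, 0 ≤ I + s * ((C + 1) / 2 * (b - a)) := by
    intro s hs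
    have hs' : s ∈ Icc 0 δ := ⟨hs.1.le, hs.2⟩
    have hz : ∀ t ∈ Icc a b, HasDerivWithinAt (fun t ↦ X (s, α t)) (Y (s, α t)) (Icc a b) t := by
      intro t ht
      simp only [hX, hY, hα]
      exact ((hx t ht).add (((hf t).const_mul s).smul_const e)).hasDerivWithinAt
    have hzc : ContinuousOn (fun t ↦ Y (s, α t)) (Icc a b) :=
      hYc.continuous.comp_continuousOn (continuousOn_const.prodMk hαc)
    have hzU : MapsTo (fun t ↦ X (s, α t)) (Icc a b) U := fun t ht ↦
      (hTδ _ (mem_image_of_mem α ht) s hs').1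
    have h1 := dist_le_integral_chart (c := c) hab.le hz hzc hzU
    have ea : X (s, α a) = x a := by simp [hX, hα, hfa]
    have eb : X (s, α b) = x b := by simp [hX, hα, hfb]
    simp only [ea, eb] at h1
    have h2 := hmin.trans h1
    have h3 : ∫ t in a..b, √(metricInChart c (X (s, α t)) (Y (s, α t)) (Y (s, α t))) ≤
        ∫ t in a..b, (1 + (s / 2 * F₁ (α t) + s ^ 2 / 4 * (C + 1))) := by
      refine intervalIntegral.integral_mono_on hab.le ?_ ?_ fun t ht ↦ ?_
      · refine ContinuousOn.intervalIntegrable_of_Icc hab.le (ContinuousOn.sqrt ?_)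
        exact continuousOn_metricInChart_apply
          (fun t ht ↦ (hz t ht).continuousWithinAt) hzc hzc hzU
      · exact ContinuousOn.intervalIntegrable_of_Icc hab.le (continuousOn_const.add
          ((continuousOn_const.mul hF₁c).add continuousOn_const))
      · refine (sqrt_le_half_one_add (metricInChart_self_nonneg _ _ _)).trans ?_
        have h4 := (hTδ _ (mem_image_of_mem α ht) s hs').2
        have h5 : F (0, α t) = 1 := by
          simp only [hF, hX0, hY0]; exact hunit t ht
        have h6 := (le_abs_self _).trans (hC _ (mem_image_of_mem α ht))
        have h7 := mul_le_mul_of_nonneg_left h6 (by positivity : 0 ≤ s ^ 2 / 2)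
        rw [h5] at h4
        change (1 + F (s, α t)) / 2 ≤ _
        linarith
    have h4 := h2.trans h3
    have hInt : IntervalIntegrable (fun t ↦ s / 2 * F₁ (α t)) volume a b :=
      ContinuousOn.intervalIntegrable_of_Icc hab.le (continuousOn_const.mul hF₁c)
    rw [intervalIntegral.integral_add (f := fun _ ↦ (1 : ℝ)) intervalIntegrable_const
      (hInt.add intervalIntegrable_const), intervalIntegral.integral_add
      hInt intervalIntegrable_const, intervalIntegral.integral_const_mul] at h4
    simp only [intervalIntegral.integral_const, smul_eq_mul] at h4
    have h5 : 0 ≤ s / 2 * (I + s * ((C + 1) / 2 * (b - a))) := by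
      rw [← hI] at h4; linarith
    exact nonneg_of_mul_nonneg_right h5 (by linarith [hs.1])
  have hlim : Tendsto (fun s : ℝ ↦ I + s * ((C + 1) / 2 * (b - a))) (𝓝[>] 0) (𝓝 I) := by
    have : Continuous fun s : ℝ ↦ I + s * ((C + 1) / 2 * (b - a)) := by fun_prop
    simpa using (this.tendsto 0).mono_left nhdsWithin_le_nhds
  refine ge_of_tendsto hlim ?_
  filter_upwards [Ioc_mem_nhdsGT hδ] with s hs using key s hs

/-- A unit speed curve realizing the distance between its endpoints satisfies the geodesic
equation in a chart. -/
theorem hasDerivAt_of_minimizing {c : M} {a b : ℝ} {x x' : ℝ → E}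
    (hxU : MapsTo x (Icc a b) (extChartAt 𝓘(ℝ, E) c).target)
    (hx : ∀ t ∈ Icc a b, HasDerivAt x (x' t) t) (hx' : ContinuousOn x' (Icc a b))
    (hunit : ∀ t ∈ Icc a b, metricInChart c (x t) (x' t) (x' t) = 1)
    (hmin : b - a ≤
      dist ((extChartAt 𝓘(ℝ, E) c).symm (x a)) ((extChartAt 𝓘(ℝ, E) c).symm (x b)))
    {t : ℝ} (ht : t ∈ Ioo a b) :
    HasDerivAt x' (-christoffel c (x t) (x' t) (x' t)) t := by
  have hab : a < b := ht.1.trans ht.2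
  have ht' : t ∈ Icc a b := ⟨ht.1.le, ht.2.le⟩
  have hcE : CompleteSpace E := FiniteDimensional.complete ℂ E
  have hxc : ContinuousOn x (Icc a b) := fun t ht ↦ (hx t ht).continuousAt.continuousWithinAt
  have hD := (contDiffOn_fderiv_metricInChart (E := E) c).continuousOn.comp hxc hxU
  have hPc (e : E) : ContinuousOn (fun t ↦ 2 * metricInChart c (x t) (x' t) e) (Icc a b) :=
    continuousOn_const.mul (continuousOn_metricInChart_apply hxc hx' continuousOn_const hxU)
  have hQc (e : E) : ContinuousOn
      (fun t ↦ fderiv ℝ (metricInChart c) (x t) e (x' t) (x' t)) (Icc a b) :=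
    ((hD.clm_apply continuousOn_const).clm_apply hx').clm_apply hx'
  -- The one-sided inequality for both f and -f is the vanishing of the first variation.
  have hdbr (e : E) := du_bois_reymond hab (hPc e) (hQc e) fun f f' hf' hf hfa hfb ↦ by
    refine le_antisymm ?_ (first_variation_nonneg hab hxU hx hx' hunit hmin e hf' hf hfa hfb)
    have h1 := first_variation_nonneg hab hxU hx hx' hunit hmin e (f := fun t ↦ -f t)
      (f' := fun t ↦ -f' t) hf'.neg (fun t ↦ (hf t).neg) (by simp [hfa]) (by simp [hfb])
    have h2 : ∀ t, fderiv ℝ (metricInChart c) (x t) e (x' t) (x' t) * -f t +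
        2 * metricInChart c (x t) (x' t) e * -f' t =
        -(fderiv ℝ (metricInChart c) (x t) e (x' t) (x' t) * f t +
        2 * metricInChart c (x t) (x' t) e * f' t) := fun t ↦ by ring
    simp only [h2] at h1
    rw [intervalIntegral.integral_neg] at h1
    linarith
  -- Here p is the momentum covector. Du Bois-Reymond says p' = Q, the Euler-Lagrange equation,
  -- without assuming that x' is differentiable; differentiability of x' follows by applying the
  -- inverse metric to p.
  set p : ℝ → E →L[ℝ] ℝ := fun t ↦ metricInChart c (x t) (x' t) with hp
  set Q : ℝ → E →L[ℝ] ℝ := fun t ↦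
    (1 / 2 : ℝ) • ((fderiv ℝ (metricInChart c) (x t)).flip (x' t)).flip (x' t) with hQ
  have hQcont : ContinuousOn Q (Icc a b) := by
    rw [continuousOn_clm_apply]
    intro e
    simp only [hQ, smul_apply, ContinuousLinearMap.flip_apply]
    exact (hQc e).const_smul (1 / 2 : ℝ)
  have hpQ : ∀ τ ∈ Icc a b, p τ = p a + ∫ σ in a..τ, Q σ := by
    intro τ hτ
    ext e
    obtain ⟨k, hk⟩ := hdbr e
    have h1 := hk τ hτ
    have h2 := hk a ⟨le_rfl, hab.le⟩
    rw [intervalIntegral.integral_same, add_zero] at h2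
    have hInt : IntervalIntegrable Q volume a τ :=
      (hQcont.mono (Icc_subset_Icc_right hτ.2)).intervalIntegrable_of_Icc hτ.1
    rw [add_apply, ContinuousLinearMap.intervalIntegral_apply hInt]
    simp only [hQ, hp, smul_apply, ContinuousLinearMap.flip_apply, smul_eq_mul]
    rw [intervalIntegral.integral_const_mul]
    linarith
  have hpd : HasDerivAt p (Q t) t := by
    have hInt : IntervalIntegrable Q volume a t :=
      (hQcont.mono (Icc_subset_Icc_right ht.2.le)).intervalIntegrable_of_Icc ht.1.le
    have h1 : HasDerivAt (fun τ ↦ p a + ∫ σ in a..τ, Q σ) (Q t) t :=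
      (intervalIntegral.integral_hasDerivAt_right hInt
        ((hQcont.mono Ioo_subset_Icc_self).stronglyMeasurableAtFilter isOpen_Ioo t ht)
        (hQcont.continuousAt (Icc_mem_nhds ht.1 ht.2))).const_add (p a)
    refine h1.congr_of_eventuallyEq ?_
    filter_upwards [Icc_mem_nhds ht.1 ht.2] with τ hτ using hpQ τ hτ
  have hinv : DifferentiableAt ℝ (fun y ↦ (metricInChart c y).inverse) (x t) :=
    ((contDiffOn_inverse_metricInChart c).differentiableOn (by simp)).differentiableAt
      ((isOpen_chart_target c).mem_nhds (hxU ht'))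
  have hx'eq : ∀ τ ∈ Icc a b, x' τ = (metricInChart c (x τ)).inverse (p τ) := by
    intro τ hτ
    exact ((metricInChart_isInvertible (hxU hτ)).inverse_apply_eq.2 rfl).symm
  have hdiff : DifferentiableAt ℝ x' t := by
    have h1 : DifferentiableAt ℝ (fun τ ↦ (metricInChart c (x τ)).inverse (p τ)) t :=
      (hinv.comp t (hx t ht').differentiableAt).clm_apply hpd.differentiableAt
    refine h1.congr_of_eventuallyEq ?_
    filter_upwards [Icc_mem_nhds ht.1 ht.2] with τ hτ using hx'eq τ hτ
  have hw := hdiff.hasDerivAt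
  set w := deriv x' t with hwdef
  -- Computing p' by the product rule and comparing with Q gives the defining equation of the
  -- Christoffel symbol.
  have h1 := ((hasFDerivAt_metricInChart (hxU ht')).comp_hasDerivAt t (hx t ht')).clm_apply hw
  have h2 := h1.unique hpd
  suffices w = -christoffel c (x t) (x' t) (x' t) by rwa [this] at hw
  refine eq_of_metricInChart_eq (hxU ht') fun e ↦ ?_
  have h3 := DFunLike.congr_fun h2 e
  simp only [hQ, smul_apply, add_apply, ContinuousLinearMap.flip_apply, smul_eq_mul,
    Function.comp] at h3
  rw [map_neg, neg_apply, metricInChart_christoffel c (x t) (x' t) (x' t) e (hxU ht')]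
  linarith

/-- A curve realizing distances is a unit speed geodesic in every chart. -/
theorem exists_geodesic_of_isometry {γ : ℝ → M} (hγ : Isometry γ) {c : M} {t₀ : ℝ}
    (hc : γ t₀ ∈ (extChartAt 𝓘(ℝ, E) c).source) :
    ∃ δ > 0, ∃ x' : ℝ → E, ∀ t ∈ Ioo (t₀ - δ) (t₀ + δ),
      γ t ∈ (extChartAt 𝓘(ℝ, E) c).source ∧
      HasDerivAt (fun τ ↦ extChartAt 𝓘(ℝ, E) c (γ τ)) (x' t) t ∧
      HasDerivAt x' (-christoffel c (extChartAt 𝓘(ℝ, E) c (γ t)) (x' t) (x' t)) t ∧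
      metricInChart c (extChartAt 𝓘(ℝ, E) c (γ t)) (x' t) (x' t) = 1 := by
  obtain ⟨δ, hδ, x', hx'c, hx'⟩ := exists_hasDerivAt_of_isometry hγ hc
  refine ⟨δ, hδ, x', fun t ht ↦ ⟨(hx' t ht).1, (hx' t ht).2.1, ?_, (hx' t ht).2.2⟩⟩
  obtain ⟨a, ha, hat⟩ := exists_between ht.1
  obtain ⟨b, htb, hb⟩ := exists_between ht.2
  have hsub : Icc a b ⊆ Ioo (t₀ - δ) (t₀ + δ) := fun τ hτ ↦
    ⟨ha.trans_le hτ.1, hτ.2.trans_lt hb⟩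
  refine hasDerivAt_of_minimizing (a := a) (b := b) (x := fun τ ↦ extChartAt 𝓘(ℝ, E) c (γ τ))
    (fun τ hτ ↦ (extChartAt 𝓘(ℝ, E) c).map_source (hx' τ (hsub hτ)).1)
    (fun τ hτ ↦ (hx' τ (hsub hτ)).2.1) (hx'c.mono hsub) (fun τ hτ ↦ (hx' τ (hsub hτ)).2.2) ?_
    ⟨hat, htb⟩
  have hab : a ≤ b := (hat.trans htb).le
  rw [(extChartAt 𝓘(ℝ, E) c).left_inv (hx' a (hsub ⟨le_rfl, hab⟩)).1,
    (extChartAt 𝓘(ℝ, E) c).left_inv (hx' b (hsub ⟨hab, le_rfl⟩)).1, hγ.dist_eq, Real.dist_eq,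
    abs_sub_comm]
  exact le_abs_self _

end Geodesic

/-! ### Holomorphic coordinate changes and transformation laws -/

section Transition

variable {E : Type*} [NormedAddCommGroup E] [NormedSpace ℂ E]
  {M : Type*} [TopologicalSpace M] [ChartedSpace E M] [IsManifold 𝓘(ℂ, E) ω M]

/-- The change of coordinates from the chart centred at `c` to the chart centred at `c'`. -/
def transition (c c' : M) (y : E) : E :=
  extChartAt 𝓘(ℝ, E) c' ((extChartAt 𝓘(ℝ, E) c).symm y)

/-- The domain of the change of coordinates from the chart centred at `c` to the chart centred
at `c'`. -/
def transitionDomain (E : Type*) [NormedAddCommGroup E] [NormedSpace ℂ E]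
    {M : Type*} [TopologicalSpace M] [ChartedSpace E M] (c c' : M) : Set E :=
  (extChartAt 𝓘(ℝ, E) c).target ∩
    (extChartAt 𝓘(ℝ, E) c).symm ⁻¹' (extChartAt 𝓘(ℝ, E) c').source

theorem isOpen_transitionDomain (c c' : M) : IsOpen (transitionDomain E c c') :=
  (continuousOn_extChartAt_symm c).isOpen_inter_preimage (isOpen_chart_target c)
    (isOpen_extChartAt_source c')

theorem transition_mem {c c' : M} {y : E} (hy : y ∈ transitionDomain E c c') :
    transition c c' y ∈ (extChartAt 𝓘(ℝ, E) c').target :=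
  (extChartAt 𝓘(ℝ, E) c').map_source hy.2

theorem symm_transition {c c' : M} {y : E} (hy : y ∈ transitionDomain E c c') :
    (extChartAt 𝓘(ℝ, E) c').symm (transition c c' y) = (extChartAt 𝓘(ℝ, E) c).symm y :=
  (extChartAt 𝓘(ℝ, E) c').left_inv hy.2

theorem contDiffOn_transition (c c' : M) :
    ContDiffOn ℂ ω (transition (E := E) c c') (transitionDomain E c c') := by
  have h := contDiffOn_ext_coord_change (I := 𝓘(ℂ, E)) (n := ω) c' c
  refine h.mono fun y hy ↦ ?_
  rw [PartialEquiv.trans_source, PartialEquiv.symm_source]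
  exact hy

theorem contDiffAt_transition {c c' : M} {y : E} (hy : y ∈ transitionDomain E c c') :
    ContDiffAt ℂ ω (transition c c') y :=
  (contDiffOn_transition c c').contDiffAt ((isOpen_transitionDomain c c').mem_nhds hy)

/-- The real derivative of a holomorphic map is the restriction of scalars of its complex
derivative. -/
theorem fderiv_transition_smul {c c' : M} {y : E} (hy : y ∈ transitionDomain E c c') (a : ℂ)
    (v : E) : fderiv ℝ (transition c c') y (a • v) = a • fderiv ℝ (transition c c') y v := by
  have h1 := (contDiffAt_transition hy).differentiableAt (by simp)
  have h2 : fderiv ℝ (transition c c') y = (fderiv ℂ (transition c c') y).restrictScalars ℝ :=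
    (h1.hasFDerivAt.restrictScalars ℝ).fderiv
  rw [h2]
  simp

theorem contDiffAt_real_transition {c c' : M} {y : E} (hy : y ∈ transitionDomain E c c') :
    ContDiffAt ℝ ∞ (transition c c') y :=
  ((contDiffAt_transition hy).restrict_scalars ℝ).of_le (by simp)

/-- The tangent space at p is E, read through the chart centred at p; so the derivative of an
inverse chart is that of the coordinate change to the chart centred at the image point. -/
theorem mfderiv_chart_symm {c : M} {y : E} (hy : y ∈ (extChartAt 𝓘(ℝ, E) c).target) (v : E) :
    (mfderiv 𝓘(ℝ, E) 𝓘(ℝ, E) (extChartAt 𝓘(ℝ, E) c).symm y v : E) =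
      fderiv ℝ (transition c ((extChartAt 𝓘(ℝ, E) c).symm y)) y v := by
  have h1 := mdifferentiableAt_chart_symm hy
  have h2 := h1.mfderiv
  rw [modelWithCornersSelf_coe, range_id, fderivWithin_univ] at h2
  exact DFunLike.congr_fun h2 v

theorem fderiv_transition_comp {c c' p : M} {y : E} (hy : y ∈ transitionDomain E c c')
    (hy' : transition c c' y ∈ transitionDomain E c' p) (v : E) :
    fderiv ℝ (transition c p) y v =
      fderiv ℝ (transition c' p) (transition c c' y) (fderiv ℝ (transition c c') y v) := by
  have hev : transition (E := E) c p =ᶠ[𝓝 y] transition c' p ∘ transition c c' := by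
    filter_upwards [(isOpen_transitionDomain c c').mem_nhds hy] with z hz
    simp only [transition, Function.comp]
    rw [(extChartAt 𝓘(ℝ, E) c').left_inv hz.2]
  have h1 := ((contDiffAt_real_transition hy').differentiableAt (by simp)).hasFDerivAt
  have h2 := ((contDiffAt_real_transition hy).differentiableAt (by simp)).hasFDerivAt
  rw [((h1.comp y h2).congr_of_eventuallyEq hev).fderiv]
  rfl

variable [RiemannianBundle (fun x : M ↦ TangentSpace 𝓘(ℝ, E) x)]

/-- The inner product of the tangent space at `p`, as a function of vectors of `E`. -/
def tangentInner (p : M) (u v : E) : ℝ :=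
  inner ℝ (show TangentSpace 𝓘(ℝ, E) p from u) (show TangentSpace 𝓘(ℝ, E) p from v)

theorem metricInChart_eq_tangentInner {c : M} {y : E} (hy : y ∈ (extChartAt 𝓘(ℝ, E) c).target)
    (u v : E) : metricInChart c y u v = tangentInner ((extChartAt 𝓘(ℝ, E) c).symm y)
      (fderiv ℝ (transition c ((extChartAt 𝓘(ℝ, E) c).symm y)) y u)
      (fderiv ℝ (transition c ((extChartAt 𝓘(ℝ, E) c).symm y)) y v) := by
  rw [metricInChart_apply, ← mfderiv_chart_symm hy, ← mfderiv_chart_symm hy]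
  rfl

theorem mem_transitionDomain_symm {c : M} {y : E} (hy : y ∈ (extChartAt 𝓘(ℝ, E) c).target) :
    y ∈ transitionDomain E c ((extChartAt 𝓘(ℝ, E) c).symm y) :=
  ⟨hy, mem_extChartAt_source _⟩

theorem metricInChart_transition {c c' : M} {y : E} (hy : y ∈ transitionDomain E c c') (u v : E) :
    metricInChart c y u v = metricInChart c' (transition c c' y)
      (fderiv ℝ (transition c c') y u) (fderiv ℝ (transition c c') y v) := by
  have hy' : transition c c' y ∈ transitionDomain E c' ((extChartAt 𝓘(ℝ, E) c).symm y) := by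
    rw [← symm_transition hy]
    exact mem_transitionDomain_symm (transition_mem hy)
  rw [metricInChart_eq_tangentInner hy.1, metricInChart_eq_tangentInner (transition_mem hy),
    symm_transition hy, fderiv_transition_comp hy hy', fderiv_transition_comp hy hy']

theorem metricInChart_J (hJ : ∀ (x : M) (u v : TangentSpace 𝓘(ℝ, E) x),
      inner ℝ (J x u) (J x v) = inner ℝ u v) {c : M} {y : E}
    (hy : y ∈ (extChartAt 𝓘(ℝ, E) c).target) (u v : E) :
    metricInChart c y (Complex.I • u) (Complex.I • v) = metricInChart c y u v := by
  rw [metricInChart_eq_tangentInner hy, metricInChart_eq_tangentInner hy,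
    fderiv_transition_smul (mem_transitionDomain_symm hy),
    fderiv_transition_smul (mem_transitionDomain_symm hy)]
  exact hJ _ _ _

/-- The derivative preserves the positive definite coordinate metrics. -/
theorem fderiv_transition_injective {c c' : M} {y : E} (hy : y ∈ transitionDomain E c c') :
    Function.Injective (fderiv ℝ (transition c c') y) := by
  rw [injective_iff_map_eq_zero]
  intro v hv
  by_contra hne
  have h1 := metricInChart_self_pos hy.1 hne
  rw [metricInChart_transition hy, hv] at h1
  simp at h1

theorem fderiv_transition_surjective [FiniteDimensional ℂ E] {c c' : M} {y : E}
    (hy : y ∈ transitionDomain E c c') : Function.Surjective (fderiv ℝ (transition c c') y) :=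
  (LinearMap.injective_iff_surjective (f := (fderiv ℝ (transition c c') y).toLinearMap)).1
    (fderiv_transition_injective hy)

/-- The second derivative of the change of coordinates is symmetric. -/
theorem fderiv_fderiv_transition_symm {c c' : M} {y : E} (hy : y ∈ transitionDomain E c c')
    (u v : E) : fderiv ℝ (fderiv ℝ (transition c c')) y u v =
      fderiv ℝ (fderiv ℝ (transition c c')) y v u :=
  ((contDiffAt_real_transition hy).isSymmSndFDerivAt
    (by simpa using ENat.LEInfty.out)).eq u v

theorem hasFDerivAt_fderiv_transition {c c' : M} {y : E} (hy : y ∈ transitionDomain E c c') :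
    HasFDerivAt (fderiv ℝ (transition c c')) (fderiv ℝ (fderiv ℝ (transition c c')) y) y :=
  (((contDiffAt_real_transition hy).fderiv_right (m := ∞) (by simp)).differentiableAt
    (by simp)).hasFDerivAt

/-- Differentiating the complex linearity of the first derivative. This makes the inhomogeneous term
in the transformation law of the Christoffel symbols harmless for J. -/
theorem fderiv_fderiv_transition_smul {c c' : M} {y : E} (hy : y ∈ transitionDomain E c c')
    (a : ℂ) (u v : E) : fderiv ℝ (fderiv ℝ (transition c c')) y u (a • v) =
      a • fderiv ℝ (fderiv ℝ (transition c c')) y u v := by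
  have h0 := hasFDerivAt_fderiv_transition hy
  have h1 := h0.clm_apply (hasFDerivAt_const (a • v) y)
  have h2 := (h0.clm_apply (hasFDerivAt_const v y)).const_smul a
  have hev : (fun z ↦ fderiv ℝ (transition c c') z (a • v)) =ᶠ[𝓝 y]
      fun z ↦ a • fderiv ℝ (transition c c') z v := by
    filter_upwards [(isOpen_transitionDomain c c').mem_nhds hy] with z hz
    exact fderiv_transition_smul hz a v
  have h3 := (h2.congr_of_eventuallyEq hev).unique h1
  have h4 := DFunLike.congr_fun h3 u
  simp at h4
  exact h4.symm

variable [FiniteDimensional ℂ E]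
  [IsContMDiffRiemannianBundle 𝓘(ℝ, E) ∞ E (fun x : M ↦ TangentSpace 𝓘(ℝ, E) x)]

theorem fderiv_metricInChart_transition {c c' : M} {y : E} (hy : y ∈ transitionDomain E c c')
    (w u v : E) : fderiv ℝ (metricInChart c) y w u v =
      fderiv ℝ (metricInChart c') (transition c c' y) (fderiv ℝ (transition c c') y w)
        (fderiv ℝ (transition c c') y u) (fderiv ℝ (transition c c') y v) +
      metricInChart c' (transition c c' y) (fderiv ℝ (fderiv ℝ (transition c c')) y w u)
        (fderiv ℝ (transition c c') y v) +
      metricInChart c' (transition c c' y) (fderiv ℝ (transition c c') y u)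
        (fderiv ℝ (fderiv ℝ (transition c c')) y w v) := by
  have h0 := hasFDerivAt_fderiv_transition hy
  have hθ := ((contDiffAt_real_transition hy).differentiableAt (by simp)).hasFDerivAt
  have h1 := ((((hasFDerivAt_metricInChart (transition_mem hy)).comp y hθ).clm_apply
    (h0.clm_apply (hasFDerivAt_const u y))).clm_apply (h0.clm_apply (hasFDerivAt_const v y)))
  have h2 := ((hasFDerivAt_metricInChart hy.1).clm_apply (hasFDerivAt_const u y)).clm_apply
    (hasFDerivAt_const v y)
  have hev : (fun z ↦ metricInChart c z u v) =ᶠ[𝓝 y] fun z ↦ metricInChart c' (transition c c' z)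
      (fderiv ℝ (transition c c') z u) (fderiv ℝ (transition c c') z v) := by
    filter_upwards [(isOpen_transitionDomain c c').mem_nhds hy] with z hz
    exact metricInChart_transition hz u v
  have h3 := (h1.congr_of_eventuallyEq hev).unique h2
  have h4 := DFunLike.congr_fun h3 w
  simp at h4
  rw [← h4]
  ring

/-- The transformation law of the Christoffel symbols. -/
theorem christoffel_transition {c c' : M} {y : E} (hy : y ∈ transitionDomain E c c') (u v : E) :
    fderiv ℝ (transition c c') y (christoffel c y u v) =
      christoffel c' (transition c c' y) (fderiv ℝ (transition c c') y u)
        (fderiv ℝ (transition c c') y v) + fderiv ℝ (fderiv ℝ (transition c c')) y u v := by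
  refine eq_of_metricInChart_eq (transition_mem hy) fun w' ↦ ?_
  -- It suffices to test against images of vectors, where both sides are given by Koszul's formula.
  obtain ⟨w, rfl⟩ := fderiv_transition_surjective hy w'
  rw [← metricInChart_transition hy, metricInChart_christoffel c y u v w hy.1, map_add, add_apply,
    metricInChart_christoffel c' _ _ _ _ (transition_mem hy),
    fderiv_metricInChart_transition hy, fderiv_metricInChart_transition hy,
    fderiv_metricInChart_transition hy, fderiv_fderiv_transition_symm hy v u,
    fderiv_fderiv_transition_symm hy w u, fderiv_fderiv_transition_symm hy w v]
  rw [metricInChart_symm c' _ (fderiv ℝ (transition c c') y u),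
    metricInChart_symm c' _ (fderiv ℝ (transition c c') y v)]
  ring

end Transition

/-! ### Complex bilinearity of the Christoffel symbols and the curvature in a chart -/

section Kahler

variable {E : Type*} [NormedAddCommGroup E] [NormedSpace ℂ E] [FiniteDimensional ℂ E]
  {M : Type*} [TopologicalSpace M] [ChartedSpace E M] [IsManifold 𝓘(ℂ, E) ω M]
  [RiemannianBundle (fun x : M ↦ TangentSpace 𝓘(ℝ, E) x)]
  [IsContMDiffRiemannianBundle 𝓘(ℝ, E) ∞ E (fun x : M ↦ TangentSpace 𝓘(ℝ, E) x)]

/-- The vector field with constant coordinates `w` in the chart centred at `c`. -/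
def constField (c : M) (w : E) (z : M) : TangentSpace 𝓘(ℝ, E) z :=
  fderiv ℝ (transition c z) (extChartAt 𝓘(ℝ, E) c z) w

theorem constField_eq {c z : M} (hz : z ∈ (extChartAt 𝓘(ℝ, E) c).source) (w : E) :
    constField c w z = mfderivWithin 𝓘(ℝ, E) 𝓘(ℝ, E) (extChartAt 𝓘(ℝ, E) c).symm
      (range 𝓘(ℝ, E)) (extChartAt 𝓘(ℝ, E) c z) w := by
  have hy := (extChartAt 𝓘(ℝ, E) c).map_source hz
  rw [modelWithCornersSelf_coe, range_id, mfderivWithin_univ]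
  refine Eq.trans ?_ (mfderiv_chart_symm hy w).symm
  rw [(extChartAt 𝓘(ℝ, E) c).left_inv hz]
  rfl

theorem fieldInChart_constField {c : M} {y : E} (hy : y ∈ (extChartAt 𝓘(ℝ, E) c).target)
    (w : E) : fieldInChart (constField c w) c y = w := by
  have hz := (extChartAt 𝓘(ℝ, E) c).map_target hy
  rw [fieldInChart, constField_eq hz]
  have h := mfderiv_extChartAt_comp_mfderivWithin_extChartAt_symm' (I := 𝓘(ℝ, E)) hz
  exact DFunLike.congr_fun h w

theorem J_constField {c z : M} (hz : z ∈ (extChartAt 𝓘(ℝ, E) c).source) (w : E) :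
    J z (constField c w z) = constField c (Complex.I • w) z := by
  have hy := (extChartAt 𝓘(ℝ, E) c).map_source hz
  have h := mem_transitionDomain_symm hy
  rw [(extChartAt 𝓘(ℝ, E) c).left_inv hz] at h
  exact (fderiv_transition_smul h Complex.I w).symm

theorem mdifferentiableAt_constField (c : M) (w : E) :
    MDifferentiableAt 𝓘(ℝ, E) 𝓘(ℝ, E).tangent
      (fun z ↦ (⟨z, constField c w z⟩ : TangentBundle 𝓘(ℝ, E) M)) c := by
  have h0 := mem_extChartAt_target (I := 𝓘(ℝ, E)) c
  have h1 := ((contMDiffOn_chart_symm_section c w).mdifferentiableOn (by simp)).mdifferentiableAt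
    ((isOpen_chart_target c).mem_nhds h0)
  have h2 := h1.comp c (mdifferentiableAt_extChartAt (mem_chart_source E c))
  refine h2.congr_of_eventuallyEq ?_
  filter_upwards [extChartAt_source_mem_nhds (I := 𝓘(ℝ, E)) c] with z hz
  have h3 : ∀ (p : M) (a : E), p = z → (⟨z, a⟩ : TangentBundle 𝓘(ℝ, E) M) = ⟨p, a⟩ := by
    rintro p a rfl; rfl
  rw [constField_eq hz, modelWithCornersSelf_coe, range_id, mfderivWithin_univ]
  exact h3 _ _ ((extChartAt 𝓘(ℝ, E) c).left_inv hz)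

/-- Constant coordinates kill the derivative term, so these fields detect the Christoffel symbols in
the condition that J is parallel. -/
theorem leviCivita_constField (c : M) (v w : E) :
    leviCivita (constField c w) c v = christoffel c (extChartAt 𝓘(ℝ, E) c c) v w := by
  have h0 := mem_extChartAt_target (I := 𝓘(ℝ, E)) c
  have hev : fieldInChart (constField c w) c =ᶠ[𝓝 (extChartAt 𝓘(ℝ, E) c c)] fun _ ↦ w := by
    filter_upwards [(isOpen_chart_target c).mem_nhds h0] with y hy
    exact fieldInChart_constField hy w
  change covDerivInChart (E := E) c (fieldInChart (constField c w) c) _ v = _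
  rw [covDerivInChart, hev.fderiv_eq, fieldInChart_constField h0]
  simp

theorem leviCivita_J_constField (c : M) (v w : E) :
    leviCivita (fun z ↦ J z (constField c w z)) c v =
      christoffel c (extChartAt 𝓘(ℝ, E) c c) v (Complex.I • w) := by
  rw [← leviCivita_constField]
  have h0 := mem_extChartAt_target (I := 𝓘(ℝ, E)) c
  have he : ∀ y ∈ (extChartAt 𝓘(ℝ, E) c).target, fieldInChart (fun z ↦ J z (constField c w z)) c y
      = fieldInChart (constField c (Complex.I • w)) c y := by
    intro y hy
    rw [fieldInChart, J_constField ((extChartAt 𝓘(ℝ, E) c).map_target hy)]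
    rfl
  have hev : fieldInChart (fun z ↦ J z (constField c w z)) c =ᶠ[𝓝 (extChartAt 𝓘(ℝ, E) c c)]
      fieldInChart (constField c (Complex.I • w)) c := by
    filter_upwards [(isOpen_chart_target c).mem_nhds h0] with y hy using he y hy
  change covDerivInChart (E := E) c (fieldInChart (fun z ↦ J z (constField c w z)) c) _ v =
    covDerivInChart (E := E) c (fieldInChart (constField c (Complex.I • w)) c) _ v
  rw [covDerivInChart, covDerivInChart, hev.fderiv_eq, he _ h0]

/-- The condition ∇J = 0 tested on fields with constant coordinates. Only the centre of the chart is
reached, because the covariant derivative at a point is computed in the chart centred there. -/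
theorem IsKahler.christoffel_smul_I_center (hK : IsKahler E M) (c : M) (v w : E) :
    christoffel c (extChartAt 𝓘(ℝ, E) c c) v (Complex.I • w) =
      Complex.I • christoffel c (extChartAt 𝓘(ℝ, E) c c) v w := by
  have h := hK.parallel_J (constField c w) c (mdifferentiableAt_constField c w) v
  rw [leviCivita_constField, leviCivita_J_constField] at h
  exact h

/-- On a Kähler manifold, the Christoffel symbols in holomorphic charts are complex linear. -/
theorem IsKahler.christoffel_smul_I (hK : IsKahler E M) {c : M} {y : E}
    (hy : y ∈ (extChartAt 𝓘(ℝ, E) c).target) (v w : E) :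
    christoffel c y v (Complex.I • w) = Complex.I • christoffel c y v w := by
  -- Pass to the chart centred at the point itself. The correction in the transformation law is the
  -- Hessian of a holomorphic map, which is complex linear as well.
  set p := (extChartAt 𝓘(ℝ, E) c).symm y with hp
  have hd : y ∈ transitionDomain E c p := mem_transitionDomain_symm hy
  refine fderiv_transition_injective hd ?_
  have hθ : transition c p y = extChartAt 𝓘(ℝ, E) p p := rfl
  rw [christoffel_transition hd, fderiv_transition_smul hd, fderiv_transition_smul hd,
    christoffel_transition hd, fderiv_fderiv_transition_smul hd, hθ,
    hK.christoffel_smul_I_center, smul_add]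

theorem IsKahler.christoffel_smul_I_left (hK : IsKahler E M) {c : M} {y : E}
    (hy : y ∈ (extChartAt 𝓘(ℝ, E) c).target) (v w : E) :
    christoffel c y (Complex.I • v) w = Complex.I • christoffel c y v w := by
  rw [christoffel_symm hy, hK.christoffel_smul_I hy, christoffel_symm hy]

/-- The holomorphic sectional curvature, read in a chart. -/
def holSecInChart (c : M) (y u : E) : ℝ :=
  -metricInChart c y (fderiv ℝ (christoffelL c) y u u u +
    Complex.I • fderiv ℝ (christoffelL c) y (Complex.I • u) u u) u

theorem hasFDerivAt_christoffelL {c : M} {y : E} (hy : y ∈ (extChartAt 𝓘(ℝ, E) c).target) :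
    HasFDerivAt (christoffelL c) (fderiv ℝ (christoffelL c) y) y :=
  (((contDiffOn_christoffelL c).differentiableOn (by simp)).differentiableAt
    ((isOpen_chart_target c).mem_nhds hy)).hasFDerivAt

theorem hasFDerivAt_christoffel {c : M} {y : E} (hy : y ∈ (extChartAt 𝓘(ℝ, E) c).target)
    (u v : E) : HasFDerivAt (fun z ↦ christoffel c z u v)
      (((fderiv ℝ (christoffelL c) y).flip u).flip v) y := by
  have h := ((hasFDerivAt_christoffelL hy).clm_apply (hasFDerivAt_const u y)).clm_apply
    (hasFDerivAt_const v y)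
  refine HasFDerivAt.congr_fderiv (f := fun z ↦ christoffel c z u v) h ?_
  ext w
  simp

theorem IsKahler.fderiv_christoffelL_smul_I (hK : IsKahler E M) {c : M} {y : E}
    (hy : y ∈ (extChartAt 𝓘(ℝ, E) c).target) (w u v : E) :
    fderiv ℝ (christoffelL c) y w u (Complex.I • v) =
      Complex.I • fderiv ℝ (christoffelL c) y w u v := by
  have h1 := hasFDerivAt_christoffel hy u (Complex.I • v)
  have h2 := (hasFDerivAt_christoffel hy u v).const_smul Complex.I
  have hev : (fun z ↦ christoffel c z u (Complex.I • v)) =ᶠ[𝓝 y]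
      fun z ↦ Complex.I • christoffel c z u v := by
    filter_upwards [(isOpen_chart_target c).mem_nhds hy] with z hz
    exact hK.christoffel_smul_I hz u v
  exact DFunLike.congr_fun (h1.unique (h2.congr_of_eventuallyEq hev)) w

theorem IsKahler.fderiv_christoffelL_smul_I_left (hK : IsKahler E M) {c : M} {y : E}
    (hy : y ∈ (extChartAt 𝓘(ℝ, E) c).target) (w u v : E) :
    fderiv ℝ (christoffelL c) y w (Complex.I • u) v =
      Complex.I • fderiv ℝ (christoffelL c) y w u v := by
  have h1 := hasFDerivAt_christoffel hy (Complex.I • u) v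
  have h2 := (hasFDerivAt_christoffel hy u v).const_smul Complex.I
  have hev : (fun z ↦ christoffel c z (Complex.I • u) v) =ᶠ[𝓝 y]
      fun z ↦ Complex.I • christoffel c z u v := by
    filter_upwards [(isOpen_chart_target c).mem_nhds hy] with z hz
    exact hK.christoffel_smul_I_left hz u v
  exact DFunLike.congr_fun (h1.unique (h2.congr_of_eventuallyEq hev)) w

theorem metricInChart_center (c : M) (u v : E) :
    metricInChart c (extChartAt 𝓘(ℝ, E) c c) u v = tangentInner c u v := by
  have h0 := mem_extChartAt_target (I := 𝓘(ℝ, E)) c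
  rw [metricInChart_eq_tangentInner h0, extChartAt_to_inv]
  have hev : transition c c =ᶠ[𝓝 (extChartAt 𝓘(ℝ, E) c c)] id := by
    filter_upwards [(isOpen_chart_target c).mem_nhds h0] with y hy
    exact (extChartAt 𝓘(ℝ, E) c).right_inv hy
  rw [hev.fderiv_eq]
  simp

/-- By complex bilinearity the two quadratic Christoffel terms of R(u, Iu)Iu cancel, and I can be
pulled out of the slots of the derivative terms, leaving the expression in `holSecInChart`. -/
theorem IsKahler.holSecInChart_center (hK : IsKahler E M) (c : M) (u : E) :
    holSecInChart c (extChartAt 𝓘(ℝ, E) c c) u = holSecCurvature (E := E) c u := by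
  have h0 := mem_extChartAt_target (I := 𝓘(ℝ, E)) c
  set y := extChartAt 𝓘(ℝ, E) c c
  have hR : curvatureInChart c y u (Complex.I • u) (Complex.I • u) =
      -(fderiv ℝ (christoffelL c) y u u u +
        Complex.I • fderiv ℝ (christoffelL c) y (Complex.I • u) u u) := by
    rw [curvatureInChart, (hasFDerivAt_christoffel h0 _ _).fderiv,
      (hasFDerivAt_christoffel h0 _ _).fderiv]
    simp only [ContinuousLinearMap.flip_apply]
    rw [hK.fderiv_christoffelL_smul_I_left h0, hK.fderiv_christoffelL_smul_I h0,
      hK.fderiv_christoffelL_smul_I h0, hK.christoffel_smul_I_left h0, hK.christoffel_smul_I h0,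
      hK.christoffel_smul_I_left h0, hK.christoffel_smul_I h0,
      smul_smul, Complex.I_mul_I]
    simp only [neg_smul, one_smul]
    abel
  rw [holSecInChart, ← neg_apply, ← map_neg, ← hR, metricInChart_center]
  rfl

theorem continuousOn_holSecInChart {X : Type*} [TopologicalSpace X] {s : Set X} {c : M}
    {z u : X → E} (hz : ContinuousOn z s) (hu : ContinuousOn u s)
    (h : MapsTo z s (extChartAt 𝓘(ℝ, E) c).target) :
    ContinuousOn (fun t ↦ holSecInChart c (z t) (u t)) s := by
  have hD : ContinuousOn (fun t ↦ fderiv ℝ (christoffelL c) (z t)) s :=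
    ((contDiffOn_christoffelL c).continuousOn_fderiv_of_isOpen (isOpen_chart_target c)
      (by simp)).comp hz h
  refine (continuousOn_metricInChart_apply hz (ContinuousOn.add ?_ ?_) hu h).neg
  · exact ((hD.clm_apply hu).clm_apply hu).clm_apply hu
  · exact (((hD.clm_apply (hu.const_smul Complex.I)).clm_apply hu).clm_apply hu).const_smul
      Complex.I

end Kahler

/-! ### Second variation of length in the direction J applied to the velocity -/

section SecondVariation

variable {E : Type*} [NormedAddCommGroup E] [NormedSpace ℂ E] [FiniteDimensional ℂ E]
  {M : Type*} [MetricSpace M] [ChartedSpace E M] [IsManifold 𝓘(ℂ, E) ω M]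
  [RiemannianBundle (fun x : M ↦ TangentSpace 𝓘(ℝ, E) x)]
  [IsContMDiffRiemannianBundle 𝓘(ℝ, E) ∞ E (fun x : M ↦ TangentSpace 𝓘(ℝ, E) x)]
  [IsRiemannianManifold 𝓘(ℝ, E) M]

/-- The variation of a geodesic in the direction of `f • J u`, where `u` is its velocity, to second
order. The arguments are the parameter `s` and the tuple `(x, u, f, f')`. -/
def varPoint (c : M) (p : ℝ × (E × E × ℝ × ℝ)) : E :=
  p.2.1 + (p.1 * p.2.2.2.1) • (Complex.I • p.2.2.1) +
    (p.1 ^ 2 / 2 * p.2.2.2.1 ^ 2) • christoffelL c p.2.1 p.2.2.1 p.2.2.1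

/-- The second order coefficient of `varVelocity`. -/
def varAcc (c : M) (q : E × E × ℝ × ℝ) : E :=
  (2 * q.2.2.1 * q.2.2.2) • christoffelL c q.1 q.2.1 q.2.1 +
    q.2.2.1 ^ 2 • (fderiv ℝ (christoffelL c) q.1 q.2.1 q.2.1 q.2.1 -
      (2 : ℝ) • christoffelL c q.1 q.2.1 (christoffelL c q.1 q.2.1 q.2.1))

/-- The time derivative of `varPoint` along a geodesic. -/
def varVelocity (c : M) (p : ℝ × (E × E × ℝ × ℝ)) : E :=
  p.2.2.1 + p.1 • (p.2.2.2.2 • (Complex.I • p.2.2.1) -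
    p.2.2.2.1 • (Complex.I • christoffelL c p.2.1 p.2.2.1 p.2.2.1)) +
    (p.1 ^ 2 / 2) • varAcc c p.2

/-- The energy density of the variation. -/
def varEnergy (c : M) (p : ℝ × (E × E × ℝ × ℝ)) : ℝ :=
  metricInChart c (varPoint c p) (varVelocity c p) (varVelocity c p)

theorem varPoint_zero (c : M) (q : E × E × ℝ × ℝ) : varPoint c (0, q) = q.1 := by
  simp [varPoint]

theorem varVelocity_zero (c : M) (q : E × E × ℝ × ℝ) : varVelocity c (0, q) = q.2.1 := by
  simp [varVelocity]

/-- Metric compatibility puts the product rule in covariant form, so that the second variation can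
be computed with covariant derivatives in s. -/
theorem hasDerivAt_metricInChart_cov {c : M} {X A B : ℝ → E} {X' A' B' : E} {s : ℝ}
    (hs : X s ∈ (extChartAt 𝓘(ℝ, E) c).target) (hX : HasDerivAt X X' s) (hA : HasDerivAt A A' s)
    (hB : HasDerivAt B B' s) :
    HasDerivAt (fun s ↦ metricInChart c (X s) (A s) (B s))
      (metricInChart c (X s) (A' + christoffelL c (X s) X' (A s)) (B s) +
        metricInChart c (X s) (A s) (B' + christoffelL c (X s) X' (B s))) s := by
  refine (hasDerivAt_metricInChart_apply hs hX hA hB).congr_deriv ?_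
  rw [fderiv_metricInChart_eq hs, christoffelL_apply, christoffelL_apply]
  simp only [map_add, add_apply]
  ring

theorem christoffelL_smul_I (hK : IsKahler E M) {c : M} {y : E}
    (hy : y ∈ (extChartAt 𝓘(ℝ, E) c).target) (v w : E) :
    christoffelL c y v (Complex.I • w) = Complex.I • christoffelL c y v w :=
  hK.christoffel_smul_I hy v w

theorem christoffelL_smul_I_left (hK : IsKahler E M) {c : M} {y : E}
    (hy : y ∈ (extChartAt 𝓘(ℝ, E) c).target) (v w : E) :
    christoffelL c y (Complex.I • v) w = Complex.I • christoffelL c y v w :=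
  hK.christoffel_smul_I_left hy v w

theorem I_smul_I_smul (v : E) : Complex.I • Complex.I • v = -v := by
  rw [smul_smul, Complex.I_mul_I, neg_one_smul]

/-- The first and second derivatives of the energy density of the variation. -/
theorem varEnergy_derivs (hK : IsKahler E M) {c : M} (q : E × E × ℝ × ℝ)
    (hq : q.1 ∈ (extChartAt 𝓘(ℝ, E) c).target) (hunit : metricInChart c q.1 q.2.1 q.2.1 = 1) :
    HasDerivAt (fun s ↦ varEnergy c (s, q)) 0 0 ∧
    HasDerivAt (deriv fun s ↦ varEnergy c (s, q))
      (2 * q.2.2.2 ^ 2 - 2 * q.2.2.1 ^ 2 * holSecInChart c q.1 q.2.1) 0 := by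
  obtain ⟨x, u, f, f'⟩ := q
  simp only at hq hunit ⊢
  set U := (extChartAt 𝓘(ℝ, E) c).target with hU
  set g := christoffelL c x u u with hg
  set b := varAcc c (x, u, f, f') with hb
  set a := f' • (Complex.I • u) - f • (Complex.I • g) with ha
  set X : ℝ → E := fun s ↦ varPoint c (s, (x, u, f, f')) with hX
  set Y : ℝ → E := fun s ↦ varVelocity c (s, (x, u, f, f')) with hY
  set X' : ℝ → E := fun s ↦ f • (Complex.I • u) + (s * f ^ 2) • g with hX'
  set Y' : ℝ → E := fun s ↦ a + s • b with hY'
  have hX0 : X 0 = x := varPoint_zero c _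
  have hY0 : Y 0 = u := varVelocity_zero c _
  have dsq : ∀ s : ℝ, HasDerivAt (fun s : ℝ ↦ s ^ 2 / 2) s s := fun s ↦ by
    simpa using ((hasDerivAt_id s).pow 2).div_const 2
  have dX : ∀ s, HasDerivAt X (X' s) s := by
    intro s
    have h1 : HasDerivAt (fun s : ℝ ↦ (s * f) • (Complex.I • u)) (f • (Complex.I • u)) s := by
      simpa using ((hasDerivAt_id s).mul_const f).smul_const (Complex.I • u)
    have h2 : HasDerivAt (fun s : ℝ ↦ (s ^ 2 / 2 * f ^ 2) • g) ((s * f ^ 2) • g) s :=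
      ((dsq s).mul_const (f ^ 2)).smul_const g
    exact (h1.const_add x).add h2
  -- Since Γ(Iu, Iu) = -Γ(u, u), this second derivative is the one of a geodesic with velocity f Iu:
  -- the quadratic term of `varPoint` makes the transverse curves have no covariant acceleration at
  -- s = 0.
  have dX' : HasDerivAt X' (f ^ 2 • g) 0 := by
    have h1 : HasDerivAt (fun s : ℝ ↦ (s * f ^ 2) • g) (f ^ 2 • g) 0 := by
      simpa using ((hasDerivAt_id (0 : ℝ)).mul_const (f ^ 2)).smul_const g
    exact h1.const_add _
  have dY : ∀ s, HasDerivAt Y (Y' s) s := by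
    intro s
    have h1 : HasDerivAt (fun s : ℝ ↦ s • a) a s := by
      simpa using (hasDerivAt_id s).smul_const a
    exact (h1.const_add u).add ((dsq s).smul_const b)
  have dY' : HasDerivAt Y' b 0 := by
    have h1 : HasDerivAt (fun s : ℝ ↦ s • b) b 0 := by
      simpa using (hasDerivAt_id (0 : ℝ)).smul_const b
    exact h1.const_add a
  -- Z is the covariant derivative of the velocity Y in the direction of the variation.
  set Z : ℝ → E := fun s ↦ Y' s + christoffelL c (X s) (X' s) (Y s) with hZ
  have hX'0 : X' 0 = f • (Complex.I • u) := by simp [hX']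
  have hY'0 : Y' 0 = a := by simp [hY']
  -- The Christoffel terms cancel because Iu is parallel along the geodesic. As Iu is orthogonal to
  -- u, the first variation vanishes pointwise.
  have hZ0 : Z 0 = f' • (Complex.I • u) := by
    simp only [hZ, hX0, hY0, hX'0, hY'0, ha]
    rw [map_smul, smul_apply, christoffelL_smul_I_left hK hq]
    abel
  have dE : ∀ s, X s ∈ U → HasDerivAt (fun s ↦ varEnergy c (s, (x, u, f, f')))
      (2 * metricInChart c (X s) (Z s) (Y s)) s := by
    intro s hs
    refine (hasDerivAt_metricInChart_cov hs (dX s) (dY s) (dY s)).congr_deriv ?_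
    rw [metricInChart_symm c (X s) (Y s)]
    simp only [hZ]
    ring
  have hIu : metricInChart c x (Complex.I • u) u = 0 := by
    have h1 := metricInChart_J hK.inner_J hq (Complex.I • u) u
    rw [I_smul_I_smul, map_neg, neg_apply, metricInChart_symm c x u] at h1
    linarith
  have dE0 : HasDerivAt (fun s ↦ varEnergy c (s, (x, u, f, f'))) 0 0 := by
    refine (dE 0 (by rw [hX0]; exact hq)).congr_deriv ?_
    rw [hX0, hY0, hZ0]
    simp [hIu]
  refine ⟨dE0, ?_⟩
  have hev : (deriv fun s ↦ varEnergy c (s, (x, u, f, f'))) =ᶠ[𝓝 0]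
      fun s ↦ 2 * metricInChart c (X s) (Z s) (Y s) := by
    have hnhds : ∀ᶠ s in 𝓝 (0 : ℝ), X s ∈ U := by
      refine (dX 0).continuousAt.eventually_mem ?_
      rw [hX0]
      exact (isOpen_chart_target c).mem_nhds hq
    filter_upwards [hnhds] with s hs using (dE s hs).deriv
  refine HasDerivAt.congr_of_eventuallyEq ?_ hev
  have dΓ : HasFDerivAt (christoffelL c) (fderiv ℝ (christoffelL c) x) (X 0) := by
    rw [hX0]; exact hasFDerivAt_christoffelL hq
  have dZ : HasDerivAt Z (b + (fderiv ℝ (christoffelL c) x (f • (Complex.I • u))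
      (f • (Complex.I • u)) u + christoffelL c x (f ^ 2 • g) u +
      christoffelL c x (f • (Complex.I • u)) a)) 0 := by
    refine (dY'.add (((dΓ.comp_hasDerivAt 0 (dX 0)).clm_apply dX').clm_apply (dY 0))).congr_deriv ?_
    simp only [Function.comp, hX0, hY0, hX'0, hY'0, add_apply]
  refine ((hasDerivAt_metricInChart_cov (by rw [hX0]; exact hq) (dX 0) dZ (dY 0)).const_mul
    2).congr_deriv ?_
  have hsym : christoffelL c x g u = christoffelL c x u g := christoffel_symm hq g u
  -- The second covariant derivative of Y at s = 0 is the pure curvature term; its product with u is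
  -- -f² times the holomorphic sectional curvature.
  have hcov : b + (fderiv ℝ (christoffelL c) x (f • (Complex.I • u)) (f • (Complex.I • u)) u +
      christoffelL c x (f ^ 2 • g) u + christoffelL c x (f • (Complex.I • u)) a) +
      christoffelL c x (f • (Complex.I • u)) (f' • (Complex.I • u)) =
      f ^ 2 • (fderiv ℝ (christoffelL c) x u u u +
        Complex.I • fderiv ℝ (christoffelL c) x (Complex.I • u) u u) := by
    simp only [ha, hb, varAcc, map_smul, smul_apply, map_sub, christoffelL_smul_I_left hK hq,
      christoffelL_smul_I hK hq, hK.fderiv_christoffelL_smul_I_left hq, I_smul_I_smul,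
      ← hg, hsym, smul_sub, smul_neg]
    module
  have hvel : a + christoffelL c x (f • (Complex.I • u)) u = f' • (Complex.I • u) := by
    rw [← hZ0]; simp only [hZ, hX0, hY0, hX'0, hY'0]
  rw [hX0, hY0, hZ0, hX'0, hY'0, hcov, hvel]
  simp only [map_smul, smul_apply, smul_eq_mul, metricInChart_J hK.inner_J hq, hunit,
    holSecInChart]
  ring

theorem contDiffOn_real_smul {F G : Type*} [NormedAddCommGroup F] [NormedSpace ℝ F]
    [NormedAddCommGroup G] [NormedSpace ℝ G] {f : F → ℝ} {g : F → G} {s : Set F}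
    (hf : ContDiffOn ℝ ∞ f s) (hg : ContDiffOn ℝ ∞ g s) :
    ContDiffOn ℝ ∞ (fun x ↦ f x • g x) s :=
  hf.smul hg

theorem contDiffOn_varPoint (c : M) :
    ContDiffOn ℝ ∞ (varPoint (E := E) c) {p | p.2.1 ∈ (extChartAt 𝓘(ℝ, E) c).target} := by
  unfold varPoint
  have h1 : ContDiffOn ℝ ∞ (fun p : ℝ × (E × E × ℝ × ℝ) ↦ christoffelL c p.2.1)
      {p | p.2.1 ∈ (extChartAt 𝓘(ℝ, E) c).target} :=
    (contDiffOn_christoffelL c).comp (t := (extChartAt 𝓘(ℝ, E) c).target)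
      (f := fun p : ℝ × (E × E × ℝ × ℝ) ↦ p.2.1) (by fun_prop) fun p hp ↦ hp
  have h2 : ContDiffOn ℝ ∞ (fun p : ℝ × (E × E × ℝ × ℝ) ↦ p.2.2.1)
      {p | p.2.1 ∈ (extChartAt 𝓘(ℝ, E) c).target} := by fun_prop
  refine ContDiffOn.add (by fun_prop) (contDiffOn_real_smul (by fun_prop) ?_)
  exact (h1.clm_apply h2).clm_apply h2

theorem contDiffOn_varVelocity (c : M) :
    ContDiffOn ℝ ∞ (varVelocity (E := E) c) {p | p.2.1 ∈ (extChartAt 𝓘(ℝ, E) c).target} := by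
  unfold varVelocity varAcc
  have h1 : ContDiffOn ℝ ∞ (fun p : ℝ × (E × E × ℝ × ℝ) ↦ christoffelL c p.2.1)
      {p | p.2.1 ∈ (extChartAt 𝓘(ℝ, E) c).target} :=
    (contDiffOn_christoffelL c).comp (t := (extChartAt 𝓘(ℝ, E) c).target)
      (f := fun p : ℝ × (E × E × ℝ × ℝ) ↦ p.2.1) (by fun_prop) fun p hp ↦ hp
  have h2 : ContDiffOn ℝ ∞ (fun p : ℝ × (E × E × ℝ × ℝ) ↦ p.2.2.1)
      {p | p.2.1 ∈ (extChartAt 𝓘(ℝ, E) c).target} := by fun_prop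
  have h3 : ContDiffOn ℝ ∞ (fun p : ℝ × (E × E × ℝ × ℝ) ↦ fderiv ℝ (christoffelL c) p.2.1)
      {p | p.2.1 ∈ (extChartAt 𝓘(ℝ, E) c).target} :=
    ((contDiffOn_christoffelL c).fderiv_of_isOpen (isOpen_chart_target c) (by simp)).comp
      (t := (extChartAt 𝓘(ℝ, E) c).target)
      (f := fun p : ℝ × (E × E × ℝ × ℝ) ↦ p.2.1) (by fun_prop) fun p hp ↦ hp
  have hg := (h1.clm_apply h2).clm_apply h2
  refine ContDiffOn.add (ContDiffOn.add h2 (contDiffOn_real_smul (by fun_prop) (ContDiffOn.sub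
    (by fun_prop) (contDiffOn_real_smul (by fun_prop) (hg.const_smul Complex.I)))))
    (contDiffOn_real_smul (by fun_prop) (ContDiffOn.add (contDiffOn_real_smul (by fun_prop) hg)
      (contDiffOn_real_smul (by fun_prop) (ContDiffOn.sub ?_ ?_))))
  · exact ((h3.clm_apply h2).clm_apply h2).clm_apply h2
  · exact ((h1.clm_apply h2).clm_apply hg).const_smul (2 : ℝ)

/-- The geodesic equation eliminates the second derivative of x, so that the velocity depends only
on (x, x', φ, φ') and the estimate is again uniform over a compact set of tuples. -/
theorem hasDerivAt_varPoint {c : M} {x x' : ℝ → E} {φ φ' : ℝ → ℝ} {t : ℝ}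
    (hU : x t ∈ (extChartAt 𝓘(ℝ, E) c).target) (hx : HasDerivAt x (x' t) t)
    (hx' : HasDerivAt x' (-christoffel c (x t) (x' t) (x' t)) t)
    (hφ : HasDerivAt φ (φ' t) t) (s : ℝ) :
    HasDerivAt (fun t ↦ varPoint c (s, (x t, x' t, φ t, φ' t)))
      (varVelocity c (s, (x t, x' t, φ t, φ' t))) t := by
  set g := christoffelL c (x t) (x' t) (x' t) with hg
  have hx'' : HasDerivAt x' (-g) t := hx'
  have h1 := ((hasFDerivAt_christoffelL hU).comp_hasDerivAt t hx).clm_apply hx'' |>.clm_apply hx''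
  have h2 := (((hφ.const_mul s).smul (hx''.const_smul Complex.I)))
  have h3 := ((hφ.pow 2).const_mul (s ^ 2 / 2)).smul h1
  refine ((hx.add h2).add h3).congr_deriv ?_
  have hsym : christoffelL c (x t) g (x' t) = christoffelL c (x t) (x' t) g :=
    christoffel_symm hU g (x' t)
  simp only [varVelocity, varAcc, Function.comp, map_neg, neg_apply, add_apply, ← hg, hsym,
    smul_neg, Nat.cast_ofNat, Pi.smul_apply, Pi.pow_apply]
  module

/-- The second variation of length along a piece of geodesic contained in a chart where the
holomorphic sectional curvature is bounded below. -/
theorem eventually_dist_varPoint_le (hK : IsKahler E M) {c : M} {a b : ℝ} (hab : a ≤ b)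
    {x x' : ℝ → E} {φ φ' : ℝ → ℝ} (hU : MapsTo x (Icc a b) (extChartAt 𝓘(ℝ, E) c).target)
    (hx : ∀ t ∈ Icc a b, HasDerivAt x (x' t) t)
    (hx' : ∀ t ∈ Icc a b, HasDerivAt x' (-christoffel c (x t) (x' t) (x' t)) t)
    (hunit : ∀ t ∈ Icc a b, metricInChart c (x t) (x' t) (x' t) = 1)
    (hφ : ∀ t, HasDerivAt φ (φ' t) t) (hφ' : Continuous φ') {κ : ℝ}
    (hκ : ∀ t ∈ Icc a b, κ ≤ holSecInChart c (x t) (x' t)) {ε : ℝ} (hε : 0 < ε) :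
    ∀ᶠ s in 𝓝[>] (0 : ℝ),
      dist ((extChartAt 𝓘(ℝ, E) c).symm (varPoint c (s, (x a, x' a, φ a, φ' a))))
        ((extChartAt 𝓘(ℝ, E) c).symm (varPoint c (s, (x b, x' b, φ b, φ' b)))) ≤
      (b - a) + s ^ 2 * ((∫ t in a..b, (φ' t ^ 2 - κ * φ t ^ 2) / 2) + ε) := by
  set U := (extChartAt 𝓘(ℝ, E) c).target with hUdef
  have hUo : IsOpen U := isOpen_chart_target c
  have hxc : ContinuousOn x (Icc a b) := fun t ht ↦ (hx t ht).continuousAt.continuousWithinAt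
  have hx'c : ContinuousOn x' (Icc a b) := fun t ht ↦ (hx' t ht).continuousAt.continuousWithinAt
  have hφc : Continuous φ := continuous_iff_continuousAt.2 fun t ↦ (hφ t).continuousAt
  set α : ℝ → E × E × ℝ × ℝ := fun t ↦ (x t, x' t, φ t, φ' t) with hα
  have hαc : ContinuousOn α (Icc a b) :=
    hxc.prodMk (hx'c.prodMk (hφc.continuousOn.prodMk hφ'.continuousOn))
  have hcomp : IsCompact (α '' Icc a b) := isCompact_Icc.image_of_continuousOn hαc
  set W₀ : Set (ℝ × (E × E × ℝ × ℝ)) := {p | p.2.1 ∈ U} with hW₀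
  have hW₀o : IsOpen W₀ := hUo.preimage (by fun_prop : Continuous
    fun p : ℝ × (E × E × ℝ × ℝ) ↦ p.2.1)
  set W := W₀ ∩ varPoint c ⁻¹' U with hWdef
  have hW : IsOpen W := (contDiffOn_varPoint c).continuousOn.isOpen_inter_preimage hW₀o hUo
  have hvel := (contDiffOn_varVelocity (E := E) c).mono (inter_subset_left : W ⊆ W₀)
  have hF : ContDiffOn ℝ 2 (varEnergy (E := E) c) W := by
    have h1 : ContDiffOn ℝ ∞ (varEnergy (E := E) c) W :=
      (((contDiffOn_metricInChart c).comp ((contDiffOn_varPoint c).mono inter_subset_left)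
        fun p hp ↦ hp.2).clm_apply hvel).clm_apply hvel
    exact h1.of_le ENat.LEInfty.out
  have hKW : ∀ q ∈ α '' Icc a b, ((0 : ℝ), q) ∈ W := by
    rintro _ ⟨t, ht, rfl⟩
    exact ⟨hU ht, by rw [mem_preimage, varPoint_zero]; exact hU ht⟩
  have hd : ∀ q ∈ α '' Icc a b, HasDerivAt (fun s ↦ varEnergy c (s, q)) 0 0 ∧
      HasDerivAt (deriv fun s ↦ varEnergy c (s, q))
        (2 * q.2.2.2 ^ 2 - 2 * q.2.2.1 ^ 2 * holSecInChart c q.1 q.2.1) 0 := by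
    rintro _ ⟨t, ht, rfl⟩
    exact varEnergy_derivs hK (α t) (hU ht) (hunit t ht)
  obtain ⟨F₂, -, hF₂, hT⟩ := exists_uniform_taylor hW hF hcomp hKW (F₁ := fun _ ↦ 0)
    fun q hq ↦ (hd q hq).1
  -- The + 1 covers the case a = b.
  set η : ℝ := ε / (b - a + 1) with hη
  have hba : 0 < b - a + 1 := by linarith
  have hη0 : 0 < η := by positivity
  obtain ⟨δ, hδ, hTδ⟩ := hT η hη0
  filter_upwards [Ioc_mem_nhdsGT hδ] with s hs
  have hs' : s ∈ Icc 0 δ := ⟨hs.1.le, hs.2⟩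
  have hmem : ∀ t ∈ Icc a b, (s, α t) ∈ W := fun t ht ↦ (hTδ _ (mem_image_of_mem α ht) s hs').1
  have hz : ∀ t ∈ Icc a b,
      HasDerivWithinAt (fun t ↦ varPoint c (s, α t)) (varVelocity c (s, α t)) (Icc a b) t :=
    fun t ht ↦ (hasDerivAt_varPoint (hU ht) (hx t ht) (hx' t ht) (hφ t) s).hasDerivWithinAt
  have hzc : ContinuousOn (fun t ↦ varVelocity c (s, α t)) (Icc a b) :=
    (hvel.continuousOn).comp (continuousOn_const.prodMk hαc) hmem
  have hzU : MapsTo (fun t ↦ varPoint c (s, α t)) (Icc a b) U := fun t ht ↦ (hmem t ht).2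
  have h1 := dist_le_integral_chart (c := c) hab hz hzc hzU
  refine h1.trans ?_
  have hqc : Continuous fun t ↦ (φ' t ^ 2 - κ * φ t ^ 2) / 2 := by fun_prop
  -- The energy density is 1 at s = 0 and has no linear term in s, so bounding the square root by (1
  -- + E)/2 leaves half of its second order term.
  have h3 : ∫ t in a..b,
      √(metricInChart c (varPoint c (s, α t)) (varVelocity c (s, α t)) (varVelocity c (s, α t))) ≤
      ∫ t in a..b, (1 + s ^ 2 * ((φ' t ^ 2 - κ * φ t ^ 2) / 2 + η)) := by
    refine intervalIntegral.integral_mono_on hab ?_ ?_ fun t ht ↦ ?_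
    · refine ContinuousOn.intervalIntegrable_of_Icc hab (ContinuousOn.sqrt ?_)
      exact continuousOn_metricInChart_apply
        (fun t ht ↦ (hz t ht).continuousWithinAt) hzc hzc hzU
    · exact Continuous.intervalIntegrable (by fun_prop) _ _
    · refine (sqrt_le_half_one_add (metricInChart_self_nonneg _ _ _)).trans ?_
      have hq := mem_image_of_mem α ht
      have h4 := (hTδ _ hq s hs').2
      have h5 : varEnergy c (0, α t) = 1 := by
        rw [varEnergy, varPoint_zero, varVelocity_zero]; exact hunit t ht
      rw [h5, (hF₂ _ hq).unique (hd _ hq).2] at h4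
      change (1 + varEnergy c (s, α t)) / 2 ≤ _
      have h6 := mul_le_mul_of_nonneg_left (hκ t ht) (sq_nonneg (φ t))
      have h7 := mul_le_mul_of_nonneg_left h6 (sq_nonneg s)
      simp only [hα] at h4 ⊢
      nlinarith [mul_nonneg (sq_nonneg s) hη0.le]
  refine h3.trans ?_
  rw [intervalIntegral.integral_add (by simp) (Continuous.intervalIntegrable (by fun_prop) _ _),
    intervalIntegral.integral_const_mul, intervalIntegral.integral_add
      (hqc.intervalIntegrable _ _) (by simp)]
  simp only [intervalIntegral.integral_const, smul_eq_mul, mul_one]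
  gcongr
  rw [hη, mul_div_assoc', div_le_iff₀ hba]
  nlinarith

end SecondVariation

/-! ### Complexified second order Taylor polynomials and holomorphic maps -/

section Jet

/-- Second order Taylor expansion of a function with a second derivative at a point. -/
theorem eventually_norm_taylor_le {F : Type*} [NormedAddCommGroup F] [NormedSpace ℝ F]
    {x x' : ℝ → F} {t : ℝ} {w : F} (hx : ∀ᶠ τ in 𝓝 t, HasDerivAt x (x' τ) τ)
    (hx' : HasDerivAt x' w t) {ε : ℝ} (hε : 0 < ε) :
    ∀ᶠ τ in 𝓝 (0 : ℝ), ‖x (t + τ) - (x t + τ • x' t + (τ ^ 2 / 2) • w)‖ ≤ ε * τ ^ 2 := by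
  have h1 : ∀ᶠ τ in 𝓝 t, ‖x' τ - x' t - (τ - t) • w‖ ≤ ε * ‖τ - t‖ :=
    (hasDerivAt_iff_isLittleO.1 hx').def hε
  obtain ⟨r, hr, hball⟩ := Metric.eventually_nhds_iff_ball.1 (hx.and h1)
  filter_upwards [Metric.ball_mem_nhds (0 : ℝ) hr] with τ hτ
  rw [mem_ball_zero_iff, Real.norm_eq_abs] at hτ
  have hd : ∀ σ ∈ Metric.closedBall (0 : ℝ) |τ|, HasDerivWithinAt
      (fun σ ↦ x (t + σ) - (x t + σ • x' t + (σ ^ 2 / 2) • w))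
      (x' (t + σ) - (x' t + σ • w)) (Metric.closedBall (0 : ℝ) |τ|) σ := by
    intro σ hσ
    rw [mem_closedBall_zero_iff, Real.norm_eq_abs] at hσ
    have hb : t + σ ∈ Metric.ball t r := by
      rw [Metric.mem_ball, Real.dist_eq]; simpa using hσ.trans_lt hτ
    have h2 : HasDerivAt (fun σ ↦ x (t + σ)) (x' (t + σ)) σ :=
      HasDerivAt.comp_const_add t σ (hball _ hb).1
    have h3 : HasDerivAt (fun σ : ℝ ↦ σ • x' t) (x' t) σ := by
      simpa using (hasDerivAt_id σ).smul_const (x' t)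
    have h4 : HasDerivAt (fun σ : ℝ ↦ (σ ^ 2 / 2) • w) (σ • w) σ := by
      have : HasDerivAt (fun s : ℝ ↦ s ^ 2 / 2) σ σ := by
        simpa using ((hasDerivAt_id σ).pow 2).div_const 2
      exact this.smul_const w
    exact (h2.sub ((h3.const_add (x t)).add h4)).hasDerivWithinAt
  have hbd : ∀ σ ∈ Metric.closedBall (0 : ℝ) |τ|, ‖x' (t + σ) - (x' t + σ • w)‖ ≤ ε * |τ| := by
    intro σ hσ
    rw [mem_closedBall_zero_iff, Real.norm_eq_abs] at hσ
    have hb : t + σ ∈ Metric.ball t r := by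
      rw [Metric.mem_ball, Real.dist_eq]; simpa using hσ.trans_lt hτ
    have h2 := (hball _ hb).2
    rw [add_sub_cancel_left, Real.norm_eq_abs] at h2
    rw [← sub_sub]
    exact h2.trans (by gcongr)
  have := (convex_closedBall (0 : ℝ) |τ|).norm_image_sub_le_of_norm_hasDerivWithin_le hd hbd
    (x := 0) (y := τ) (by simp) (by simp)
  simp only [add_zero, zero_smul, ne_eq, OfNat.ofNat_ne_zero, not_false_eq_true, zero_pow,
    zero_div, sub_self, sub_zero, Real.norm_eq_abs] at this
  calc _ ≤ _ := this
    _ = ε * τ ^ 2 := by rw [mul_assoc, ← sq, sq_abs]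

/-- A holomorphic function of one variable that is `o(τ ^ 2)` for real `τ` is `o(z ^ 2)`. -/
theorem eventually_norm_le_of_real {F : Type*} [NormedAddCommGroup F] [NormedSpace ℂ F]
    {h : ℂ → F} (hh : AnalyticAt ℂ h 0)
    (hr : ∀ ε : ℝ, 0 < ε → ∀ᶠ τ : ℝ in 𝓝 0, ‖h τ‖ ≤ ε * τ ^ 2) {ε : ℝ} (hε : 0 < ε) :
    ∀ᶠ z in 𝓝 (0 : ℂ), ‖h z‖ ≤ ε * ‖z‖ ^ 2 := by
  by_cases h0 : ∀ᶠ z in 𝓝 (0 : ℂ), h z = 0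
  · filter_upwards [h0] with z hz
    rw [hz, norm_zero]; positivity
  obtain ⟨n, g, hg, hg0, hev⟩ := hh.exists_eventuallyEq_pow_smul_nonzero_iff.2 h0
  simp only [sub_zero] at hev
  have hgc : Tendsto (fun z ↦ ‖g z‖) (𝓝 0) (𝓝 ‖g 0‖) := hg.continuousAt.norm
  have hgpos : 0 < ‖g 0‖ := norm_pos_iff.2 hg0
  have hcast : Tendsto (fun τ : ℝ ↦ (τ : ℂ)) (𝓝 0) (𝓝 0) := by
    simpa using Complex.continuous_ofReal.tendsto 0
  -- Here n is the order of vanishing at 0. An order at most 2 would already be visible on the real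
  -- axis, contradicting the o(τ²) bound there.
  have hn : 3 ≤ n := by
    by_contra hn
    have hn2 : n ≤ 2 := by omega
    have h1 := hr (‖g 0‖ / 2 / 2) (by positivity)
    have h2 : ∀ᶠ τ : ℝ in 𝓝 0, ‖g 0‖ / 2 < ‖g τ‖ :=
      hcast.eventually (hgc.eventually_const_lt (by linarith))
    have h3 : ∀ᶠ τ : ℝ in 𝓝 0, |τ| ≤ 1 := by
      filter_upwards [Metric.closedBall_mem_nhds (0 : ℝ) one_pos] with τ hτ
      simpa using hτ
    have h4 := (h1.and (h2.and (h3.and (hcast.eventually hev)))).filter_mono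
      (nhdsWithin_le_nhds (s := Ioi (0 : ℝ)))
    obtain ⟨τ, ⟨k1, k2, k3, k4⟩, k5⟩ := (h4.and self_mem_nhdsWithin).exists
    have k5' : 0 < τ := k5
    rw [k4, norm_smul, norm_pow, Complex.norm_real, Real.norm_eq_abs, abs_of_pos k5'] at k1
    rw [abs_of_pos k5'] at k3
    have k6 : τ ^ 2 ≤ τ ^ n := pow_le_pow_of_le_one k5'.le k3 hn2
    have k7 : τ ^ 2 * (‖g 0‖ / 2) ≤ τ ^ n * ‖g τ‖ := by gcongr
    nlinarith [mul_pos (pow_pos k5' 2) hgpos]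
  have h2 : ∀ᶠ z in 𝓝 (0 : ℂ), ‖g z‖ < ‖g 0‖ + 1 := hgc.eventually_lt_const (by linarith)
  have h3 : ∀ᶠ z in 𝓝 (0 : ℂ), ‖z‖ ≤ min 1 (ε / (‖g 0‖ + 1)) := by
    filter_upwards [Metric.closedBall_mem_nhds (0 : ℂ)
      (lt_min one_pos (by positivity : 0 < ε / (‖g 0‖ + 1)))] with τ hτ
    simpa using hτ
  filter_upwards [hev, h2, h3] with z k1 k2 k3
  rw [k1, norm_smul, norm_pow]
  have k4 : ‖z‖ ^ n ≤ ‖z‖ ^ 3 :=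
    pow_le_pow_of_le_one (norm_nonneg _) (k3.trans (min_le_left _ _)) hn
  have k5 : ‖z‖ * (‖g 0‖ + 1) ≤ ε := by
    rw [← le_div_iff₀ (by positivity)]; exact k3.trans (min_le_right _ _)
  calc ‖z‖ ^ n * ‖g z‖ ≤ ‖z‖ ^ 3 * (‖g 0‖ + 1) := by gcongr
    _ = (‖z‖ * (‖g 0‖ + 1)) * ‖z‖ ^ 2 := by ring
    _ ≤ ε * ‖z‖ ^ 2 := by gcongr

variable {E : Type*} [NormedAddCommGroup E] [NormedSpace ℂ E]

/-- The complexified second order Taylor polynomial of a curve. -/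
def quad (x v w : E) (z : ℂ) : E := x + z • v + (z ^ 2 / 2) • w

theorem quad_ofReal (x v w : E) (τ : ℝ) :
    quad x v w τ = x + τ • v + (τ ^ 2 / 2) • w := by
  simp only [quad, ← Complex.coe_smul]
  push_cast
  rfl

theorem quad_zero (x v w : E) : quad x v w 0 = x := by simp [quad]

theorem analyticAt_quad (x v w : E) : AnalyticAt ℂ (quad x v w) 0 := by
  unfold quad
  fun_prop

/-- The complexified Taylor polynomials of a curve and of its image under a holomorphic map agree
to second order. -/
theorem eventually_norm_comp_quad_sub_le [CompleteSpace E] {θ : E → E}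
    {x x' y y' : ℝ → E} {t : ℝ} {w w' : E}
    (hθ : AnalyticAt ℂ θ (x t)) (hx : ∀ᶠ τ in 𝓝 t, HasDerivAt x (x' τ) τ)
    (hx' : HasDerivAt x' w t) (hy : ∀ᶠ τ in 𝓝 t, HasDerivAt y (y' τ) τ)
    (hy' : HasDerivAt y' w' t) (hxy : ∀ᶠ τ in 𝓝 t, y τ = θ (x τ)) {ε : ℝ} (hε : 0 < ε) :
    ∀ᶠ z in 𝓝 (0 : ℂ), ‖θ (quad (x t) (x' t) w z) - quad (y t) (y' t) w' z‖ ≤ ε * ‖z‖ ^ 2 := by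
  -- The difference is holomorphic in z, so real z suffice; there both terms approximate y (t + τ)
  -- to second order.
  refine eventually_norm_le_of_real
    (h := fun z ↦ θ (quad (x t) (x' t) w z) - quad (y t) (y' t) w' z) ?_ ?_ hε
  · refine AnalyticAt.sub ?_ (analyticAt_quad _ _ _)
    refine AnalyticAt.fun_comp (g := θ) ?_ (analyticAt_quad _ _ _)
    rwa [quad_zero]
  intro ε hε
  obtain ⟨L, s, hs, hL⟩ := (hθ.contDiffAt (n := 1)).exists_lipschitzOnWith
  have hshift : Tendsto (fun τ ↦ t + τ) (𝓝 0) (𝓝 t) := by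
    simpa using (continuous_const_add t).tendsto 0
  have hxt : Tendsto (fun τ ↦ x (t + τ)) (𝓝 0) (𝓝 (x t)) :=
    (hx.self_of_nhds.continuousAt.tendsto).comp hshift
  have hcast : Tendsto (fun τ : ℝ ↦ (τ : ℂ)) (𝓝 0) (𝓝 0) := by
    simpa using Complex.continuous_ofReal.tendsto 0
  have hq : Tendsto (fun τ : ℝ ↦ quad (x t) (x' t) w τ) (𝓝 0) (𝓝 (x t)) := by
    have := (analyticAt_quad (x t) (x' t) w).continuousAt.tendsto.comp hcast
    rwa [quad_zero] at this
  have hε' : 0 < ε / (2 * (L + 1)) := by positivity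
  filter_upwards [eventually_norm_taylor_le hx hx' hε',
    eventually_norm_taylor_le hy hy' (half_pos hε), hxt.eventually_mem hs, hq.eventually_mem hs,
    hshift.eventually hxy] with τ h1 h2 h3 h4 h5
  rw [← quad_ofReal] at h1 h2
  have h6 : ‖θ (quad (x t) (x' t) w τ) - θ (x (t + τ))‖ ≤ ε / 2 * τ ^ 2 := by
    have h7 := hL.dist_le_mul _ h4 _ h3
    rw [dist_eq_norm, dist_eq_norm, norm_sub_rev (quad _ _ _ _)] at h7
    calc _ ≤ _ := h7
      _ ≤ (L + 1) * (ε / (2 * (L + 1)) * τ ^ 2) := by gcongr; linarith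
      _ = ε / 2 * τ ^ 2 := by field_simp
  calc _ = ‖(θ (quad (x t) (x' t) w τ) - θ (x (t + τ))) +
        (y (t + τ) - quad (y t) (y' t) w' τ)‖ := by rw [h5]; congr 1; abel
    _ ≤ ε / 2 * τ ^ 2 + ε / 2 * τ ^ 2 := (norm_add_le _ _).trans (add_le_add h6 h2)
    _ = ε * τ ^ 2 := by ring

end Jet

/-! ### Variation of a line across charts, and nonexistence of lines -/

section Line

variable {E : Type*} [NormedAddCommGroup E] [NormedSpace ℂ E] [FiniteDimensional ℂ E]
  {M : Type*} [MetricSpace M] [ChartedSpace E M] [IsManifold 𝓘(ℂ, E) ω M]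
  [RiemannianBundle (fun x : M ↦ TangentSpace 𝓘(ℝ, E) x)]
  [IsContMDiffRiemannianBundle 𝓘(ℝ, E) ∞ E (fun x : M ↦ TangentSpace 𝓘(ℝ, E) x)]
  [IsRiemannianManifold 𝓘(ℝ, E) M]

/-- The point with parameter `z` on the complexified second order Taylor polynomial at `t` of the
curve `γ`, computed in the chart centred at `c`. -/
def jetPoint (E : Type*) [NormedAddCommGroup E] [NormedSpace ℂ E] {M : Type*} [TopologicalSpace M]
    [ChartedSpace E M] (c : M) (γ : ℝ → M) (t : ℝ) (z : ℂ) : M :=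
  (extChartAt 𝓘(ℝ, E) c).symm (quad (extChartAt 𝓘(ℝ, E) c (γ t))
    (deriv (fun τ ↦ extChartAt 𝓘(ℝ, E) c (γ τ)) t)
    (deriv (deriv fun τ ↦ extChartAt 𝓘(ℝ, E) c (γ τ)) t) z)

theorem jetPoint_zero {c : M} {γ : ℝ → M} {t : ℝ} (h : γ t ∈ (extChartAt 𝓘(ℝ, E) c).source) :
    jetPoint E c γ t 0 = γ t := by
  rw [jetPoint, quad_zero, (extChartAt 𝓘(ℝ, E) c).left_inv h]

/-- An isometric curve is twice differentiable in charts. -/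
theorem hasDerivAt_deriv_of_isometry {γ : ℝ → M} (hγ : Isometry γ) {c : M} {t : ℝ}
    (hc : γ t ∈ (extChartAt 𝓘(ℝ, E) c).source) :
    (∀ᶠ τ in 𝓝 t, HasDerivAt (fun τ ↦ extChartAt 𝓘(ℝ, E) c (γ τ))
      (deriv (fun τ ↦ extChartAt 𝓘(ℝ, E) c (γ τ)) τ) τ) ∧
    HasDerivAt (deriv fun τ ↦ extChartAt 𝓘(ℝ, E) c (γ τ))
      (-christoffel c (extChartAt 𝓘(ℝ, E) c (γ t)) (deriv (fun τ ↦ extChartAt 𝓘(ℝ, E) c (γ τ)) t)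
        (deriv (fun τ ↦ extChartAt 𝓘(ℝ, E) c (γ τ)) t)) t ∧
    metricInChart c (extChartAt 𝓘(ℝ, E) c (γ t)) (deriv (fun τ ↦ extChartAt 𝓘(ℝ, E) c (γ τ)) t)
        (deriv (fun τ ↦ extChartAt 𝓘(ℝ, E) c (γ τ)) t) = 1 := by
  obtain ⟨δ, hδ, x', h⟩ := exists_geodesic_of_isometry hγ hc
  have hnhds : Ioo (t - δ) (t + δ) ∈ 𝓝 t := Ioo_mem_nhds (by linarith) (by linarith)
  have hev : (deriv fun τ ↦ extChartAt 𝓘(ℝ, E) c (γ τ)) =ᶠ[𝓝 t] x' := by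
    filter_upwards [hnhds] with τ hτ using (h τ hτ).2.1.deriv
  obtain ⟨-, -, h2, h3⟩ := h t (mem_of_mem_nhds hnhds)
  refine ⟨?_, ?_, ?_⟩
  · filter_upwards [hnhds] with τ hτ using (h τ hτ).2.1.differentiableAt.hasDerivAt
  · rw [hev.eq_of_nhds]
    exact h2.congr_of_eventuallyEq hev
  · rw [hev.eq_of_nhds]
    exact h3

/-- The complexified Taylor polynomials in two charts agree to second order. -/
theorem eventually_dist_jetPoint_le {γ : ℝ → M} (hγ : Isometry γ) {c c' : M} {t : ℝ}
    (hc : γ t ∈ (extChartAt 𝓘(ℝ, E) c).source) (hc' : γ t ∈ (extChartAt 𝓘(ℝ, E) c').source)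
    {ε : ℝ} (hε : 0 < ε) :
    ∀ᶠ z in 𝓝 (0 : ℂ), dist (jetPoint E c γ t z) (jetPoint E c' γ t z) ≤ ε * ‖z‖ ^ 2 := by
  obtain ⟨hx, hx', -⟩ := hasDerivAt_deriv_of_isometry (E := E) hγ hc
  obtain ⟨hy, hy', -⟩ := hasDerivAt_deriv_of_isometry (E := E) hγ hc'
  have hD : extChartAt 𝓘(ℝ, E) c (γ t) ∈ transitionDomain E c c' := by
    refine ⟨(extChartAt 𝓘(ℝ, E) c).map_source hc, ?_⟩
    rw [mem_preimage, (extChartAt 𝓘(ℝ, E) c).left_inv hc]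
    exact hc'
  have hθt : transition c c' (extChartAt 𝓘(ℝ, E) c (γ t)) = extChartAt 𝓘(ℝ, E) c' (γ t) := by
    rw [transition, (extChartAt 𝓘(ℝ, E) c).left_inv hc]
  have hcE : CompleteSpace E := FiniteDimensional.complete ℂ E
  have hθ : AnalyticAt ℂ (transition (E := E) c c') (extChartAt 𝓘(ℝ, E) c (γ t)) :=
    (contDiffAt_transition hD).analyticAt
  have hxy : ∀ᶠ τ in 𝓝 t, extChartAt 𝓘(ℝ, E) c' (γ τ) =
      transition c c' (extChartAt 𝓘(ℝ, E) c (γ τ)) := by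
    filter_upwards [hγ.continuous.continuousAt.eventually_mem
      ((isOpen_extChartAt_source (I := 𝓘(ℝ, E)) c).mem_nhds hc)] with τ hτ
    rw [transition, (extChartAt 𝓘(ℝ, E) c).left_inv hτ]
  obtain ⟨r, hr, κ, hκ, _, _, _, _, hcomp⟩ :=
    exists_chart_comparison ((extChartAt 𝓘(ℝ, E) c').map_source hc')
  have h1 := eventually_norm_comp_quad_sub_le hθ hx hx' hy hy' hxy (div_pos hε hκ)
  set p := quad (extChartAt 𝓘(ℝ, E) c (γ t)) (deriv (fun τ ↦ extChartAt 𝓘(ℝ, E) c (γ τ)) t)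
    (deriv (deriv fun τ ↦ extChartAt 𝓘(ℝ, E) c (γ τ)) t) with hp
  set q := quad (extChartAt 𝓘(ℝ, E) c' (γ t)) (deriv (fun τ ↦ extChartAt 𝓘(ℝ, E) c' (γ τ)) t)
    (deriv (deriv fun τ ↦ extChartAt 𝓘(ℝ, E) c' (γ τ)) t) with hq
  rw [← hx'.deriv, ← hy'.deriv, ← hp, ← hq] at h1
  have hpc : Tendsto p (𝓝 0) (𝓝 (extChartAt 𝓘(ℝ, E) c (γ t))) := by
    have := (analyticAt_quad (extChartAt 𝓘(ℝ, E) c (γ t))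
      (deriv (fun τ ↦ extChartAt 𝓘(ℝ, E) c (γ τ)) t)
      (deriv (deriv fun τ ↦ extChartAt 𝓘(ℝ, E) c (γ τ)) t)).continuousAt.tendsto
    rwa [quad_zero] at this
  have hqc : Tendsto q (𝓝 0) (𝓝 (extChartAt 𝓘(ℝ, E) c' (γ t))) := by
    have := (analyticAt_quad (extChartAt 𝓘(ℝ, E) c' (γ t))
      (deriv (fun τ ↦ extChartAt 𝓘(ℝ, E) c' (γ τ)) t)
      (deriv (deriv fun τ ↦ extChartAt 𝓘(ℝ, E) c' (γ τ)) t)).continuousAt.tendsto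
    rwa [quad_zero] at this
  have hθp : Tendsto (fun z ↦ transition c c' (p z)) (𝓝 0) (𝓝 (extChartAt 𝓘(ℝ, E) c' (γ t))) := by
    have := hθ.continuousAt.tendsto.comp hpc
    rwa [hθt] at this
  filter_upwards [h1, hpc.eventually_mem ((isOpen_transitionDomain c c').mem_nhds hD),
    hqc.eventually_mem (Metric.ball_mem_nhds _ hr),
    hθp.eventually_mem (Metric.ball_mem_nhds _ hr)] with z k1 k2 k3 k4
  have k5 := (hcomp _ k4 _ k3).2.1
  rw [symm_transition k2] at k5
  change dist ((extChartAt 𝓘(ℝ, E) c).symm (p z)) ((extChartAt 𝓘(ℝ, E) c').symm (q z)) ≤ _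
  refine k5.trans ?_
  rw [norm_sub_rev]
  calc _ ≤ κ * (ε / κ * ‖z‖ ^ 2) := by gcongr
    _ = ε * ‖z‖ ^ 2 := by field_simp

/-- The variation of a curve in the direction of `f` times `J` applied to its velocity, to second order. -/
def variation (E : Type*) [NormedAddCommGroup E] [NormedSpace ℂ E] {M : Type*} [TopologicalSpace M]
    [ChartedSpace E M] (γ : ℝ → M) (f : ℝ → ℝ) (s t : ℝ) : M :=
  jetPoint E (γ t) γ t (Complex.I * (s * f t : ℝ))

theorem variation_of_eq_zero {γ : ℝ → M} {f : ℝ → ℝ} {t : ℝ} (h : f t = 0) (s : ℝ) :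
    variation E γ f s t = γ t := by
  rw [variation, h]
  simp [jetPoint_zero (E := E) (mem_extChartAt_source (I := 𝓘(ℝ, E)) (γ t))]

/-- The distance between the points at `a` and `b` of the variation of `γ` is at most
`b - a + β s ^ 2 + o(s ^ 2)`. -/
def VariationBound (E : Type*) [NormedAddCommGroup E] [NormedSpace ℂ E] {M : Type*} [MetricSpace M]
    [ChartedSpace E M] (γ : ℝ → M) (f : ℝ → ℝ) (a b β : ℝ) : Prop :=
  ∀ ε > 0, ∀ᶠ s in 𝓝[>] (0 : ℝ),
    dist (variation E γ f s a) (variation E γ f s b) ≤ (b - a) + s ^ 2 * (β + ε)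

theorem VariationBound.mono {γ : ℝ → M} {f : ℝ → ℝ} {a b β β' : ℝ}
    (h : VariationBound E γ f a b β) (hβ : β ≤ β') : VariationBound E γ f a b β' := by
  intro ε hε
  filter_upwards [h ε hε] with s hs
  refine hs.trans ?_
  gcongr

/-- The triangle inequality suffices because the varied point at time b is the same in both
estimates, being defined by the chart centred at γ b. -/
theorem VariationBound.trans {γ : ℝ → M} {f : ℝ → ℝ} {a b c β β' : ℝ}
    (h : VariationBound E γ f a b β) (h' : VariationBound E γ f b c β') :
    VariationBound E γ f a c (β + β') := by
  intro ε hε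
  filter_upwards [h (ε / 2) (half_pos hε), h' (ε / 2) (half_pos hε)] with s hs hs'
  have := dist_triangle (variation E γ f s a) (variation E γ f s b) (variation E γ f s c)
  linarith

theorem VariationBound.refl (γ : ℝ → M) (f : ℝ → ℝ) (a : ℝ) : VariationBound E γ f a a 0 := by
  intro ε hε
  filter_upwards with s
  simp only [dist_self, sub_self, zero_add]
  positivity

/-- At z = i s f the linear term becomes s f Jx'. Since z² = -s²f² and x'' = -Γ(x', x'), the
quadratic term becomes that of `varPoint`, which does not involve f'. -/
theorem jetPoint_eq_varPoint {γ : ℝ → M} (hγ : Isometry γ) {c : M} {t : ℝ}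
    (hc : γ t ∈ (extChartAt 𝓘(ℝ, E) c).source) (s f f' : ℝ) :
    jetPoint E c γ t (Complex.I * (s * f : ℝ)) = (extChartAt 𝓘(ℝ, E) c).symm
      (varPoint c (s, (extChartAt 𝓘(ℝ, E) c (γ t),
        deriv (fun τ ↦ extChartAt 𝓘(ℝ, E) c (γ τ)) t, f, f'))) := by
  rw [jetPoint, (hasDerivAt_deriv_of_isometry hγ hc).2.1.deriv]
  congr 1
  simp only [quad, varPoint, christoffelL_apply, smul_neg, ← Complex.coe_smul]
  rw [mul_pow, Complex.I_sq]
  push_cast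
  module

/-- The variation uses a different chart at each time; on a short interval it may be computed in one
fixed chart, at a cost o(s²) that `VariationBound` tolerates. -/
theorem eventually_dist_variation_jetPoint_le {γ : ℝ → M} (hγ : Isometry γ) {c : M} {t : ℝ}
    (hc : γ t ∈ (extChartAt 𝓘(ℝ, E) c).source) (f : ℝ → ℝ) {ε : ℝ} (hε : 0 < ε) :
    ∀ᶠ s in 𝓝[>] (0 : ℝ), dist (variation E γ f s t)
      (jetPoint E c γ t (Complex.I * (s * f t : ℝ))) ≤ ε * s ^ 2 := by
  have hε' : 0 < ε / (f t ^ 2 + 1) := by positivity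
  have h1 := eventually_dist_jetPoint_le hγ (mem_extChartAt_source (I := 𝓘(ℝ, E)) (γ t)) hc hε'
  have h2 : Tendsto (fun s : ℝ ↦ Complex.I * (s * f t : ℝ)) (𝓝[>] 0) (𝓝 0) := by
    refine Tendsto.mono_left ?_ nhdsWithin_le_nhds
    have : Continuous fun s : ℝ ↦ Complex.I * (s * f t : ℝ) := by fun_prop
    simpa using this.tendsto 0
  filter_upwards [h2.eventually h1] with s hs
  refine hs.trans ?_
  rw [norm_mul, Complex.norm_I, one_mul, Complex.norm_real, Real.norm_eq_abs, sq_abs, mul_pow,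
    div_mul_eq_mul_div, div_le_iff₀ (by positivity)]
  nlinarith [mul_nonneg hε.le (sq_nonneg s)]

/-- The second variation of length near a point of a line. -/
theorem exists_variationBound (hK : IsKahler E M) (hH : PositiveHolSecCurvature E M) {γ : ℝ → M}
    (hγ : Isometry γ) (t₀ : ℝ) :
    ∃ κ > 0, ∃ δ > 0, ∀ f f' : ℝ → ℝ, (∀ t, HasDerivAt f (f' t) t) → Continuous f' →
      ∀ a b, a ≤ b → Icc a b ⊆ Ioo (t₀ - δ) (t₀ + δ) →
        VariationBound E γ f a b (∫ t in a..b, (f' t ^ 2 - κ * f t ^ 2) / 2) := by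
  set c := γ t₀ with hc
  have hsrc : γ t₀ ∈ (extChartAt 𝓘(ℝ, E) c).source := mem_extChartAt_source _
  set x : ℝ → E := fun τ ↦ extChartAt 𝓘(ℝ, E) c (γ τ) with hx
  have hev : ∀ᶠ t in 𝓝 t₀, γ t ∈ (extChartAt 𝓘(ℝ, E) c).source :=
    hγ.continuous.continuousAt.eventually_mem ((isOpen_extChartAt_source c).mem_nhds hsrc)
  obtain ⟨δ₁, hδ₁, hev⟩ := Metric.eventually_nhds_iff_ball.1 hev
  rw [Real.ball_eq_Ioo] at hev
  have ht₀ : t₀ ∈ Ioo (t₀ - δ₁) (t₀ + δ₁) := ⟨by linarith, by linarith⟩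
  have hg : ∀ t ∈ Ioo (t₀ - δ₁) (t₀ + δ₁), HasDerivAt x (deriv x t) t ∧
      HasDerivAt (deriv x) (-christoffel c (x t) (deriv x t) (deriv x t)) t ∧
      metricInChart c (x t) (deriv x t) (deriv x t) = 1 := fun t ht ↦
    have h := hasDerivAt_deriv_of_isometry hγ (hev t ht)
    ⟨h.1.self_of_nhds, h.2⟩
  have hxU : MapsTo x (Ioo (t₀ - δ₁) (t₀ + δ₁)) (extChartAt 𝓘(ℝ, E) c).target :=
    fun t ht ↦ (extChartAt 𝓘(ℝ, E) c).map_source (hev t ht)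
  have hcont : ContinuousOn (fun t ↦ holSecInChart c (x t) (deriv x t))
      (Ioo (t₀ - δ₁) (t₀ + δ₁)) :=
    continuousOn_holSecInChart (fun t ht ↦ (hg t ht).1.continuousAt.continuousWithinAt)
      (fun t ht ↦ (hg t ht).2.1.continuousAt.continuousWithinAt) hxU
  have hpos : 0 < holSecInChart c (x t₀) (deriv x t₀) := by
    have h1 := (hg t₀ ht₀).2.2
    simp only [hx] at h1 ⊢
    rw [← hc, hK.holSecInChart_center]
    rw [← hc, metricInChart_center] at h1
    refine hH c _ ?_
    have h2 : ‖(show TangentSpace 𝓘(ℝ, E) c from deriv x t₀)‖ ^ 2 = 1 := by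
      rw [← real_inner_self_eq_norm_sq]; exact h1
    exact (pow_eq_one_iff_of_nonneg (norm_nonneg _) two_ne_zero).1 h2
  -- Half of the positive curvature at t₀ remains a lower bound nearby, by continuity.
  set κ := holSecInChart c (x t₀) (deriv x t₀) / 2 with hκ
  have hlt : ∀ᶠ t in 𝓝 t₀, κ < holSecInChart c (x t) (deriv x t) :=
    ((hcont t₀ ht₀).continuousAt (isOpen_Ioo.mem_nhds ht₀)).tendsto.eventually_const_lt
      (by rw [hκ]; linarith)
  obtain ⟨δ₂, hδ₂, hlt⟩ := Metric.eventually_nhds_iff_ball.1 hlt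
  rw [Real.ball_eq_Ioo] at hlt
  refine ⟨κ, by positivity, min δ₁ δ₂, lt_min hδ₁ hδ₂, fun f f' hf hf' a b hab hsub ε hε ↦ ?_⟩
  have hsub₁ : Icc a b ⊆ Ioo (t₀ - δ₁) (t₀ + δ₁) := hsub.trans
    (Ioo_subset_Ioo (by linarith [min_le_left δ₁ δ₂]) (by linarith [min_le_left δ₁ δ₂]))
  have hsub₂ : Icc a b ⊆ Ioo (t₀ - δ₂) (t₀ + δ₂) := hsub.trans
    (Ioo_subset_Ioo (by linarith [min_le_right δ₁ δ₂]) (by linarith [min_le_right δ₁ δ₂]))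
  have ha := hev a (hsub₁ (left_mem_Icc.2 hab))
  have hb := hev b (hsub₁ (right_mem_Icc.2 hab))
  -- The error is split in three: the second variation in the chart and the change of chart at each
  -- endpoint.
  have h1 := eventually_dist_varPoint_le hK hab (hxU.mono_left hsub₁)
    (fun t ht ↦ (hg t (hsub₁ ht)).1) (fun t ht ↦ (hg t (hsub₁ ht)).2.1)
    (fun t ht ↦ (hg t (hsub₁ ht)).2.2) hf hf' (fun t ht ↦ (hlt t (hsub₂ ht)).le)
    (by positivity : 0 < ε / 3)
  filter_upwards [h1, eventually_dist_variation_jetPoint_le hγ ha f (by positivity : 0 < ε / 3),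
    eventually_dist_variation_jetPoint_le hγ hb f (by positivity : 0 < ε / 3)] with s k1 k2 k3
  rw [jetPoint_eq_varPoint hγ ha s (f a) (f' a)] at k2
  rw [jetPoint_eq_varPoint hγ hb s (f b) (f' b)] at k3
  rw [dist_comm] at k3
  have k4 := dist_triangle4 _ _ _ _ |>.trans (add_le_add (add_le_add k2 k1) k3)
  linarith

/-- Subdivide [a, b] into intervals on which the local bound holds, drop the favourable curvature
terms and add up. -/
theorem variationBound_integral (hK : IsKahler E M) (hH : PositiveHolSecCurvature E M) {γ : ℝ → M}
    (hγ : Isometry γ) {f f' : ℝ → ℝ} (hf : ∀ t, HasDerivAt f (f' t) t) (hf' : Continuous f')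
    {a b : ℝ} (hab : a ≤ b) : VariationBound E γ f a b (∫ t in a..b, f' t ^ 2 / 2) := by
  choose κ hκ δ hδ h using exists_variationBound hK hH hγ
  have hfc : Continuous f := continuous_iff_continuousAt.2 fun t ↦ (hf t).continuousAt
  have hi : ∀ a b, IntervalIntegrable (fun t ↦ f' t ^ 2 / 2) volume a b :=
    fun a b ↦ Continuous.intervalIntegrable (by fun_prop) _ _
  obtain ⟨t, ht0, htm, ⟨m, hm⟩, ht⟩ := exists_monotone_Icc_subset_open_cover_Icc hab
    (c := fun t₀ : ℝ ↦ (Subtype.val ⁻¹' Ioo (t₀ - δ t₀) (t₀ + δ t₀) : Set (Icc a b)))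
    (fun t₀ ↦ isOpen_Ioo.preimage continuous_subtype_val)
    (fun t _ ↦ mem_iUnion.2 ⟨t, by linarith [hδ t], by linarith [hδ t]⟩)
  have key : ∀ n, VariationBound E γ f a (t n) (∫ τ in a..(t n), f' τ ^ 2 / 2) := by
    intro n
    induction n with
    | zero => rw [ht0, intervalIntegral.integral_same]; exact VariationBound.refl γ f a
    | succ n ih =>
      obtain ⟨t₀, hsub⟩ := ht n
      have hle : (t n : ℝ) ≤ t (n + 1) := htm n.le_succ
      have h1 := h t₀ f f' hf hf' (t n) (t (n + 1)) hle fun τ hτ ↦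
        hsub (a := ⟨τ, (t n).2.1.trans hτ.1, hτ.2.trans (t (n + 1)).2.2⟩) ⟨hτ.1, hτ.2⟩
      rw [← intervalIntegral.integral_add_adjacent_intervals (hi a (t n)) (hi _ (t (n + 1)))]
      refine ih.trans (h1.mono (intervalIntegral.integral_mono_on hle
        (Continuous.intervalIntegrable (by fun_prop) _ _) (hi _ _) fun τ _ ↦ ?_))
      nlinarith [mul_nonneg (hκ t₀).le (sq_nonneg (f τ))]
  have := key m
  rwa [hm m le_rfl] at this

/-- A Kähler manifold with positive holomorphic sectional curvature contains no line. -/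
theorem not_isometry_of_positive (hK : IsKahler E M) (hH : PositiveHolSecCurvature E M)
    (γ : ℝ → M) : ¬ Isometry γ := by
  intro hγ
  obtain ⟨κ, hκ, δ, hδ, hloc⟩ := exists_variationBound hK hH hγ 0
  set d := δ / 2 with hd
  have hd0 : 0 < d := half_pos hδ
  -- L ≥ 2d gives f ≥ 3/4 on [-d, d]. Lκd ≥ 9 > 8 makes the total bound 4/L - κd/2 negative: 4/L
  -- bounds the integral of f'²/2 over [-L, L], and κd/2 is the curvature gain on [-d, d].
  set L := 2 * d + 9 / (κ * d) with hL
  have hL0 : 0 < L := by positivity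
  have hLd : 2 * d ≤ L := by rw [hL]; linarith [show 0 < 9 / (κ * d) by positivity]
  have hLκ : 9 ≤ L * (κ * d) := by
    rw [← div_le_iff₀ (by positivity)]; linarith
  set f : ℝ → ℝ := fun t ↦ 1 - t ^ 2 / L ^ 2 with hf
  set f' : ℝ → ℝ := fun t ↦ -(2 * t / L ^ 2) with hf'
  have hfd : ∀ t, HasDerivAt f (f' t) t := fun t ↦ by
    have := (((hasDerivAt_id t).pow 2).div_const (L ^ 2)).const_sub 1
    simpa using this
  have hf'c : Continuous f' := by fun_prop
  have hfc : Continuous f := by fun_prop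
  have h1 := variationBound_integral hK hH hγ hfd hf'c (show -L ≤ -d by linarith)
  have h2 := hloc f f' hfd hf'c (-d) d (by linarith)
    (Icc_subset_Ioo (by linarith) (by linarith))
  have h3 := variationBound_integral hK hH hγ hfd hf'c (show d ≤ L by linarith)
  have h4 := (h1.trans h2).trans h3
  have hb : ∀ t ∈ Icc (-L) L, f' t ^ 2 / 2 ≤ 2 / L ^ 2 := by
    intro t ht
    have : t ^ 2 ≤ L ^ 2 := sq_le_sq' ht.1 ht.2
    have e : f' t ^ 2 / 2 = 2 * t ^ 2 / L ^ 4 := by simp only [hf']; field_simp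
    rw [e, div_le_div_iff₀ (by positivity) (by positivity)]
    nlinarith [sq_nonneg L]
  have hq : ∀ t ∈ Icc (-d) d, 1 / 2 ≤ f t ^ 2 := by
    intro t ht
    have e1 : t ^ 2 ≤ d ^ 2 := sq_le_sq' ht.1 ht.2
    have e2 : t ^ 2 / L ^ 2 ≤ 1 / 4 := by
      rw [div_le_iff₀ (by positivity)]; nlinarith
    have e3 : 3 / 4 ≤ f t := by simp only [hf]; linarith
    nlinarith
  have i1 : ∫ t in (-L)..(-d), f' t ^ 2 / 2 ≤ (L - d) * (2 / L ^ 2) := by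
    have := intervalIntegral.integral_mono_on (show -L ≤ -d by linarith)
      (Continuous.intervalIntegrable (by fun_prop) _ _) (intervalIntegrable_const (μ := volume))
      fun t ht ↦ hb t ⟨ht.1, ht.2.trans (by linarith)⟩
    rw [intervalIntegral.integral_const, smul_eq_mul] at this
    linarith
  have i3 : ∫ t in d..L, f' t ^ 2 / 2 ≤ (L - d) * (2 / L ^ 2) := by
    have := intervalIntegral.integral_mono_on (show d ≤ L by linarith)
      (Continuous.intervalIntegrable (by fun_prop) _ _) (intervalIntegrable_const (μ := volume))
      fun t ht ↦ hb t ⟨by linarith [ht.1], ht.2⟩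
    rw [intervalIntegral.integral_const, smul_eq_mul] at this
    linarith
  have i2 : ∫ t in (-d)..d, (f' t ^ 2 - κ * f t ^ 2) / 2 ≤ (2 * d) * (2 / L ^ 2 - κ / 4) := by
    have := intervalIntegral.integral_mono_on (show -d ≤ d by linarith)
      (Continuous.intervalIntegrable (by fun_prop) _ _) (intervalIntegrable_const (μ := volume))
      (g := fun _ ↦ 2 / L ^ 2 - κ / 4) (f := fun t ↦ (f' t ^ 2 - κ * f t ^ 2) / 2)
      fun t ht ↦ by
        have e1 := hb t ⟨by linarith [ht.1], by linarith [ht.2]⟩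
        have e2 := mul_le_mul_of_nonneg_left (hq t ht) hκ.le
        linarith
    rw [intervalIntegral.integral_const, smul_eq_mul] at this
    linarith
  have e : 4 / L - κ * d / 2 < 0 := by
    rw [sub_neg, div_lt_iff₀ hL0]; linarith
  have e' : L * (2 / L ^ 2) = 2 / L := by field_simp
  have h5 := h4.mono (β' := 4 / L - κ * d / 2) (by linarith [show 4 / L = 2 * (2 / L) by ring])
  -- An error of half the size of the negative coefficient keeps it negative. As f vanishes at ±L
  -- the endpoints are fixed, so γ(-L) and γ(L) come out closer than 2L.
  obtain ⟨s, hs, hs0⟩ := ((h5 (-(4 / L - κ * d / 2) / 2) (by linarith)).and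
    self_mem_nhdsWithin).exists
  have hs0' : 0 < s := hs0
  rw [variation_of_eq_zero (by simp [hf, hL0.ne']), variation_of_eq_zero (by simp [hf, hL0.ne']),
    hγ.dist_eq, Real.dist_eq, abs_of_nonpos (by linarith)] at hs
  have := mul_neg_of_pos_of_neg (pow_pos hs0' 2)
    (show (4 / L - κ * d / 2) + -(4 / L - κ * d / 2) / 2 < 0 by linarith)
  linarith

end Line

/-! ### Length spaces: properness, and lines from distinct ends -/

section LengthSpace

/-- Any two points are joined by paths whose lengths are arbitrarily close to their distance. -/
def HasShortPaths (M : Type*) [MetricSpace M] : Prop :=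
  ∀ (x y : M) (l : ℝ), dist x y < l → ∃ γ : ℝ → M, γ 0 = x ∧ γ 1 = y ∧ ContinuousOn γ (Icc 0 1) ∧
    ∀ s s', 0 ≤ s → s ≤ s' → s' ≤ 1 → dist x (γ s) + dist (γ s) (γ s') + dist (γ s') y < l

variable {M : Type*} [MetricSpace M]

theorem HasShortPaths.exists_dist_eq (h : HasShortPaths M) {x y : M} {a ε : ℝ} (ha : 0 ≤ a)
    (hay : a ≤ dist x y) (hε : 0 < ε) : ∃ z, dist x z = a ∧ dist z y < dist x y - a + ε := by
  obtain ⟨γ, h0, h1, hγ, hl⟩ := h x y (dist x y + ε) (by linarith)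
  have hc : ContinuousOn (fun s ↦ dist x (γ s)) (Icc 0 1) := by fun_prop
  obtain ⟨s, hs, hsa⟩ := intermediate_value_Icc zero_le_one hc
    (show a ∈ Icc (dist x (γ 0)) (dist x (γ 1)) by rw [h0, h1, dist_self]; exact ⟨ha, hay⟩)
  have := hl s s hs.1 le_rfl hs.2
  rw [dist_self] at this
  simp only at hsa
  exact ⟨γ s, hsa, by linarith⟩

/-- **Hopf-Rinow-Cohn-Vossen**: a complete locally compact length space is proper. -/
theorem HasShortPaths.properSpace [LocallyCompactSpace M] [CompleteSpace M]
    (h : HasShortPaths M) : ProperSpace M := by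
  suffices H : ∀ (p : M) (r : ℝ), IsCompact (Metric.closedBall p r) from ⟨H⟩
  intro p
  by_contra! hbad
  set bad := {r : ℝ | ¬ IsCompact (Metric.closedBall p r)} with hbaddef
  have hnonneg : ∀ r ∈ bad, 0 ≤ r := fun r hr ↦ by
    by_contra! hneg
    exact hr (by rw [Metric.closedBall_eq_empty.2 hneg]; exact isCompact_empty)
  set R := sInf bad with hR
  have hbdd : BddBelow bad := ⟨0, hnonneg⟩
  have hR0 : 0 ≤ R := le_csInf hbad hnonneg
  have hlt : ∀ r < R, IsCompact (Metric.closedBall p r) := fun r hr ↦ by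
    by_contra hc
    exact (not_le.2 hr) (csInf_le hbdd hc)
  -- The only use of short paths here: points of the ball of radius r + ε lie within 2ε of the ball
  -- of radius r.
  have hclose : ∀ r ε : ℝ, 0 ≤ r → 0 < ε → ∀ y, dist p y ≤ r + ε →
      ∃ z ∈ Metric.closedBall p r, dist z y < 2 * ε := by
    intro r ε hr hε y hy
    rcases le_total (dist p y) r with hle | hle
    · exact ⟨y, by rwa [Metric.mem_closedBall, dist_comm], by rw [dist_self]; positivity⟩
    · obtain ⟨z, hz, hzy⟩ := h.exists_dist_eq hr hle hε
      exact ⟨z, by rw [Metric.mem_closedBall, dist_comm, hz], by linarith⟩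
  -- The infimum radius R is not bad: its ball is complete, and totally bounded by approximation
  -- from the compact balls of radius R - η.
  have hcR : IsCompact (Metric.closedBall p R) := by
    rcases hR0.eq_or_lt with h0 | h0
    · rw [← h0, Metric.closedBall_zero]; exact isCompact_singleton
    refine isCompact_iff_totallyBounded_isComplete.2
      ⟨?_, Metric.isClosed_closedBall.isComplete⟩
    rw [Metric.totallyBounded_iff]
    intro ε hε
    set η := min (ε / 4) R with hη
    have hη0 : 0 < η := lt_min (by positivity) h0
    have hηR : η ≤ R := min_le_right _ _
    have hηε : η ≤ ε / 4 := min_le_left _ _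
    obtain ⟨t, ht, hcov⟩ := Metric.totallyBounded_iff.1
      (hlt (R - η) (by linarith)).totallyBounded (ε / 2) (half_pos hε)
    refine ⟨t, ht, fun y hy ↦ ?_⟩
    rw [Metric.mem_closedBall, dist_comm] at hy
    obtain ⟨z, hz, hzy⟩ := hclose (R - η) η (by linarith) hη0 y (by linarith)
    obtain ⟨w, hw, hzw⟩ := mem_iUnion₂.1 (hcov hz)
    refine mem_iUnion₂.2 ⟨w, hw, ?_⟩
    rw [Metric.mem_ball] at hzw ⊢
    linarith [dist_triangle_left y w z]
  -- By local compactness a thickening of this ball is compact, so slightly larger radii are not bad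
  -- either, which contradicts the choice of R.
  obtain ⟨δ, hδ, hcδ⟩ := hcR.exists_isCompact_cthickening
  have hcR' : ∀ r < R + δ / 2, IsCompact (Metric.closedBall p r) := by
    intro r hr
    refine hcδ.of_isClosed_subset Metric.isClosed_closedBall fun y hy ↦ ?_
    rw [Metric.mem_closedBall, dist_comm] at hy
    obtain ⟨z, hz, hzy⟩ := hclose R (δ / 2) hR0 (by positivity) y (by linarith)
    exact Metric.mem_cthickening_of_dist_le y z δ _ hz (by rw [dist_comm]; linarith)
  obtain ⟨r, hr, hrlt⟩ := exists_lt_of_csInf_lt hbad (show sInf bad < R + δ / 2 by linarith)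
  exact hr (hcR' r hrlt)

/-- Between two far away points in different components of the complement of `K` there is an
almost isometric curve through `K`. -/
theorem HasShortPaths.exists_almost_isometry (h : HasShortPaths M) {K : Set M} {p : M} {R : ℝ}
    (hR : K ⊆ Metric.closedBall p R) {x y : M}
    (hxy : y ∉ connectedComponentIn Kᶜ x) {n η : ℝ} (hn : 0 ≤ n) (hη : 0 < η)
    (hpx : R + n ≤ dist p x) (hpy : R + n + η ≤ dist p y) :
    ∃ f : ℝ → M, f 0 ∈ K ∧
      ∀ s ∈ Icc (-n) n, ∀ t ∈ Icc (-n) n, |dist (f s) (f t) - dist s t| ≤ η := by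
  obtain ⟨γ, h0, h1, hγ, hl⟩ := h x y (dist x y + η) (by linarith)
  -- A path avoiding K would put y in the component of x.
  have hmeet : ∃ s₀ ∈ Icc (0 : ℝ) 1, γ s₀ ∈ K := by
    by_contra! hno
    refine hxy ?_
    have hsub : γ '' Icc 0 1 ⊆ connectedComponentIn Kᶜ x :=
      (isPreconnected_Icc.image γ hγ).subset_connectedComponentIn
        ⟨0, by simp, h0⟩ (by rintro _ ⟨s, hs, rfl⟩; exact hno s hs)
    exact hsub ⟨1, by simp, h1⟩
  obtain ⟨s₀, hs₀, hk⟩ := hmeet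
  set k := γ s₀ with hkdef
  have hpk : dist p k ≤ R := by
    have := hR hk
    rwa [Metric.mem_closedBall, dist_comm] at this
  set a := dist x k with ha
  have han : n ≤ a := by linarith [dist_triangle_right p x k]
  -- The extra η on the side of y pays for the excess length of the path, so the distance from x
  -- still covers the whole range from a - n to a + n.
  have hbn : n + η ≤ dist k y := by linarith [dist_triangle p k y]
  have hab : a + n ≤ dist x y := by
    have := hl s₀ s₀ hs₀.1 le_rfl hs₀.2
    rw [dist_self] at this
    linarith
  have hc : ContinuousOn (fun s ↦ dist x (γ s)) (Icc 0 1) := by fun_prop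
  -- Parametrise by the distance from x, shifted so that 0 corresponds to the crossing. Parameters
  -- need not be unique, so at t = 0 the point in K is imposed.
  have hex : ∀ t ∈ Icc (-n) n, ∃ s ∈ Icc (0 : ℝ) 1, dist x (γ s) = a + t ∧ (t = 0 → s = s₀) := by
    intro t ht
    by_cases ht0 : t = 0
    · exact ⟨s₀, hs₀, by rw [ht0, add_zero], fun _ ↦ rfl⟩
    · obtain ⟨s, hs, hsa⟩ := intermediate_value_Icc zero_le_one hc
        (show a + t ∈ Icc (dist x (γ 0)) (dist x (γ 1)) by
          rw [h0, h1, dist_self]; exact ⟨by linarith [ht.1], by linarith [ht.2]⟩)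
      exact ⟨s, hs, hsa, fun h ↦ absurd h ht0⟩
  choose! σ hσ hσa hσ0 using hex
  -- On a path with excess less than η, the distance between two points and the difference of their
  -- distances from x agree up to η.
  have hle : ∀ s ∈ Icc (0 : ℝ) 1, ∀ s' ∈ Icc (0 : ℝ) 1, s ≤ s' →
      |dist (γ s) (γ s') - dist (dist x (γ s)) (dist x (γ s'))| ≤ η := by
    intro s hs s' hs' hss
    have e1 := hl s s' hs.1 hss hs'.2
    have e2 := dist_triangle x (γ s') y
    have e3 := abs_dist_sub_le (γ s) (γ s') x
    rw [dist_comm _ x, dist_comm _ x] at e3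
    have e4 := neg_le_abs (dist x (γ s) - dist x (γ s'))
    rw [Real.dist_eq, abs_le]
    constructor <;> linarith
  refine ⟨fun t ↦ γ (σ t), ?_, fun s hs t ht ↦ ?_⟩
  · have : (0 : ℝ) ∈ Icc (-n) n := ⟨by linarith, hn⟩
    simp only [hσ0 0 this rfl]
    exact hk
  · have key : |dist (γ (σ s)) (γ (σ t)) - dist (dist x (γ (σ s))) (dist x (γ (σ t)))| ≤ η := by
      rcases le_total (σ s) (σ t) with hst | hst
      · exact hle _ (hσ s hs) _ (hσ t ht) hst
      · rw [dist_comm, dist_comm (dist x _)]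
        exact hle _ (hσ t ht) _ (hσ s hs) hst
    rwa [hσa s hs, hσa t ht, dist_add_left] at key

/-- Limits of almost isometric curves through a bounded set are lines. -/
theorem exists_isometry_of_almost_isometry [ProperSpace M] {K : Set M} (hK : Bornology.IsBounded K)
    (h : ∀ n : ℕ, ∃ f : ℝ → M, f 0 ∈ K ∧ ∀ s ∈ Icc (-n : ℝ) n, ∀ t ∈ Icc (-n : ℝ) n,
      |dist (f s) (f t) - dist s t| ≤ 1 / ((n : ℝ) + 1)) :
    ∃ γ : ℝ → M, Isometry γ := by
  choose f hf0 hf using h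
  obtain ⟨R, hR⟩ := hK.subset_closedBall (f 0 0)
  have hev : ∀ t : ℝ, ∀ᶠ n : ℕ in atTop, t ∈ Icc (-n : ℝ) n := by
    intro t
    filter_upwards [eventually_ge_atTop ⌈|t|⌉₊] with n hn
    have : |t| ≤ n := (Nat.le_ceil _).trans (by exact_mod_cast hn)
    exact abs_le.1 this
  -- An ultrafilter provides limits for all t at once, with no diagonal subsequence; the curves need
  -- not be continuous, since the limit is isometric anyway.
  have hU : (↑(hyperfilter ℕ) : Filter ℕ) ≤ atTop := Nat.hyperfilter_le_atTop
  have hlim : ∀ t : ℝ, ∃ y, Tendsto (fun n ↦ f n t) (hyperfilter ℕ) (𝓝 y) := by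
    intro t
    have hmem : ∀ᶠ n in (hyperfilter ℕ : Filter ℕ),
        f n t ∈ Metric.closedBall (f 0 0) (R + |t| + 1) := by
      filter_upwards [hU (hev t), hU (hev 0)] with n hn hn0
      have h1 := (abs_le.1 (hf n t hn 0 hn0)).2
      have h2 := hR (hf0 n)
      have h3 : 1 / ((n : ℝ) + 1) ≤ 1 := by
        rw [div_le_one (by positivity)]; linarith [n.cast_nonneg (α := ℝ)]
      rw [Metric.mem_closedBall] at h2 ⊢
      rw [Real.dist_eq, sub_zero] at h1
      linarith [dist_triangle (f n t) (f n 0) (f 0 0)]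
    obtain ⟨y, -, hy⟩ := (isCompact_closedBall (f 0 0) (R + |t| + 1)).ultrafilter_le_nhds'
      ((hyperfilter ℕ).map fun n ↦ f n t) hmem
    exact ⟨y, hy⟩
  choose γ hγ using hlim
  refine ⟨γ, Isometry.of_dist_eq fun s t ↦ ?_⟩
  refine tendsto_nhds_unique ((hγ s).dist (hγ t)) ?_
  rw [tendsto_iff_dist_tendsto_zero]
  have h0 : Tendsto (fun n : ℕ ↦ 1 / ((n : ℝ) + 1)) (hyperfilter ℕ) (𝓝 0) :=
    tendsto_one_div_add_atTop_nhds_zero_nat.mono_left hU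
  refine squeeze_zero' (Eventually.of_forall fun _ ↦ dist_nonneg) ?_ h0
  filter_upwards [hU (hev s), hU (hev t)] with n hs ht
  exact hf n s hs t ht

/-- A proper length space with two distinct ends contains a line. -/
theorem HasShortPaths.exists_isometry_of_ends [ProperSpace M] (h : HasShortPaths M)
    (K : CompactExhaustion M) (hK : ¬ (ends K).Subsingleton) : ∃ γ : ℝ → M, Isometry γ := by
  rw [Set.not_subsingleton_iff] at hK
  obtain ⟨V, hV, W, hW, hVW⟩ := hK
  obtain ⟨l, hl⟩ := Function.ne_iff.1 hVW
  obtain ⟨⟨x, hx, hVx⟩, hVc⟩ := hV.2 l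
  obtain ⟨⟨y, hy, hWy⟩, hWc⟩ := hW.2 l
  obtain ⟨R, hR⟩ := (K.isCompact l).isBounded.subset_closedBall x
  -- By properness, a set that is not relatively compact contains points arbitrarily far from x.
  have hfar : ∀ S : Set M, ¬ IsCompact (closure S) → ∀ r : ℝ, ∃ z ∈ S, r ≤ dist x z := by
    intro S hS r
    by_contra! hno
    refine hS ((isCompact_closedBall x r).closure_of_subset fun z hz ↦ ?_)
    rw [Metric.mem_closedBall, dist_comm]
    exact (hno z hz).le
  refine exists_isometry_of_almost_isometry (K.isCompact l).isBounded fun n ↦ ?_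
  obtain ⟨x', hx', hx'd⟩ := hfar _ hVc (R + n)
  obtain ⟨y', hy', hy'd⟩ := hfar _ hWc (R + n + 1 / ((n : ℝ) + 1))
  rw [hVx] at hx'
  rw [hWy] at hy'
  refine h.exists_almost_isometry hR (x := x') (y := y') (fun hmem ↦ hl ?_)
    n.cast_nonneg (by positivity) hx'd hy'd
  rw [hVx, hWy, connectedComponentIn_eq hx', connectedComponentIn_eq hmem,
    ← connectedComponentIn_eq hy']

end LengthSpace

/-! ### Riemannian manifolds as length spaces, and the theorem -/

section Conclusion

/-- Length is additive over the three pieces cut out by s and s', and each piece is at least as long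
as its chord. -/
theorem hasShortPaths (E : Type*) [NormedAddCommGroup E] [NormedSpace ℂ E]
    [FiniteDimensional ℂ E] (M : Type*) [MetricSpace M] [ChartedSpace E M]
    [IsManifold 𝓘(ℂ, E) ω M] [RiemannianBundle (fun x : M ↦ TangentSpace 𝓘(ℝ, E) x)]
    [IsContMDiffRiemannianBundle 𝓘(ℝ, E) ∞ E (fun x : M ↦ TangentSpace 𝓘(ℝ, E) x)]
    [IsRiemannianManifold 𝓘(ℝ, E) M] : HasShortPaths M := by
  intro x y l hl
  obtain ⟨γ, h0, h1, hγ, hlen⟩ := exists_path_lt (E := E) hl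
  refine ⟨γ, h0, h1, hγ.continuousOn, fun s s' hs hss hs' ↦ ?_⟩
  have e1 := edist_le_pathELength (E := E) hs (hγ.mono (Icc_subset_Icc le_rfl (hss.trans hs')))
  have e2 := edist_le_pathELength (E := E) hss (hγ.mono (Icc_subset_Icc hs hs'))
  have e3 := edist_le_pathELength (E := E) hs' (hγ.mono (Icc_subset_Icc (hs.trans hss) le_rfl))
  have e4 := (add_le_add (add_le_add e1 e2) e3).trans_lt
    (by rwa [Manifold.pathELength_add hs hss, Manifold.pathELength_add (hs.trans hss) hs'])
  rw [h0, h1, edist_dist, edist_dist, edist_dist, ← ENNReal.ofReal_add dist_nonneg dist_nonneg,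
    ← ENNReal.ofReal_add (by positivity) dist_nonneg] at e4
  exact lt_of_not_ge fun hge ↦ (not_le.2 e4) (ENNReal.ofReal_le_ofReal hge)

end Conclusion

end KahlerEnds

end

theorem theorem1p8
    {E : Type*} [NormedAddCommGroup E] [NormedSpace ℂ E] [FiniteDimensional ℂ E]
    {M : Type*} [MetricSpace M] [ChartedSpace E M] [IsManifold 𝓘(ℂ, E) ω M]
    [RiemannianBundle (fun x : M ↦ TangentSpace 𝓘(ℝ, E) x)]
    [IsContMDiffRiemannianBundle 𝓘(ℝ, E) ∞ E (fun x : M ↦ TangentSpace 𝓘(ℝ, E) x)]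
    [IsRiemannianManifold 𝓘(ℝ, E) M]
    [ConnectedSpace M] [CompleteSpace M] [NoncompactSpace M]
    (hK : KahlerEnds.IsKahler E M)
    (hH : KahlerEnds.PositiveHolSecCurvature E M)
    (K : CompactExhaustion M) :
    KahlerEnds.numEnds K < ⊤ := by
  have hE : ProperSpace E := FiniteDimensional.proper ℂ E
  have hlcM : LocallyCompactSpace M := ChartedSpace.locallyCompactSpace E M
  have hpaths := KahlerEnds.hasShortPaths E M
  have hproper : ProperSpace M := hpaths.properSpace
  -- This is stronger than finiteness: there is at most one end.
  have hsub : (KahlerEnds.ends K).Subsingleton := by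
    by_contra hns
    obtain ⟨γ, hγ⟩ := hpaths.exists_isometry_of_ends K hns
    exact KahlerEnds.not_isometry_of_positive hK hH γ hγ
  exact (Set.encard_le_one_iff_subsingleton.2 hsub).trans_lt ENat.one_lt_top
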